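/- Conventions. Fix a universe of small sets. A simplicial category is a category enriched in (small) simplicial sets, with possibly large class of objects; it is quasi-categorically enriched if its hom simplicial sets $\mathrm{Fun}_{\mathcal K}(X,Y)$ are quasi-categories. The groupoid core $gQ$ of a quasi-category $Q$ is the simplicial subset of those simplices all of whose edges are invertible; the $(\infty,1)$-core $g_*\mathcal K$ has the objects of $\mathcal K$ and hom simplicial sets $g\,\mathrm{Fun}_{\mathcal K}(X,Y)$. Let $\mathcal A$ be a small simplicial category. A weight is a simplicial functor $W\colon\mathcal A\to\mathrm{SSet}$. A projective cell complex (respectively a projective anodyne extension) is a map of weights that is a countable composite of pushouts of small coproducts of maps $\partial\Delta^n\times\mathcal A(a,-)\hookrightarrow\Delta^n\times\mathcal A(a,-)$ with $n\ge 0$ (respectively $\Lambda^{n,k}\times\mathcal A(a,-)\hookrightarrow\Delta^n\times\mathcal A(a,-)$ with $n\ge 1$, $0\le k\le n$). $W$ is flexible if $\emptyset\to W$ is a projective cell complex; $\mathrm{Flex}^{\mathcal A}\subseteq \mathrm{SSet}^{\mathcal A}$ is the full simplicial subcategory of flexible weights. A $W$-cone over a simplicial functor $F\colon\mathcal A\to\mathcal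 K$ with summit $L$ is a simplicial natural transformation $\Lambda\colon W\to\mathrm{Fun}_{\mathcal K}(L,F-)$; it displays $L$ as a $W$-weighted homotopy limit of $F$ if for every $X\in\mathcal K$ the induced map $\mathrm{Fun}_{\mathcal K}(X,L)\to\mathrm{SSet}^{\mathcal A}(W,\mathrm{Fun}_{\mathcal K}(X,F-))$ is an equivalence of quasi-categories (it has an inverse up to homotopies parametrised by the nerve of the free-living isomorphism). $\mathcal K$ has a simplicially functorial choice of flexible weighted homotopy limits of shape $\mathcal A$ if there are a simplicial functor $\{-,-\}^{\simeq}\colon(\mathrm{Flex}^{\mathcal A})^{\mathrm{op}}\times\mathcal K^{\mathcal A}\to\mathcal K$ and a family of cones $\Lambda_{W,F}\colon W\to \mathrm{Fun}_{\mathcal K}(\{W,F\}^{\simeq},F-)$, simplicially natural in $W$ and $F$, each displaying $\{W,F\}^{\simeq}$ as a $W$-weighted homotopy limit of $F$. An $\infty$-cosmos is a quasi-categorically enriched category $\mathcal K$ with a specified subcategory of isofibrations such that: (a) $\mathcal K$ has, in the simplicially enriched sense, a terminal object $1$, small products, cotensors by all small simplicial sets, limits of countable towers of isofibrations, and pullbacks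 of isofibrations along arbitrary maps; (b) isofibrations contain all isomorphisms and all maps to $1$, and are closed under pullback along arbitrary maps, small products, limits of countable towers, and Leibniz cotensors with monomorphisms of simplicial sets; and $\mathrm{Fun}_{\mathcal K}(X,p)$ is an isofibration of quasi-categories for every isofibration $p$ and object $X$. Statement. (1) For every small simplicial category $\mathcal A$, every weight $W$ on $\mathcal A$ admits a projective anodyne extension $u_W\colon W\hookrightarrow W'$ with $W'$ levelwise a Kan complex, and $W'$ is flexible if $W$ is. (2) Let $\mathcal K$ be quasi-categorically enriched, let $W$ be a flexible weight on a small simplicial category $\mathcal A$, let $u\colon W\hookrightarrow W'$ be a projective anodyne extension with $W'$ levelwise a Kan complex, and let $F\colon\mathcal A\to g_*\mathcal K$ be a simplicial functor. Every cone $\Lambda'\colon W'\to\mathrm{Fun}_{\mathcal K}(L,F-)$ that displays $L$ as a $W'$-weighted homotopy limit of $F$ in $\mathcal K$ factors through the inclusion $\mathrm{Fun}_{g_*\mathcal K}(L,F-)\subseteq\mathrm{Fun}_{\mathcal K}(L,F-)$, and the composite $\Lambda\colon W\xrightarrow{u}W'\xrightarrow{\Lambda'}\mathrm{Fun}_{g_*\mathcal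 K}(L,F-)$ displays $L$ as a $W$-weighted homotopy limit of $F$ in $g_*\mathcal K$. (3) Let $\mathcal K$ be quasi-categorically enriched and $\mathcal A$ a small simplicial category. If $\mathcal K$ has a simplicially functorial choice of flexible weighted homotopy limits of shape $\mathcal A$, then so does $g_*\mathcal K$. (4) If $\mathcal K$ is an $\infty$-cosmos, then $g_*\mathcal K$ has a simplicially functorial choice of flexible weighted homotopy limits of shape $\mathcal A$ for every small simplicial category $\mathcal A$. -/

import Mathlib

open CategoryTheory MonoidalCategory Simplicial Opposite Limits

universe w u v

namespace SimpCat

/-- The `n`-simplices of a binary product are pairs of `n`-simplices. -/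
abbrev pair {X Y : SSet.{w}} {n : SimplexCategoryᵒᵖ} (x : X.obj n) (y : Y.obj n) :
    (X ⊗ Y).obj n := (x, y)

section Basic

variable {C : Type u} [EnrichedCategory SSet.{w} C]

/-- The hom simplicial set of a simplicially enriched category. -/
abbrev Fun (X Y : C) : SSet.{w} := EnrichedCategory.Hom X Y

/-- The identity of `X`, as a (degenerate) `n`-simplex of `Fun X X`. -/
def idn (X : C) (n : SimplexCategoryᵒᵖ) : (Fun.{w} X X).obj n :=
  (eId SSet.{w} X).app n PUnit.unit

/-- Composition of `n`-simplices of hom simplicial sets, in diagrammatic order. -/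
def comp {X Y Z : C} {n : SimplexCategoryᵒᵖ} (f : (Fun.{w} X Y).obj n)
    (g : (Fun.{w} Y Z).obj n) : (Fun.{w} X Z).obj n :=
  (eComp SSet.{w} X Y Z).app n (pair f g)

lemma map_idn (X : C) {n m : SimplexCategoryᵒᵖ} (φ : n ⟶ m) :
    (Fun.{w} X X).map φ (idn X n) = idn X m :=
  (ConcreteCategory.congr_hom ((eId SSet.{w} X).naturality φ) PUnit.unit).symm

lemma map_comp {X Y Z : C} {n m : SimplexCategoryᵒᵖ} (φ : n ⟶ m)
    (f : (Fun.{w} X Y).obj n) (g : (Fun.{w} Y Z).obj n) :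
    (Fun.{w} X Z).map φ (comp f g) =
      comp ((Fun.{w} X Y).map φ f) ((Fun.{w} Y Z).map φ g) :=
  (ConcreteCategory.congr_hom ((eComp SSet.{w} X Y Z).naturality φ)
    (pair (X := Fun X Y) (Y := Fun Y Z) f g)).symm

lemma idn_comp {X Y : C} {n : SimplexCategoryᵒᵖ} (f : (Fun.{w} X Y).obj n) :
    comp (idn X n) f = f :=
  ConcreteCategory.congr_hom (NatTrans.congr_app (e_id_comp SSet.{w} X Y) n) f

lemma comp_idn {X Y : C} {n : SimplexCategoryᵒᵖ} (f : (Fun.{w} X Y).obj n) :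
    comp f (idn Y n) = f :=
  ConcreteCategory.congr_hom (NatTrans.congr_app (e_comp_id SSet.{w} X Y) n) f

lemma comp_assoc {X Y Z T : C} {n : SimplexCategoryᵒᵖ} (f : (Fun.{w} X Y).obj n)
    (g : (Fun.{w} Y Z).obj n) (h : (Fun.{w} Z T).obj n) :
    comp (comp f g) h = comp f (comp g h) :=
  ConcreteCategory.congr_hom (NatTrans.congr_app (e_assoc SSet.{w} X Y Z T) n)
    (pair (X := Fun X Y) (Y := Fun Y Z ⊗ Fun Z T) f (pair (X := Fun Y Z) (Y := Fun Z T) g h))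

end Basic

/-- A simplicially enriched category presented by its operations on `n`-simplices. -/
@[reducible]
def mkEnriched (C : Type u) (Hom : C → C → SSet.{w})
    (id : ∀ (X : C) (n : SimplexCategoryᵒᵖ), (Hom X X).obj n)
    (comp : ∀ {X Y Z : C} {n : SimplexCategoryᵒᵖ},
      (Hom X Y).obj n → (Hom Y Z).obj n → (Hom X Z).obj n)
    (map_id : ∀ (X : C) {n m : SimplexCategoryᵒᵖ} (φ : n ⟶ m),
      (Hom X X).map φ (id X n) = id X m)
    (map_comp : ∀ {X Y Z : C} {n m : SimplexCategoryᵒᵖ} (φ : n ⟶ m)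
      (f : (Hom X Y).obj n) (g : (Hom Y Z).obj n),
      (Hom X Z).map φ (comp f g) = comp ((Hom X Y).map φ f) ((Hom Y Z).map φ g))
    (id_comp : ∀ {X Y : C} {n : SimplexCategoryᵒᵖ} (f : (Hom X Y).obj n), comp (id X n) f = f)
    (comp_id : ∀ {X Y : C} {n : SimplexCategoryᵒᵖ} (f : (Hom X Y).obj n), comp f (id Y n) = f)
    (assoc : ∀ {X Y Z T : C} {n : SimplexCategoryᵒᵖ} (f : (Hom X Y).obj n)
      (g : (Hom Y Z).obj n) (h : (Hom Z T).obj n), comp (comp f g) h = comp f (comp g h)) :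
    EnrichedCategory SSet.{w} C where
  Hom := Hom
  id X :=
    { app n := ↾fun _ ↦ id X n
      naturality _ _ φ := by ext; exact (map_id X φ).symm }
  comp X Y Z :=
    { app n := ↾fun (p : (Hom X Y).obj n × (Hom Y Z).obj n) ↦ comp p.1 p.2
      naturality _ _ φ := by ext p; exact (map_comp φ p.1 p.2).symm }
  id_comp X Y := by ext n f; exact id_comp f
  comp_id X Y := by ext n f; exact comp_id f
  assoc X Y Z T := by ext n p; exact assoc p.1 p.2.1 p.2.2

/-- Simplicial functors from a small simplicial category `A` to a simplicial category `C`. They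
are wrapped in a structure because `EnrichedFunctor` carries an ordinary category structure
in which naturality is only required with respect to `0`-simplices. -/
structure SFunctor (A : Type w) [EnrichedCategory SSet.{w} A] (C : Type u)
    [EnrichedCategory SSet.{w} C] extends EnrichedFunctor SSet.{w} A C

namespace SFunctor
variable {A : Type w} [EnrichedCategory SSet.{w} A] {C : Type u} [EnrichedCategory SSet.{w} C]

/-- The action of a simplicial functor on `n`-simplices. -/
def mapS (F : SFunctor A C) {a b : A} {n : SimplexCategoryᵒᵖ} (f : (Fun.{w} a b).obj n) :
    (Fun.{w} (F.obj a) (F.obj b)).obj n :=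
  (F.map a b).app n f

lemma mapS_map (F : SFunctor A C) {a b : A} {n m : SimplexCategoryᵒᵖ} (φ : n ⟶ m)
    (f : (Fun.{w} a b).obj n) :
    F.mapS ((Fun.{w} a b).map φ f) = (Fun.{w} (F.obj a) (F.obj b)).map φ (F.mapS f) :=
  ConcreteCategory.congr_hom ((F.map a b).naturality φ) f

lemma mapS_idn (F : SFunctor A C) (a : A) (n : SimplexCategoryᵒᵖ) :
    F.mapS (idn a n) = idn (F.obj a) n :=
  ConcreteCategory.congr_hom (NatTrans.congr_app (F.map_id a) n) PUnit.unit

lemma mapS_comp (F : SFunctor A C) {a b c : A} {n : SimplexCategoryᵒᵖ}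
    (f : (Fun.{w} a b).obj n) (g : (Fun.{w} b c).obj n) :
    F.mapS (comp f g) = comp (F.mapS f) (F.mapS g) :=
  ConcreteCategory.congr_hom (NatTrans.congr_app (F.map_comp a b c) n)
    (pair (X := Fun a b) (Y := Fun b c) f g)

/-- Naturality of a family of `n`-simplices of the hom simplicial sets `Fun (F a) (G a)`. -/
def IsNatural (F G : SFunctor A C) {n : SimplexCategoryᵒᵖ}
    (x : ∀ a : A, (Fun.{w} (F.obj a) (G.obj a)).obj n) : Prop :=
  ∀ ⦃a b : A⦄ ⦃m : SimplexCategoryᵒᵖ⦄ (φ : n ⟶ m) (f : (Fun.{w} a b).obj m),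
    comp ((Fun.{w} (F.obj a) (G.obj a)).map φ (x a)) (G.mapS f) =
      comp (F.mapS f) ((Fun.{w} (F.obj b) (G.obj b)).map φ (x b))

/-- The simplicial set of simplicial natural transformations from `F` to `G`. -/
def natSSet (F G : SFunctor A C) : SSet.{w} where
  obj n := { x : ∀ a : A, (Fun.{w} (F.obj a) (G.obj a)).obj n // IsNatural F G x }
  map {n m} φ := ↾fun x ↦ ⟨fun a ↦ (Fun.{w} (F.obj a) (G.obj a)).map φ (x.1 a), by
    intro a b k ψ f
    have := x.2 (φ ≫ ψ) f
    simpa only [Functor.map_comp_apply] using this⟩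
  map_id n := by
    ext x a
    exact (Fun.{w} (F.obj a) (G.obj a)).map_id_apply _ _
  map_comp φ ψ := by
    ext x a
    exact (Fun.{w} (F.obj a) (G.obj a)).map_comp_apply _ _ _

instance : EnrichedCategory SSet.{w} (SFunctor A C) :=
  mkEnriched (SFunctor A C) natSSet
    (fun F n ↦ ⟨fun a ↦ idn (F.obj a) n, by
      intro a b m φ f
      rw [map_idn, map_idn, idn_comp, comp_idn]⟩)
    (fun {F G H n} x y ↦ ⟨fun a ↦ comp (x.1 a) (y.1 a), by
      intro a b m φ f
      rw [map_comp, map_comp, comp_assoc, y.2 φ f, ← comp_assoc, x.2 φ f, comp_assoc]⟩)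
    (fun F {n m} φ ↦ Subtype.ext (funext fun a ↦ map_idn (F.obj a) φ))
    (fun {F G H n m} φ x y ↦ Subtype.ext (funext fun a ↦ map_comp φ (x.1 a) (y.1 a)))
    (fun x ↦ Subtype.ext (funext fun a ↦ idn_comp (x.1 a)))
    (fun x ↦ Subtype.ext (funext fun a ↦ comp_idn (x.1 a)))
    (fun x y z ↦ Subtype.ext (funext fun a ↦ comp_assoc (x.1 a) (y.1 a) (z.1 a)))

/-- The component at `a` of an `n`-simplex of natural transformations. -/
def component {F G : SFunctor A C} {n : SimplexCategoryᵒᵖ} (x : (Fun.{w} F G).obj n) (a : A) :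
    (Fun.{w} (F.obj a) (G.obj a)).obj n :=
  (show natSSet F G |>.obj n from x).1 a

end SFunctor

section SSetSelf

/-- The action of an `n`-simplex of the internal hom `Fun X Y` of simplicial sets
on an `m`-simplex of `X`, along `φ : [m] ⟶ [n]`. -/
def evalS {X Y : SSet.{w}} {n m : SimplexCategoryᵒᵖ} (h : (Fun.{w} X Y).obj n) (φ : n ⟶ m)
    (x : X.obj m) : Y.obj m :=
  (show X.HomObj Y (coyoneda.obj (op n)) from h).app m φ x

/-- An `n`-simplex of the internal hom of simplicial sets, given by its action. -/
def mkHom (X Y : SSet.{w}) (n : SimplexCategoryᵒᵖ)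
    (app : ∀ m : SimplexCategoryᵒᵖ, (n ⟶ m) → X.obj m → Y.obj m)
    (nat : ∀ {m k : SimplexCategoryᵒᵖ} (ψ : m ⟶ k) (φ : n ⟶ m) (x : X.obj m),
      app k (φ ≫ ψ) (X.map ψ x) = Y.map ψ (app m φ x)) :
    (Fun.{w} X Y).obj n :=
  show X.HomObj Y (coyoneda.obj (op n)) from
    { app m φ := ↾fun x ↦ app m φ x
      naturality ψ φ := by ext x; exact nat ψ φ x }

lemma hom_ext {X Y : SSet.{w}} {n : SimplexCategoryᵒᵖ} {h k : (Fun.{w} X Y).obj n}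
    (H : ∀ (m : SimplexCategoryᵒᵖ) (φ : n ⟶ m) (x : X.obj m), evalS h φ x = evalS k φ x) :
    h = k :=
  Functor.functorHom_ext fun m φ ↦ by ext x; exact H m φ x

lemma evalS_mkHom {X Y : SSet.{w}} {n : SimplexCategoryᵒᵖ} (app nat) {m : SimplexCategoryᵒᵖ}
    (φ : n ⟶ m) (x : X.obj m) : evalS (mkHom X Y n app nat) φ x = app m φ x := rfl

lemma evalS_map {X Y : SSet.{w}} {n m k : SimplexCategoryᵒᵖ} (h : (Fun.{w} X Y).obj n)
    (ψ : n ⟶ m) (φ : m ⟶ k) (x : X.obj k) :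
    evalS ((Fun.{w} X Y).map ψ h) φ x = evalS h (ψ ≫ φ) x := rfl

lemma evalS_comp {X Y Z : SSet.{w}} {n m : SimplexCategoryᵒᵖ} (h : (Fun.{w} X Y).obj n)
    (k : (Fun.{w} Y Z).obj n) (φ : n ⟶ m) (x : X.obj m) :
    evalS (comp h k) φ x = evalS k φ (evalS h φ x) := rfl

lemma evalS_idn (X : SSet.{w}) {n m : SimplexCategoryᵒᵖ} (φ : n ⟶ m) (x : X.obj m) :
    evalS (idn X n) φ x = x := rfl

lemma map_evalS {X Y : SSet.{w}} {n m k : SimplexCategoryᵒᵖ} (h : (Fun.{w} X Y).obj n)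
    (φ : n ⟶ m) (ψ : m ⟶ k) (x : X.obj m) :
    Y.map ψ (evalS h φ x) = evalS h (φ ≫ ψ) (X.map ψ x) :=
  (ConcreteCategory.congr_hom
    ((show X.HomObj Y (coyoneda.obj (op n)) from h).naturality ψ φ) x).symm

end SSetSelf

/-- A simplicial functor presented by its action on `n`-simplices. -/
def mkEnrichedFunctor (C : Type u) [EnrichedCategory SSet.{w} C] (D : Type v)
    [EnrichedCategory SSet.{w} D] (obj : C → D)
    (map : ∀ {X Y : C} {n : SimplexCategoryᵒᵖ},
      (Fun.{w} X Y).obj n → (Fun.{w} (obj X) (obj Y)).obj n)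
    (map_map : ∀ {X Y : C} {n m : SimplexCategoryᵒᵖ} (φ : n ⟶ m) (f : (Fun.{w} X Y).obj n),
      map ((Fun.{w} X Y).map φ f) = (Fun.{w} (obj X) (obj Y)).map φ (map f))
    (map_idn : ∀ (X : C) (n : SimplexCategoryᵒᵖ), map (idn X n) = idn (obj X) n)
    (map_comp : ∀ {X Y Z : C} {n : SimplexCategoryᵒᵖ} (f : (Fun.{w} X Y).obj n)
      (g : (Fun.{w} Y Z).obj n), map (comp f g) = comp (map f) (map g)) :
    EnrichedFunctor SSet.{w} C D where
  obj := obj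
  map X Y :=
    { app n := ↾fun f ↦ map f
      naturality n m φ := by ext f; exact map_map φ f }
  map_id X := by ext n x; exact map_idn X n
  map_comp X Y Z := by ext n p; exact map_comp p.1 p.2

section Representable

variable {C : Type u} [EnrichedCategory SSet.{w} C]

/-- The covariant representable simplicial functor `Fun X -`. -/
def representable (X : C) : EnrichedFunctor SSet.{w} C SSet.{w} :=
  mkEnrichedFunctor C SSet.{w} (fun Y ↦ Fun.{w} X Y)
    (fun {Y Z n} f ↦ mkHom (Fun.{w} X Y) (Fun.{w} X Z) n
      (fun _ φ g ↦ comp g ((Fun.{w} Y Z).map φ f))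
      (fun ψ φ g ↦ by rw [map_comp, Functor.map_comp_apply]))
    (fun φ f ↦ hom_ext fun m ψ g ↦ by
      rw [evalS_map, evalS_mkHom, evalS_mkHom, Functor.map_comp_apply])
    (fun Y n ↦ hom_ext fun m φ g ↦ by
      rw [evalS_mkHom, evalS_idn, map_idn, comp_idn])
    (fun f g ↦ hom_ext fun m φ h ↦ by
      rw [evalS_mkHom, evalS_comp, evalS_mkHom, evalS_mkHom, map_comp, comp_assoc])

end Representable

section Weights

/-- Weights: simplicial functors `A ⥤ SSet`. -/
abbrev Weight (A : Type w) [EnrichedCategory SSet.{w} A] := SFunctor A SSet.{w}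

variable {A : Type w} [EnrichedCategory SSet.{w} A]

/-- The action of an `n`-simplex of `Fun a b` on an `n`-simplex of `W a`. -/
def act (W : Weight A) {a b : A} {n : SimplexCategoryᵒᵖ} (f : (Fun.{w} a b).obj n)
    (x : (W.obj a).obj n) : (W.obj b).obj n :=
  evalS (W.mapS f) (𝟙 n) x

lemma act_map (W : Weight A) {a b : A} {n m : SimplexCategoryᵒᵖ} (f : (Fun.{w} a b).obj n)
    (φ : n ⟶ m) (x : (W.obj a).obj n) :
    (W.obj b).map φ (act W f x) = act W ((Fun.{w} a b).map φ f) ((W.obj a).map φ x) := by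
  rw [act, act, SFunctor.mapS_map, map_evalS, evalS_map, Category.id_comp, Category.comp_id]

lemma evalS_mapS (W : Weight A) {a b : A} {n m : SimplexCategoryᵒᵖ} (f : (Fun.{w} a b).obj n)
    (φ : n ⟶ m) (x : (W.obj a).obj m) :
    evalS (W.mapS f) φ x = act W ((Fun.{w} a b).map φ f) x := by
  rw [act, SFunctor.mapS_map, evalS_map, Category.comp_id]

/-- A simplicial natural transformation between weights. -/
@[ext]
structure WeightHom (V W : Weight A) where
  app (a : A) : (V.obj a : SSet.{w}) ⟶ W.obj a
  naturality {a b : A} {n : SimplexCategoryᵒᵖ} (f : (Fun.{w} a b).obj n) (x : (V.obj a).obj n) :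
    (app b).app n (act V f x) = act W f ((app a).app n x)

/-- The underlying ordinary category of the simplicial category of weights. -/
instance : Category (Weight A) where
  Hom := WeightHom
  id V := { app a := 𝟙 (V.obj a), naturality _ _ := rfl }
  comp α β :=
    { app a := α.app a ≫ β.app a
      naturality {a b n} f x :=
        (congrArg _ (α.naturality f x)).trans (β.naturality f ((α.app a).app n x)) }

/-- The weight `U × Fun a -`. -/
def cellWeight (U : SSet.{w}) (a : A) : Weight A where
  toEnrichedFunctor := mkEnrichedFunctor A SSet.{w} (fun b ↦ U ⊗ Fun.{w} a b)
    (fun {b c n} f ↦ mkHom (U ⊗ Fun.{w} a b) (U ⊗ Fun.{w} a c) n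
      (fun _ φ p ↦ pair (Y := Fun.{w} a c) p.1 (comp p.2 ((Fun.{w} b c).map φ f)))
      (fun ψ φ p ↦ Prod.ext rfl (by
        change comp ((Fun.{w} a b).map ψ p.2) ((Fun.{w} b c).map (φ ≫ ψ) f) =
          (Fun.{w} a c).map ψ (comp p.2 ((Fun.{w} b c).map φ f))
        rw [map_comp, Functor.map_comp_apply])))
    (fun {b c n m} φ f ↦ hom_ext fun k ψ p ↦ Prod.ext rfl (by
      change comp p.2 ((Fun.{w} b c).map ψ ((Fun.{w} b c).map φ f)) =
        comp p.2 ((Fun.{w} b c).map (φ ≫ ψ) f)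
      rw [Functor.map_comp_apply]))
    (fun b n ↦ hom_ext fun m φ p ↦ Prod.ext rfl (by
      change comp p.2 ((Fun.{w} b b).map φ (idn b n)) = p.2
      rw [map_idn, comp_idn]))
    (fun {b c d n} f g ↦ hom_ext fun m φ p ↦ Prod.ext rfl (by
      change comp p.2 ((Fun.{w} b d).map φ (comp f g)) =
        comp (comp p.2 ((Fun.{w} b c).map φ f)) ((Fun.{w} c d).map φ g)
      rw [map_comp, comp_assoc]))

/-- The map `U × Fun a - ⟶ V × Fun a -` induced by `i : U ⟶ V`. -/
def cellMap {U V : SSet.{w}} (i : U ⟶ V) (a : A) : cellWeight U a ⟶ cellWeight V a where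
  app b := i ▷ Fun.{w} a b
  naturality _ _ := rfl

/-- Projective cells `∂Δ[n] × Fun a - ⟶ Δ[n] × Fun a -`, indexed by `n` and `a`. -/
def projectiveCell (p : ℕ × A) :
    cellWeight (A := A) (∂Δ[p.1] : SSet.{w}) p.2 ⟶ cellWeight Δ[p.1] p.2 :=
  cellMap ∂Δ[p.1].ι p.2

/-- Projective horns `Λ[n, k] × Fun a - ⟶ Δ[n] × Fun a -` with `n ≥ 1` and `0 ≤ k ≤ n`,
where `n = p.1.1 + 1`, `k = p.1.2` and `a = p.2`. -/
def projectiveHorn (p : (Σ n : ℕ, Fin (n + 2)) × A) :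
    cellWeight (A := A) (Λ[p.1.1 + 1, p.1.2] : SSet.{w}) p.2 ⟶ cellWeight Δ[p.1.1 + 1] p.2 :=
  cellMap Λ[p.1.1 + 1, p.1.2].ι p.2

/-- Countable composites of pushouts of coproducts of projective cells. -/
def IsProjectiveCellComplex {V W : Weight A} (i : V ⟶ W) : Prop :=
  Nonempty (HomotopicalAlgebra.RelativeCellComplex.{w}
    (fun (_ : ℕ) (p : ℕ × A) ↦ projectiveCell p) i)

/-- Countable composites of pushouts of coproducts of projective horns. -/
def IsProjectiveAnodyne {V W : Weight A} (i : V ⟶ W) : Prop :=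
  Nonempty (HomotopicalAlgebra.RelativeCellComplex.{w}
    (fun (_ : ℕ) (p : (Σ n : ℕ, Fin (n + 2)) × A) ↦ projectiveHorn p) i)

/-- A weight is flexible when the map to it from the empty weight is a projective
cell complex. -/
def IsFlexible (W : Weight A) : Prop :=
  ∃ (E : Weight A) (hE : IsInitial E), IsProjectiveCellComplex (hE.to W)

/-- The weight takes values in Kan complexes. -/
def IsLevelwiseKan (W : Weight A) : Prop := ∀ a : A, SSet.KanComplex (W.obj a)

/-- The full simplicial subcategory of `SSet^A` on the flexible weights. -/
structure Flex (A : Type w) [EnrichedCategory SSet.{w} A] where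
  weight : Weight A
  flexible : IsFlexible weight

/-- A full subcategory of a simplicial category has the same hom simplicial sets. -/
instance : EnrichedCategory SSet.{w} (Flex A) where
  Hom V W := Fun V.weight W.weight
  id V := eId SSet.{w} V.weight
  comp U V W := eComp SSet.{w} U.weight V.weight W.weight
  id_comp V W := e_id_comp SSet.{w} V.weight W.weight
  comp_id V W := e_comp_id SSet.{w} V.weight W.weight
  assoc U V W X := e_assoc SSet.{w} U.weight V.weight W.weight X.weight

end Weights

section Limits

variable {A : Type w} [EnrichedCategory SSet.{w} A] {C : Type u} [EnrichedCategory SSet.{w} C]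

/-- The simplicial functor `Fun X (F -)`. -/
def funAlong (X : C) (F : SFunctor A C) : Weight A where
  toEnrichedFunctor := F.toEnrichedFunctor.comp SSet.{w} (representable X)

lemma act_funAlong (X : C) (F : SFunctor A C) {a b : A} {n : SimplexCategoryᵒᵖ}
    (f : (Fun.{w} a b).obj n) (x : (Fun.{w} X (F.obj a)).obj n) :
    act (funAlong X F) f x = comp x (F.mapS f) := by
  change comp x ((Fun.{w} (F.obj a) (F.obj b)).map (𝟙 n) (F.mapS f)) = _
  rw [Functor.map_id_apply]

/-- A `W`-cone over `F` with summit `L`: a simplicial natural transformation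
`W ⟶ Fun L (F -)`. -/
abbrev Cone (W : Weight A) (F : SFunctor A C) (L : C) := W ⟶ funAlong L F

/-- The legs of a cone. -/
abbrev Cone.leg {W : Weight A} {F : SFunctor A C} {L : C} (c : Cone W F L) {a : A}
    {n : SimplexCategoryᵒᵖ} (x : (W.obj a).obj n) : (Fun.{w} L (F.obj a)).obj n :=
  (WeightHom.app c a).app n x

/-- The comparison map `Fun X L ⟶ Fun W (Fun X (F -))` given by postcomposition with a cone
`c : W ⟶ Fun L (F -)`; the target is the weighted limit `{W, Fun X (F -)}` in simplicial sets. -/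
def Cone.comparison {W : Weight A} {F : SFunctor A C} {L : C} (c : Cone W F L) (X : C) :
    Fun.{w} X L ⟶ Fun.{w} W (funAlong X F) where
  app n := ↾fun f ↦
    (show (SFunctor.natSSet W (funAlong X F)).obj n from
      ⟨fun a ↦ mkHom (W.obj a) (Fun.{w} X (F.obj a)) n
        (fun _ φ y ↦ comp ((Fun.{w} X L).map φ f) (c.leg y))
        (fun {m k} ψ φ y ↦ by
          have h : c.leg ((W.obj a).map ψ y) = (Fun.{w} L (F.obj a)).map ψ (c.leg y) :=
            ConcreteCategory.congr_hom ((WeightHom.app c a).naturality ψ) y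
          rw [h, map_comp, Functor.map_comp_apply]), by
        intro a b m φ g
        refine hom_ext fun k ψ y ↦ ?_
        have h : c.leg (act W ((Fun.{w} a b).map ψ g) y) =
            act (funAlong L F) ((Fun.{w} a b).map ψ g) (c.leg y) :=
          WeightHom.naturality c _ y
        rw [act_funAlong] at h
        rw [evalS_comp, evalS_comp, evalS_mapS, evalS_mapS]
        refine (act_funAlong X F _ _).trans ?_
        change comp (comp ((Fun.{w} X L).map (φ ≫ ψ) f) (c.leg y)) _ =
          comp ((Fun.{w} X L).map (φ ≫ ψ) f) (c.leg (act W ((Fun.{w} a b).map ψ g) y))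
        rw [h, comp_assoc]⟩)
  naturality n m φ := by
    ext f
    refine Subtype.ext (funext fun a ↦ hom_ext fun k ψ y ↦ ?_)
    change comp ((Fun.{w} X L).map ψ ((Fun.{w} X L).map φ f)) (c.leg y) =
      comp ((Fun.{w} X L).map (φ ≫ ψ) f) (c.leg y)
    rw [Functor.map_comp_apply]

/-- The restriction of a homotopy `X × 𝕀 ⟶ Y` along a vertex of the free-living
isomorphism `𝕀`. -/
def atVertex {X Y : SSet.{w}} (h : X ⊗ SSet.coherentIso.{w} ⟶ Y)
    (v : SSet.coherentIso.{w} _⦋0⦌) : X ⟶ Y :=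
  CartesianMonoidalCategory.lift (𝟙 X) (SSet.const v) ≫ h

/-- Equivalences of quasi-categories: maps admitting an inverse up to homotopies parametrised by
the free-living isomorphism. -/
def IsEquivalence {X Y : SSet.{w}} (f : X ⟶ Y) : Prop :=
  ∃ (g : Y ⟶ X) (h : X ⊗ SSet.coherentIso.{w} ⟶ X) (k : Y ⊗ SSet.coherentIso.{w} ⟶ Y),
    atVertex h SSet.coherentIso.x₀ = 𝟙 X ∧ atVertex h SSet.coherentIso.x₁ = f ≫ g ∧
    atVertex k SSet.coherentIso.x₀ = g ≫ f ∧ atVertex k SSet.coherentIso.x₁ = 𝟙 Y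

/-- The cone `c` displays `L` as a homotopy limit of `F` weighted by `W`. -/
def Cone.IsHomotopyLimit {W : Weight A} {F : SFunctor A C} {L : C} (c : Cone W F L) : Prop :=
  ∀ X : C, IsEquivalence (c.comparison X)

end Limits

/-- A simplicial category whose hom simplicial sets are quasi-categories. -/
class QCatEnriched (C : Type u) [EnrichedCategory SSet.{w} C] : Prop where
  quasicategory (X Y : C) : SSet.Quasicategory (Fun.{w} X Y)

section Core

/-- An edge of a simplicial set is invertible when it has a two-sided inverse
up to `2`-simplices. -/
def IsInvertible {X : SSet.{w}} (e : X _⦋1⦌) : Prop :=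
  Nonempty (SSet.Edge.mk' e).InvStruct

lemma IsInvertible.map {X Y : SSet.{w}} {e : X _⦋1⦌} (h : IsInvertible e) (f : X ⟶ Y) :
    IsInvertible (f.app _ e) :=
  h.elim fun I ↦ ⟨(I.map f).ofEq rfl⟩

lemma IsInvertible.pair {X Y : SSet.{w}} {e : X _⦋1⦌} {e' : Y _⦋1⦌} (h : IsInvertible e)
    (h' : IsInvertible e') : IsInvertible (X := X ⊗ Y) (SimpCat.pair (X := X) (Y := Y) e e') := by
  obtain ⟨I⟩ := h
  obtain ⟨J⟩ := h'
  exact ⟨{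
    inv := SSet.Edge.mk (SimpCat.pair (X := X) (Y := Y) I.inv.edge J.inv.edge)
      (Prod.ext I.inv.src_eq J.inv.src_eq) (Prod.ext I.inv.tgt_eq J.inv.tgt_eq)
    homInvId := SSet.Edge.CompStruct.mk
      (SimpCat.pair (X := X) (Y := Y) I.homInvId.simplex J.homInvId.simplex)
      (Prod.ext I.homInvId.d₂ J.homInvId.d₂) (Prod.ext I.homInvId.d₀ J.homInvId.d₀)
      (Prod.ext I.homInvId.d₁ J.homInvId.d₁)
    invHomId := SSet.Edge.CompStruct.mk
      (SimpCat.pair (X := X) (Y := Y) I.invHomId.simplex J.invHomId.simplex)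
      (Prod.ext I.invHomId.d₂ J.invHomId.d₂) (Prod.ext I.invHomId.d₀ J.invHomId.d₀)
      (Prod.ext I.invHomId.d₁ J.invHomId.d₁) }⟩

/-- The groupoid core of a quasi-category `X`: the simplicial subset of the simplices all of
whose edges are invertible. -/
def groupoidCore (X : SSet.{w}) : X.Subcomplex where
  obj n := { x | ∀ φ : n ⟶ op ⦋1⦌, IsInvertible (X.map φ x) }
  map {n m} φ x hx ψ := by
    have := hx (φ ≫ ψ)
    rwa [Functor.map_comp_apply] at this

/-- The objects of the `(∞,1)`-core `g_* C`: those of `C`. -/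
structure Core (C : Type u) where
  obj : C

variable {C : Type u} [EnrichedCategory SSet.{w} C]

lemma idn_mem_groupoidCore (X : C) (n : SimplexCategoryᵒᵖ) :
    idn X n ∈ (groupoidCore (Fun.{w} X X)).obj n := by
  intro φ
  rw [map_idn]
  exact ⟨(SSet.Edge.InvStruct.invStructId (idn X (op ⦋0⦌))).ofEq (map_idn X _)⟩

lemma comp_mem_groupoidCore {X Y Z : C} {n : SimplexCategoryᵒᵖ} {f : (Fun.{w} X Y).obj n}
    {g : (Fun.{w} Y Z).obj n} (hf : f ∈ (groupoidCore (Fun.{w} X Y)).obj n)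
    (hg : g ∈ (groupoidCore (Fun.{w} Y Z)).obj n) :
    comp f g ∈ (groupoidCore (Fun.{w} X Z)).obj n := by
  intro φ
  rw [map_comp]
  exact ((hf φ).pair (hg φ)).map (eComp SSet.{w} X Y Z)

/-- The `(∞,1)`-core `g_* C`: the hom simplicial sets are the groupoid cores of those
of `C`. -/
instance : EnrichedCategory SSet.{w} (Core C) :=
  mkEnriched (Core C) (fun X Y ↦ (groupoidCore (Fun.{w} X.obj Y.obj) : SSet.{w}))
    (fun X n ↦ ⟨idn X.obj n, idn_mem_groupoidCore X.obj n⟩)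
    (fun f g ↦ ⟨comp f.1 g.1, comp_mem_groupoidCore f.2 g.2⟩)
    (fun X {_ _} φ ↦ Subtype.ext (map_idn X.obj φ))
    (fun φ f g ↦ Subtype.ext (map_comp φ f.1 g.1))
    (fun f ↦ Subtype.ext (idn_comp f.1))
    (fun f ↦ Subtype.ext (comp_idn f.1))
    (fun f g h ↦ Subtype.ext (comp_assoc f.1 g.1 h.1))

/-- The inclusion of hom simplicial sets of the `(∞,1)`-core. -/
def Core.homInclusion (X Y : Core C) : Fun.{w} X Y ⟶ Fun.{w} X.obj Y.obj :=
  (groupoidCore (Fun.{w} X.obj Y.obj)).ι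

variable (C) in
/-- The inclusion simplicial functor `g_* C ⟶ C`. -/
def Core.inclusion : EnrichedFunctor SSet.{w} (Core C) C where
  obj X := X.obj
  map X Y := Core.homInclusion X Y
  map_id _ := rfl
  map_comp _ _ _ := rfl

variable {A : Type w} [EnrichedCategory SSet.{w} A]

/-- A diagram in `g_* C`, seen as a diagram in `C`. -/
def SFunctor.toBase (F : SFunctor A (Core C)) : SFunctor A C where
  toEnrichedFunctor := F.toEnrichedFunctor.comp SSet.{w} (Core.inclusion C)

/-- The inclusion `Fun_{g_* C} L (F -) ⟶ Fun_C L (F -)`. -/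
def funAlongInclusion (L : Core C) (F : SFunctor A (Core C)) :
    funAlong L F ⟶ funAlong L.obj F.toBase where
  app a := Core.homInclusion L (F.obj a)
  naturality f x :=
    (congrArg Subtype.val (act_funAlong L F f x)).trans
      (act_funAlong L.obj F.toBase f x.1).symm

end Core

section Choice

instance prodEnriched (C : Type u) [EnrichedCategory SSet.{w} C] (D : Type v)
    [EnrichedCategory SSet.{w} D] : EnrichedCategory SSet.{w} (C × D) :=
  mkEnriched (C × D) (fun X Y ↦ Fun.{w} X.1 Y.1 ⊗ Fun.{w} X.2 Y.2)
    (fun X n ↦ (idn X.1 n, idn X.2 n))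
    (fun f g ↦ (comp f.1 g.1, comp f.2 g.2))
    (fun X {_ _} φ ↦ Prod.ext (map_idn X.1 φ) (map_idn X.2 φ))
    (fun φ f g ↦ Prod.ext (map_comp φ f.1 g.1) (map_comp φ f.2 g.2))
    (fun f ↦ Prod.ext (idn_comp f.1) (idn_comp f.2))
    (fun f ↦ Prod.ext (comp_idn f.1) (comp_idn f.2))
    (fun f g h ↦ Prod.ext (comp_assoc f.1 g.1 h.1) (comp_assoc f.2 g.2 h.2))

/-- A simplicially functorial choice of flexible weighted homotopy limits of `A`-shaped
diagrams in `K`: a simplicial bifunctor `(Flex^A)ᵒᵖ × K^A ⟶ K` and a simplicially natural family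
of homotopy limit cones. -/
structure FlexibleHolimChoice (A : Type w) [EnrichedCategory SSet.{w} A] (K : Type u)
    [EnrichedCategory SSet.{w} K] where
  lim : EnrichedFunctor SSet.{w} ((Flex A)ᵒᵖ × SFunctor A K) K
  cone (W : Flex A) (F : SFunctor A K) : Cone W.weight F (lim.obj (op W, F))
  /-- For `α : V ⟶ W` in `Flex^A` and `κ : F ⟶ G` in `K^A`, the cone for `(V, G)` precomposed with
  the map `lim (W, F) ⟶ lim (V, G)` is `κ` composed with the cone for `(W, F)` restricted
  along `α`, for simplices `α` and `κ` of any dimension. -/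
  cone_natural {V W : Flex A} {F G : SFunctor A K} {n m : SimplexCategoryᵒᵖ}
    (α : (Fun.{w} V.weight W.weight).obj n) (κ : (Fun.{w} F G).obj n) (φ : n ⟶ m) (a : A)
    (x : (V.weight.obj a).obj m) :
    comp ((Fun.{w} (lim.obj (op W, F)) (lim.obj (op V, G))).map φ
        ((lim.map (op W, F) (op V, G)).app n
          (pair (X := Fun.{w} V.weight W.weight) (Y := Fun.{w} F G) α κ)))
      ((cone V G).leg x) =
    comp ((cone W F).leg (evalS (SFunctor.component α a) φ x))
      ((Fun.{w} (F.obj a) (G.obj a)).map φ (SFunctor.component κ a))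
  isHomotopyLimit (W : Flex A) (F : SFunctor A K) : (cone W F).IsHomotopyLimit

end Choice
section Cosmos

/-- Isofibrations of quasi-categories: inner fibrations with the right lifting property against
both inclusions of the point in the free-living isomorphism. -/
def IsQCatIsofibration {X Y : SSet.{w}} (p : X ⟶ Y) : Prop :=
  SSet.innerFibrations p ∧
  HasLiftingProperty (SSet.const SSet.coherentIso.x₀ : Δ[0] ⟶ SSet.coherentIso.{w}) p ∧
  HasLiftingProperty (SSet.const SSet.coherentIso.x₁ : Δ[0] ⟶ SSet.coherentIso.{w}) p

variable {K : Type u} [EnrichedCategory SSet.{w} K]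

/-- The `0`-arrows of a simplicial category. -/
abbrev Arr (X Y : K) := (Fun.{w} X Y) _⦋0⦌

/-- Postcomposition with a `0`-arrow. -/
def postcomp (X : K) {E B : K} (p : Arr.{w} E B) : Fun.{w} X E ⟶ Fun.{w} X B where
  app n := ↾fun f ↦ comp f ((Fun.{w} E B).map (n.unop.const _ 0).op p)
  naturality n m φ := by
    ext f
    change comp ((Fun.{w} X E).map φ f) _ = (Fun.{w} X B).map φ (comp f _)
    rw [map_comp, ← Functor.map_comp_apply]
    rfl

/-- Postcomposition with a `0`-arrow, on `n`-simplices. -/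
abbrev post {X E B : K} {n : SimplexCategoryᵒᵖ} (f : (Fun.{w} X E).obj n) (p : Arr.{w} E B) :
    (Fun.{w} X B).obj n :=
  (postcomp X p).app n f

/-- Simplicially enriched terminal objects. -/
def IsEnrichedTerminal (T : K) : Prop :=
  ∀ (X : K) (n : SimplexCategoryᵒᵖ), Nonempty (Unique ((Fun.{w} X T).obj n))

/-- Simplicially enriched products. -/
def IsEnrichedProduct {I : Type w} (B : I → K) (P : K) (π : ∀ i, Arr.{w} P (B i)) : Prop :=
  ∀ (X : K) (n : SimplexCategoryᵒᵖ),
    Function.Bijective fun (f : (Fun.{w} X P).obj n) (i : I) ↦ post f (π i)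

/-- Simplicially enriched pullbacks
```
P --g--> E
|q       |p
Y --f--> B
``` -/
structure IsEnrichedPullback {P E Y B : K} (g : Arr.{w} P E) (q : Arr.{w} P Y)
    (p : Arr.{w} E B) (f : Arr.{w} Y B) : Prop where
  comm : comp g p = comp q f
  universal (X : K) (n : SimplexCategoryᵒᵖ) (x : (Fun.{w} X E).obj n) (y : (Fun.{w} X Y).obj n) :
    post x p = post y f → ∃! z : (Fun.{w} X P).obj n, post z g = x ∧ post z q = y

/-- Simplicially enriched limits of towers `⋯ ⟶ E 2 ⟶ E 1 ⟶ E 0`. -/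
structure IsEnrichedTowerLimit (E : ℕ → K) (p : ∀ i, Arr.{w} (E (i + 1)) (E i)) (L : K)
    (π : ∀ i, Arr.{w} L (E i)) : Prop where
  comm (i : ℕ) : comp (π (i + 1)) (p i) = π i
  universal (X : K) (n : SimplexCategoryᵒᵖ) (x : ∀ i, (Fun.{w} X (E i)).obj n) :
    (∀ i, post (x (i + 1)) (p i) = x i) → ∃! z : (Fun.{w} X L).obj n, ∀ i, post z (π i) = x i

/-- The map `Fun X D ⟶ Fun U (Fun X B)` induced by `ε : U ⟶ Fun D B`, on `n`-simplices. -/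
def cotensorComparison {U : SSet.{w}} {B D : K} (ε : U ⟶ Fun.{w} D B) (X : K)
    (n : SimplexCategoryᵒᵖ) (f : (Fun.{w} X D).obj n) : (Fun.{w} U (Fun.{w} X B)).obj n :=
  mkHom U (Fun.{w} X B) n (fun m φ u ↦ comp ((Fun.{w} X D).map φ f) (ε.app m u))
    (fun {m k} ψ φ u ↦ by
      have h : ε.app k (U.map ψ u) = (Fun.{w} D B).map ψ (ε.app m u) :=
        ConcreteCategory.congr_hom (ε.naturality ψ) u
      rw [h, map_comp, Functor.map_comp_apply])

/-- `ε : U ⟶ Fun D B` displays `D` as the cotensor `B ^ U`. -/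
def IsCotensor {U : SSet.{w}} {B D : K} (ε : U ⟶ Fun.{w} D B) : Prop :=
  ∀ (X : K) (n : SimplexCategoryᵒᵖ), Function.Bijective (cotensorComparison ε X n)

/-- A `0`-arrow with a two-sided inverse. -/
def IsIsoArr {X Y : K} (f : Arr.{w} X Y) : Prop :=
  ∃ g : Arr.{w} Y X, comp f g = idn X _ ∧ comp g f = idn Y _

/-- Precomposition of an `n`-simplex of `Fun D B` with a `0`-arrow `r : D' ⟶ D`. -/
abbrev preArr {D' D B : K} {n : SimplexCategoryᵒᵖ} (r : Arr.{w} D' D)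
    (f : (Fun.{w} D B).obj n) : (Fun.{w} D' B).obj n :=
  comp ((Fun.{w} D' D).map (n.unop.const _ 0).op r) f

variable (K) in
/-- `∞`-cosmoi: simplicial categories enriched in quasi-categories with a subcategory of
isofibrations satisfying the completeness and isofibration axioms. All limits are simplicially
enriched, and isofibrations are closed under small products. -/
structure InftyCosmos where
  quasicategory (X Y : K) : SSet.Quasicategory (Fun.{w} X Y)
  IsIsofib {E B : K} (p : Arr.{w} E B) : Prop
  comp_isofib {E B D : K} (p : Arr.{w} E B) (q : Arr.{w} B D) :
    IsIsofib p → IsIsofib q → IsIsofib (comp p q)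
  exists_terminal : ∃ T : K, IsEnrichedTerminal.{w} T
  exists_product {I : Type w} (B : I → K) :
    ∃ (P : K) (π : ∀ i, Arr.{w} P (B i)), IsEnrichedProduct B P π
  exists_cotensor (U : SSet.{w}) (B : K) : ∃ (D : K) (ε : U ⟶ Fun.{w} D B), IsCotensor ε
  exists_towerLimit (E : ℕ → K) (p : ∀ i, Arr.{w} (E (i + 1)) (E i)) :
    (∀ i, IsIsofib (p i)) →
      ∃ (L : K) (π : ∀ i, Arr.{w} L (E i)), IsEnrichedTowerLimit E p L π
  exists_pullback {E Y B : K} (p : Arr.{w} E B) (f : Arr.{w} Y B) : IsIsofib p →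
    ∃ (P : K) (g : Arr.{w} P E) (q : Arr.{w} P Y), IsEnrichedPullback g q p f
  isofib_of_iso {E B : K} (p : Arr.{w} E B) : IsIsoArr p → IsIsofib p
  isofib_terminal {E T : K} (p : Arr.{w} E T) : IsEnrichedTerminal.{w} T → IsIsofib p
  isofib_pullback {P E Y B : K} (g : Arr.{w} P E) (q : Arr.{w} P Y) (p : Arr.{w} E B)
    (f : Arr.{w} Y B) : IsEnrichedPullback g q p f → IsIsofib p → IsIsofib q
  isofib_product {I : Type w} (E B : I → K) (p : ∀ i, Arr.{w} (E i) (B i)) (P Q : K)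
    (π : ∀ i, Arr.{w} P (E i)) (ρ : ∀ i, Arr.{w} Q (B i)) (r : Arr.{w} P Q) :
    IsEnrichedProduct E P π → IsEnrichedProduct B Q ρ →
    (∀ i, comp r (ρ i) = comp (π i) (p i)) → (∀ i, IsIsofib (p i)) → IsIsofib r
  isofib_towerLimit (E : ℕ → K) (p : ∀ i, Arr.{w} (E (i + 1)) (E i)) (L : K)
    (π : ∀ i, Arr.{w} L (E i)) :
    IsEnrichedTowerLimit E p L π → (∀ i, IsIsofib (p i)) → IsIsofib (π 0)
  /-- For `i : U ⟶ V` a monomorphism and `p : E ⟶ B` an isofibration, the Leibniz cotensor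
  `l : E ^ V ⟶ P = E ^ U ×_{B ^ U} B ^ V` is an isofibration. -/
  isofib_leibniz {U V : SSet.{w}} (i : U ⟶ V) [Mono i] {E B : K} (p : Arr.{w} E B)
    {EU EV BU BV P : K}
    (εEU : U ⟶ Fun.{w} EU E) (εEV : V ⟶ Fun.{w} EV E)
    (εBU : U ⟶ Fun.{w} BU B) (εBV : V ⟶ Fun.{w} BV B)
    (rE : Arr.{w} EV EU) (rB : Arr.{w} BV BU) (pU : Arr.{w} EU BU) (pV : Arr.{w} EV BV)
    (g : Arr.{w} P EU) (q : Arr.{w} P BV) (l : Arr.{w} EV P) :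
    IsIsofib p → IsCotensor εEU → IsCotensor εEV → IsCotensor εBU → IsCotensor εBV →
    (∀ n (u : U.obj n), preArr rE (εEU.app n u) = εEV.app n (i.app n u)) →
    (∀ n (u : U.obj n), preArr rB (εBU.app n u) = εBV.app n (i.app n u)) →
    (∀ n (u : U.obj n), preArr pU (εBU.app n u) = post (εEU.app n u) p) →
    (∀ n (v : V.obj n), preArr pV (εBV.app n v) = post (εEV.app n v) p) →
    IsEnrichedPullback g q pU rB → comp l g = rE → comp l q = pV → IsIsofib l
  isofib_fun (X : K) {E B : K} (p : Arr.{w} E B) :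
    IsIsofib p → IsQCatIsofibration (postcomp X p)

end Cosmos

end SimpCat

/-! The obstacle is that passing to the core does not commute with weighted limits: a cone in the
core needs every leg invertible, whereas maps from `W` into the hom quasi-categories may hit
non-invertible edges. If `W'` is levelwise Kan, this cannot happen. Every edge of `W' a` is
invertible, so every cone weighted by `W'` has legs in the groupoid core (`coneLift`). If `W'` is
moreover cofibrant, maps from `W'` into a levelwise Kan weight form a Kan complex, so the core of
the quasi-category of cones in `K` is the simplicial set of cones in `g_* K` (`coreConesIso`).

For the second assertion, the comparison map for `W` in the core factors as the core of the
comparison map for `W'`, an equivalence by `IsEquivalence.core`, followed by this isomorphism,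
followed by restriction along `u`. The restriction is a trivial fibration: `u` lifts against
levelwise Kan fibrations, and the diagram in the core has Kan hom complexes (`preFun_rlp`). The
latter is Joyal's theorem that the groupoid core of a quasi-category is a Kan complex
(`kanComplex_groupoidCore`), which rests on filling outer horns with invertible initial edge
(`exists_specialHorn_filler`).

The first assertion is the small object argument. Preservation of flexibility is the delicate point,
since horns are attached instead of boundary cells and two countable composites are stacked.
Flexibility is therefore derived from a basis: in each dimension the weight is free over `A` on
generators closed under degeneracies. Attaching cells along any simplicial subset and passing to
countable unions preserve bases, and a weight with a basis is a countable cell complex by its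
skeletal filtration (`IsBasis.isFlexible`).

For the third assertion the replacement has to be simplicially functorial, so the horns `Λ ⟶ W a`
are attached all at once, parametrised by the simplicial set `Fun Λ (W a)` (`kanData`). The given
choice of limits is then evaluated at replaced weights. Its action lands in the core because
equivalences reflect invertible edges (`IsEquivalence.isInvertible`).

For the fourth assertion, an `∞`-cosmos has strict limits weighted by flexible weights, built cell
by cell: cells give cotensors, coproducts give products, pushouts give pullbacks of isofibrations
and countable composites give limits of towers (`InftyCosmos.exists_strictLimit`). Strict limits are
functorial by their universal property and are homotopy limits, so the third assertion applies. -/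

namespace SimpCat

/-! ### Horns and boundaries described by their faces. -/

section Horns

variable {X : SSet.{w}}

/-- A horn in a quasi-category, given by a compatible family of faces, has a filler. -/
lemma exists_innerHorn_filler [SSet.Quasicategory X] {n : ℕ} (k : Fin (n + 3)) (h0 : 0 < k)
    (hk : k < Fin.last (n + 2)) (x : Fin (n + 3) → X _⦋n + 1⦌)
    (hx : ∀ i j : Fin (n + 2), i ≤ j → i.castSucc ≠ k → j.succ ≠ k →
      X.δ i (x j.succ) = X.δ j (x i.castSucc)) :
    ∃ s : X _⦋n + 2⦌, ∀ j, j ≠ k → X.δ j s = x j := by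
  have hf : SSet.horn.IsCompatible (i := k)
      (fun j (_ : j ≠ k) ↦ SSet.yonedaEquiv.symm (x j)) := by
    rw [SSet.horn.isCompatible_iff]
    intro i j hi hj hij
    obtain ⟨i, rfl⟩ := i.eq_castSucc_of_ne_last (Fin.ne_last_of_lt hij)
    obtain ⟨j, rfl⟩ := j.eq_succ_of_ne_zero (Fin.ne_zero_of_lt hij)
    apply SSet.yonedaEquiv.injective
    rw [SSet.stdSimplex.yonedaEquiv_δ_comp, SSet.stdSimplex.yonedaEquiv_δ_comp,
      Equiv.apply_symm_apply, Equiv.apply_symm_apply, Fin.pred_succ, Fin.castPred_castSucc]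
    exact (hx i j (by simpa [Fin.castSucc_lt_succ_iff] using hij) hi hj).symm
  obtain ⟨s, hs⟩ := SSet.Quasicategory.hornFilling h0 hk hf.desc
  refine ⟨SSet.yonedaEquiv s, fun j hj ↦ ?_⟩
  have := hf.ι_desc j hj
  rw [hs, SSet.horn.ι_ι_assoc] at this
  rw [← SSet.stdSimplex.yonedaEquiv_δ_comp, this, Equiv.apply_symm_apply]

/-- The indices `i'` and `j'` are tied to `i` and `j` by equations, so that numerals can be supplied
without casts. -/
lemma δ_δ {n : ℕ} (i j : Fin (n + 2)) {i' j' : Fin (n + 3)} (hij : i ≤ j)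
    (hi : i' = i.castSucc) (hj : j' = j.succ) (x : X _⦋n + 2⦌) :
    X.δ i (X.δ j' x) = X.δ j (X.δ i' x) := by
  subst hi hj
  exact ConcreteCategory.congr_hom (SimplicialObject.δ_comp_δ X hij) x

lemma δ_σ_self {n : ℕ} (i : Fin (n + 1)) (x : X _⦋n⦌) : X.δ i.castSucc (X.σ i x) = x :=
  ConcreteCategory.congr_hom (SimplicialObject.δ_comp_σ_self X (i := i)) x

lemma δ_σ_succ {n : ℕ} (i : Fin (n + 1)) (x : X _⦋n⦌) : X.δ i.succ (X.σ i x) = x :=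
  ConcreteCategory.congr_hom (SimplicialObject.δ_comp_σ_succ X (i := i)) x

lemma δ_σ_of_gt {n : ℕ} (i : Fin (n + 2)) (j : Fin (n + 1)) (hij : j.castSucc < i)
    (x : X _⦋n + 1⦌) : X.δ i.succ (X.σ j.castSucc x) = X.σ j (X.δ i x) :=
  ConcreteCategory.congr_hom (SimplicialObject.δ_comp_σ_of_gt X hij) x

end Horns

section Rlp

/-- A map with fillers for the boundaries given by compatible families of faces has the right
lifting property with respect to boundary inclusions. -/
lemma rlp_boundary_of_filler {E B : SSet.{w}} (p : E ⟶ B)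
    (h₀ : ∀ y : B _⦋0⦌, ∃ x : E _⦋0⦌, p.app _ x = y)
    (h : ∀ (n : ℕ) (y : B _⦋n + 1⦌) (x : Fin (n + 2) → E _⦋n⦌),
      (∀ j, p.app _ (x j) = B.δ j y) →
      (∀ (m : ℕ) (hm : n = m + 1) (i j : Fin (m + 2)), i ≤ j →
        E.δ i (hm ▸ x (Fin.cast (by rw [hm]) j.succ) : E _⦋m + 1⦌) =
          E.δ j (hm ▸ x (Fin.cast (by rw [hm]) i.castSucc) : E _⦋m + 1⦌)) →
      ∃ z : E _⦋n + 1⦌, p.app _ z = y ∧ ∀ j, E.δ j z = x j) :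
    SSet.modelCategoryQuillen.I.rlp p := by
  rintro _ _ _ ⟨n⟩
  constructor
  intro f b sq
  obtain _ | n := n
  · obtain ⟨x, hx⟩ := h₀ (SSet.yonedaEquiv b)
    refine ⟨⟨⟨SSet.yonedaEquiv.symm x, SSet.boundary.hom_ext₀, ?_⟩⟩⟩
    rw [SSet.yonedaEquiv_symm_comp, hx, Equiv.symm_apply_apply]
  · obtain ⟨z, hz, hz'⟩ := h n (SSet.yonedaEquiv b)
      (fun j ↦ SSet.yonedaEquiv (SSet.boundary.ι j ≫ f)) (fun j ↦ by
        rw [← SSet.yonedaEquiv_comp, ← SSet.stdSimplex.yonedaEquiv_δ_comp, Category.assoc, sq.w,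
          SSet.boundary.ι_ι_assoc]) (by
        rintro m rfl i j hij
        change E.δ i (SSet.yonedaEquiv (SSet.boundary.ι j.succ ≫ f)) =
          E.δ j (SSet.yonedaEquiv (SSet.boundary.ι i.castSucc ≫ f))
        rw [← SSet.stdSimplex.yonedaEquiv_δ_comp, ← SSet.stdSimplex.yonedaEquiv_δ_comp,
          ← Category.assoc, ← Category.assoc]
        congr 2
        rw [← cancel_mono (SSet.Subcomplex.ι _), Category.assoc, Category.assoc,
          SSet.boundary.ι_ι, SSet.boundary.ι_ι, SSet.stdSimplex.δ_comp_δ hij])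
    refine ⟨⟨⟨SSet.yonedaEquiv.symm z, SSet.boundary.hom_ext fun j ↦ ?_, ?_⟩⟩⟩
    · rw [SSet.boundary.ι_ι_assoc, SSet.stdSimplex.δ_comp_yonedaEquiv_symm, hz',
        Equiv.symm_apply_apply]
    · rw [SSet.yonedaEquiv_symm_comp, hz, Equiv.symm_apply_apply]

/-- A map with the right lifting property with respect to boundary inclusions has a section. -/
lemma exists_section_of_rlp {E B : SSet.{w}} (p : E ⟶ B)
    (hp : SSet.modelCategoryQuillen.I.rlp p) : ∃ s : B ⟶ E, s ≫ p = 𝟙 B := by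
  rw [← SSet.rlp_monomorphisms] at hp
  have : HasLiftingProperty (initial.to B) p := hp _ (inferInstanceAs (Mono (initial.to B)))
  have sq : CommSq (initial.to E) (initial.to B) p (𝟙 B) := ⟨by simp⟩
  exact ⟨sq.lift, sq.fac_right⟩

end Rlp

/-! ### Décalage, and Joyal's filling of outer horns with invertible initial edge. -/

section Decalage

/-- The functor `[n] ↦ [0] ⋆ [n]`. -/
def shift : SimplexCategory ⥤ SimplexCategory where
  obj n := ⦋n.len + 1⦌
  map {n m} φ := SimplexCategory.Hom.mk
    { toFun := Fin.cases 0 (fun i ↦ (φ.toOrderHom i).succ)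
      monotone' := by
        intro i j hij
        cases i using Fin.cases with
        | zero => exact Fin.zero_le _
        | succ i =>
          cases j using Fin.cases with
          | zero => simp at hij
          | succ j => simpa using φ.toOrderHom.monotone (Fin.succ_le_succ_iff.1 hij) }
  map_id n := by
    ext i : 3
    cases i using Fin.cases <;> rfl
  map_comp φ ψ := by
    ext i : 3
    cases i using Fin.cases <;> rfl

lemma shift_δ {n : ℕ} (i : Fin (n + 2)) :
    shift.map (SimplexCategory.δ i) = SimplexCategory.δ i.succ := by
  ext j : 3
  cases j using Fin.cases with
  | zero => rfl
  | succ j => exact (Fin.succ_succAbove_succ _ _).symm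

/-- The décalage of a simplicial set, obtained by adding an initial vertex. -/
def dec (X : SSet.{w}) : SSet.{w} := shift.op ⋙ X

lemma dec_δ (X : SSet.{w}) {n : ℕ} (i : Fin (n + 2)) (x : (dec X) _⦋n + 1⦌) :
    (dec X).δ i x = X.δ i.succ x := by
  change X.map (shift.map (SimplexCategory.δ i)).op x = _
  rw [shift_δ]
  rfl

/-- The inclusion `[n] ⟶ [0] ⋆ [n]`. -/
def shiftTail : 𝟭 SimplexCategory ⟶ shift where
  app n := SimplexCategory.δ (n := n.len) 0
  naturality _ _ _ := rfl

/-- The map `[0] ⋆ [0] ⋆ [n] ⟶ [0] ⋆ [n]` identifying the first two vertices. -/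
def shiftσ : shift ⋙ shift ⟶ shift where
  app n := SimplexCategory.σ (n := n.len + 1) 0
  naturality n m φ := by
    ext i : 3
    cases i using Fin.cases with
    | zero => rfl
    | succ i => cases i using Fin.cases <;> rfl

lemma map_op_map_op {X : SSet.{w}} {n m k l : ℕ} {f : ⦋n⦌ ⟶ ⦋m⦌} {g : ⦋m⦌ ⟶ ⦋l⦌} {h : ⦋n⦌ ⟶ ⦋k⦌}
    {i : ⦋k⦌ ⟶ ⦋l⦌} (H : f ≫ g = h ≫ i) (x : X _⦋l⦌) :
    X.map f.op (X.map g.op x) = X.map h.op (X.map i.op x) := by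
  rw [← Functor.map_comp_apply, ← Functor.map_comp_apply, ← op_comp, H, op_comp]

/-- The inclusion of the initial segment `[k]` of `[n]`. -/
def initialSegment {k n : ℕ} (h : k ≤ n) : ⦋k⦌ ⟶ ⦋n⦌ :=
  SimplexCategory.Hom.mk (Fin.castLEOrderEmb (Nat.succ_le_succ h)).toOrderHom

/-- The restriction of a simplex to its first vertices. -/
def front {X : SSet.{w}} {n : ℕ} (k : ℕ) (h : k ≤ n) (x : X _⦋n⦌) : X _⦋k⦌ :=
  X.map (initialSegment h).op x

lemma front_self {X : SSet.{w}} {n : ℕ} (x : X _⦋n⦌) : front n le_rfl x = x :=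
  X.map_id_apply _ x

lemma front_map {X : SSet.{w}} {n m k : ℕ} (hn : k ≤ n) (hm : k ≤ m) (φ : ⦋m⦌ ⟶ ⦋n⦌)
    (hφ : ∀ i : Fin (k + 1), φ.toOrderHom (Fin.castLE (Nat.succ_le_succ hm) i) =
      Fin.castLE (Nat.succ_le_succ hn) i) (x : X _⦋n⦌) :
    front k hm (X.map φ.op x) = front k hn x := by
  rw [front, front, ← Functor.map_comp_apply, ← op_comp]
  have : initialSegment hm ≫ φ = initialSegment hn := by
    ext i : 3
    exact hφ i
  rw [this]

lemma front_δ {X : SSet.{w}} {n k : ℕ} (hn : k ≤ n) (i : Fin (n + 2)) (hi : k < i.val)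
    (x : X _⦋n + 1⦌) : front k hn (X.δ i x) = front k (hn.trans n.le_succ) x := by
  refine front_map _ _ _ (fun j ↦ ?_) x
  refine Fin.succAbove_of_castSucc_lt _ _ ?_
  simp only [Fin.lt_def, Fin.val_castSucc, Fin.val_castLE]
  omega

lemma δ_front {X : SSet.{w}} {n k : ℕ} (hn : k ≤ n) (i : Fin (k + 2))
    (x : X _⦋n + 1⦌) : X.δ i (front (k + 1) (Nat.succ_le_succ hn) x) =
      front k hn (X.δ (Fin.castLE (by omega) i) x) := by
  refine map_op_map_op ?_ x
  ext j : 3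
  refine Fin.ext ?_
  change (Fin.castLE (Nat.succ_le_succ (Nat.succ_le_succ hn)) (i.succAbove j)).val =
    (Fin.succAbove (Fin.castLE (by omega) i) (Fin.castLE (Nat.succ_le_succ hn) j)).val
  simp only [Fin.succAbove, Fin.lt_def, Fin.val_castLE, Fin.val_castSucc]
  split_ifs <;> rfl

/-- Operators of an iterated décalage fix the added vertices, so prescribing the initial edge (or,
below, the initial triangle) cuts out a simplicial subset. -/
lemma shift_shift_apply {n m : SimplexCategory} (φ : n ⟶ m) (i : Fin 2) :
    (shift.map (shift.map φ)).toOrderHom (Fin.castLE (m := n.len + 3) (by omega) i) =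
      Fin.castLE (m := m.len + 3) (by omega) i := by
  fin_cases i <;> rfl

lemma shift_shift_shift_apply {n m : SimplexCategory} (φ : n ⟶ m) (i : Fin 3) :
    (shift.map (shift.map (shift.map φ))).toOrderHom
      (Fin.castLE (m := n.len + 4) (by omega) i) = Fin.castLE (m := m.len + 4) (by omega) i := by
  fin_cases i <;> rfl

/-- The simplices with prescribed initial edge, as simplices of the iterated décalage. -/
def underEdge {X : SSet.{w}} (e : X _⦋1⦌) : (dec (dec X)).Subcomplex where
  obj n := {x : X _⦋n.unop.len + 2⦌ | front 1 (by omega) x = e}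
  map {n m} φ x hx := by
    refine Eq.trans ?_ hx
    exact front_map _ _ _ (shift_shift_apply φ.unop) x

lemma δ_zero_dec {X : SSet.{w}} {n m : SimplexCategory} (φ : n ⟶ m) (x : X _⦋m.len + 3⦌) :
    X.δ 0 (X.map (shift.map (shift.map (shift.map φ))).op x : X _⦋n.len + 3⦌) =
      X.map (shift.map (shift.map φ)).op (X.δ 0 x) :=
  map_op_map_op (shiftTail.naturality (shift.map (shift.map φ))).symm x

/-- The face `δ 1` is the shift of `δ 0`, and both `δ 0` and `σ 0` are natural for shifted operators
(`shiftTail`, `shiftσ`). Hence the condition that the first face is degenerate is simplicial. -/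
lemma δ_one_eq_σ_map {X : SSet.{w}} {n m : SimplexCategory} (φ : n ⟶ m) (x : X _⦋m.len + 3⦌)
    (hx : X.δ 1 x = X.σ 0 (X.δ 0 (X.δ 0 x))) :
    X.δ 1 (X.map (shift.map (shift.map (shift.map φ))).op x : X _⦋n.len + 3⦌) =
      X.σ 0 (X.δ 0 (X.δ 0 (X.map (shift.map (shift.map (shift.map φ))).op x :
        X _⦋n.len + 3⦌))) := by
  have h₁ : X.δ 1 (X.map (shift.map (shift.map (shift.map φ))).op x : X _⦋n.len + 3⦌) =
      X.map (shift.map (shift.map φ)).op (X.δ 1 x) :=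
    map_op_map_op (f := SimplexCategory.δ 1) (i := SimplexCategory.δ 1) (by
      have := congrArg shift.map (shiftTail.naturality (shift.map φ))
      rw [shift.map_comp, shift.map_comp] at this
      refine Eq.trans ?_ (this.symm.trans ?_)
      · exact congrArg (· ≫ shift.map (shift.map (shift.map φ))) (shift_δ 0).symm
      · exact congrArg (shift.map (shift.map φ) ≫ ·) (shift_δ 0)) x
  have h₂ (y : X _⦋m.len + 2⦌) :
      X.δ 0 (X.map (shift.map (shift.map φ)).op y : X _⦋n.len + 2⦌) =
        X.map (shift.map φ).op (X.δ 0 y) :=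
    map_op_map_op (shiftTail.naturality (shift.map φ)).symm y
  have h₃ (y : X _⦋m.len + 1⦌) :
      X.σ 0 (X.map (shift.map φ).op y : X _⦋n.len + 1⦌) =
        X.map (shift.map (shift.map φ)).op (X.σ 0 y) :=
    map_op_map_op (shiftσ.naturality φ).symm y
  have h₄ := congrArg (fun y ↦ X.σ 0 (X.δ 0 y)) (δ_zero_dec φ x)
  exact h₁.trans ((congrArg (X.map (shift.map (shift.map φ)).op) hx).trans
    (((congrArg (X.σ 0) (h₂ _)).trans (h₃ _)).symm.trans h₄.symm))

/-- The simplices with prescribed initial triangle and degenerate first face, as simplices of the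
iterated décalage. -/
def underTriangle {X : SSet.{w}} (t : X _⦋2⦌) : (dec (dec (dec X))).Subcomplex where
  obj n := {x : X _⦋n.unop.len + 3⦌ | front 2 (by omega) x = t ∧
    X.δ 1 x = X.σ 0 (X.δ 0 (X.δ 0 x))}
  map {n m} φ x hx :=
    ⟨(front_map _ _ _ (shift_shift_shift_apply φ.unop) x).trans hx.1,
      δ_one_eq_σ_map φ.unop x hx.2⟩

lemma front_δ_zero {X : SSet.{w}} {n : ℕ} {t : X _⦋2⦌} {x : X _⦋n + 3⦌}
    (hx : front 2 (by omega) x = t) : front 1 (by omega) (X.δ 0 x) = X.δ 0 t := by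
  rw [← hx]
  exact (δ_front (n := n + 2) (k := 1) (by omega) 0 x).symm

/-- Dropping the initial vertex of a simplex with prescribed initial triangle. -/
def underTriangleTail {X : SSet.{w}} (t : X _⦋2⦌) :
    (underTriangle t : SSet.{w}) ⟶ underEdge (X.δ 0 t) where
  app n := ↾fun x ↦ ⟨(X.δ 0 (show X _⦋n.unop.len + 3⦌ from x.1)), front_δ_zero x.2.1⟩
  naturality n m φ := by
    ext x
    exact Subtype.ext (δ_zero_dec φ.unop x.1)

/-- Filling a horn `Λ[m + 3, 2]` with degenerate first face. -/
lemma exists_filler_two {X : SSet.{w}} [SSet.Quasicategory X] {m : ℕ} (u : X _⦋m + 2⦌)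
    (z : Fin (m + 1) → X _⦋m + 2⦌)
    (hz : ∀ i j : Fin m, i ≤ j →
      X.δ i.succ.succ.succ (z j.succ) = X.δ j.succ.succ.succ (z i.castSucc))
    (hu : ∀ j, X.δ 0 (z j) = X.δ j.succ.succ u)
    (hσ : ∀ j, X.δ 1 (z j) = X.σ 0 (X.δ 0 (X.δ 0 (z j)))) :
    ∃ s : X _⦋m + 3⦌, X.δ 0 s = u ∧ X.δ 1 s = X.σ 0 (X.δ 0 u) ∧
      ∀ j : Fin (m + 1), X.δ j.succ.succ.succ s = z j := by
  obtain ⟨s, hs⟩ := exists_innerHorn_filler (X := X) (n := m + 1) (Fin.succ 1)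
    (Fin.succ_pos _) (Fin.succ_lt_succ_iff.2 (Fin.succ_lt_succ_iff.2 (Fin.last_pos (n := m))))
    (Fin.cases u (Fin.cases (X.σ 0 (X.δ 0 u)) (Fin.cases u z))) (by
      intro i j hij hi hj
      cases j using Fin.cases with
      | zero =>
        obtain rfl : i = 0 := by simpa using hij
        exact δ_σ_self (0 : Fin (m + 2)) (X.δ 0 u)
      | succ j =>
        cases j using Fin.cases with
        | zero => exact absurd rfl hj
        | succ j =>
          cases i using Fin.cases with
          | zero => exact hu j
          | succ i =>
            cases i using Fin.cases with
            | zero =>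
              refine (hσ j).trans ?_
              rw [hu]
              rw [δ_δ (i := 0) (j := j.succ) (i' := 0) (j' := j.succ.succ) (by simp) rfl rfl]
              exact (δ_σ_of_gt (i := j.succ) (j := 0) (by simp [Fin.lt_def]) _).symm
            | succ i =>
              cases i using Fin.cases with
              | zero => exact absurd rfl hi
              | succ i =>
                cases j using Fin.cases with
                | zero => exact absurd hij (not_le.2
                    (Fin.succ_lt_succ_iff.2 (Fin.succ_lt_succ_iff.2 (Fin.succ_pos _))))
                | succ j => exact hz i j (by simpa using hij))
  exact ⟨s, hs 0 (Fin.succ_ne_zero _).symm, hs 1 fun h ↦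
    absurd (Fin.succ_injective _ (a₁ := (0 : Fin (m + 3))) (a₂ := 1) h) (by simp), fun j ↦ hs _ fun h ↦
    Fin.succ_ne_zero j (Fin.succ_injective _ (Fin.succ_injective _ h))⟩

/-- Filling a horn `Λ[m + 2, 1]`. -/
lemma exists_filler_one {X : SSet.{w}} [SSet.Quasicategory X] {m : ℕ} (y : X _⦋m + 1⦌)
    (z : Fin (m + 1) → X _⦋m + 1⦌)
    (hz : ∀ i j : Fin m, i ≤ j →
      X.δ i.succ.succ (z j.succ) = X.δ j.succ.succ (z i.castSucc))
    (hy : ∀ j, X.δ 0 (z j) = X.δ j.succ y) :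
    ∃ s : X _⦋m + 2⦌, X.δ 0 s = y ∧ ∀ j : Fin (m + 1), X.δ j.succ.succ s = z j := by
  obtain ⟨s, hs⟩ := exists_innerHorn_filler (X := X) (n := m) 1 (by simp) (by simp [Fin.lt_def])
    (Fin.cases y (Fin.cases y z)) (by
      intro i j hij hi hj
      cases j using Fin.cases with
      | zero => simp at hj
      | succ j =>
        cases i using Fin.cases with
        | zero => exact hy j
        | succ i =>
          cases i using Fin.cases with
          | zero => simp at hi
          | succ i =>
            cases j using Fin.cases with
            | zero => exact absurd hij (by simp [Fin.le_def])
            | succ j => exact hz i j (by simpa using hij))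
  exact ⟨s, hs 0 (by simp), fun j ↦ hs _ fun h ↦ Fin.succ_ne_zero j (Fin.succ_injective _ h)⟩

lemma front_eq_δ_last {X : SSet.{w}} {n : ℕ} (x : X _⦋n + 1⦌) :
    front n n.le_succ x = X.δ (Fin.last (n + 1)) x := by
  rw [← front_δ le_rfl (Fin.last (n + 1)) (by simp) x, front_self]

/-- A boundary problem in dimension `n` is an inner horn `Λ[n + 3, 2]` in `X`: face `0` is the
simplex to be lifted, face `1` is forced to be degenerate, and the faces from `3` on are the given
boundary. -/
lemma underTriangleTail_rlp {X : SSet.{w}} [SSet.Quasicategory X] (t : X _⦋2⦌)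
    (ht : X.δ 1 t = X.σ 0 (X.δ 0 (X.δ 0 t))) :
    SSet.modelCategoryQuillen.I.rlp (underTriangleTail t) := by
  refine rlp_boundary_of_filler _ ?_ ?_
  · rintro ⟨u, hu⟩
    change X _⦋2⦌ at u
    change front 1 _ u = _ at hu
    -- In dimension `0` the boundary is empty, and the remaining face `3` is the prescribed triangle
    -- `t`.
    obtain ⟨s, hs₀, hs₁, hs⟩ := exists_filler_two (m := 0) u (fun _ ↦ t) (fun i ↦ i.elim0)
      (fun j ↦ by
        obtain rfl : j = 0 := Subsingleton.elim (α := Fin 1) _ _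
        exact hu.symm.trans (front_eq_δ_last u)) (fun _ ↦ ht)
    exact ⟨⟨s, (front_eq_δ_last s).trans (hs 0), by rw [hs₁, hs₀]⟩, Subtype.ext hs₀⟩
  · rintro n ⟨u, hu⟩ x hx hx'
    change X _⦋n + 3⦌ at u
    have hδ (k : ℕ) (i : Fin (k + 2)) (y : (underTriangle t : SSet.{w}) _⦋k + 1⦌) :
        ((underTriangle t : SSet.{w}).δ i y).1 =
          X.δ i.succ.succ.succ (show X _⦋k + 4⦌ from y.1) := by
      refine Eq.trans (dec_δ _ i _) ?_
      refine Eq.trans (dec_δ _ i.succ _) ?_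
      exact dec_δ _ i.succ.succ _
    obtain ⟨s, hs₀, hs₁, hs⟩ := exists_filler_two (m := n + 1) u
      (fun j ↦ (show X _⦋n + 3⦌ from (x j).1)) (fun i j hij ↦ by
        -- The two endpoints of an edge satisfy no compatibility in the décalage; in `X` their last
        -- faces agree because both are `t`.
        obtain _ | n := n
        · obtain rfl : j = 0 := Subsingleton.elim (α := Fin 1) _ _
          obtain rfl : i = 0 := Subsingleton.elim (α := Fin 1) _ _
          exact ((front_eq_δ_last _).symm.trans (x 1).2.1).trans
            ((front_eq_δ_last _).symm.trans (x 0).2.1).symm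
        · have := congrArg Subtype.val (hx' n rfl i j hij)
          rw [hδ, hδ] at this
          exact this)
      (fun j ↦ (congrArg Subtype.val (hx j)).trans
        ((dec_δ (dec X) j u).trans (dec_δ X j.succ u))) (fun j ↦ (x j).2.2)
    refine ⟨⟨s, ?_, by rw [hs₁, hs₀]⟩, Subtype.ext hs₀, fun j ↦ Subtype.ext ((hδ _ _ _).trans (hs j))⟩
    have := (x (Fin.last _)).2.1
    refine Eq.trans ?_ this
    exact (front_δ (n := n + 3) (by omega) _ (by simp) s).symm.trans
      (congrArg (front 2 _) (hs (Fin.last _)))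

/-- Let `y` and `x j` be the faces `1` and `j + 2` of a horn `Λ[m + 2, 0]` with initial edge `δ 0
t`. A vertex `*` is put in front: `z j` extends `x j` and `a` extends `y`, so that `*`, `0`, `1`
span `t`. As the edge of `t` from `*` to `1` is degenerate, `*` acts as a copy of the vertex `1`,
and `δ 1 a` is a candidate for the missing face `0` of the horn. -/
lemma exists_horn_extension {X : SSet.{w}} [SSet.Quasicategory X] (t : X _⦋2⦌)
    (ht : X.δ 1 t = X.σ 0 (X.δ 0 (X.δ 0 t))) {m : ℕ} (y : X _⦋m + 1⦌)
    (x : Fin (m + 1) → X _⦋m + 1⦌)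
    (hx : ∀ i j : Fin m, i ≤ j →
      X.δ i.succ.succ (x j.succ) = X.δ j.succ.succ (x i.castSucc))
    (hy : ∀ j, X.δ 1 (x j) = X.δ j.succ y) (he : ∀ j, front 1 (by omega) (x j) = X.δ 0 t) :
    ∃ (a : X _⦋m + 2⦌) (z : Fin (m + 1) → X _⦋m + 2⦌), X.δ 0 a = y ∧
      (∀ j : Fin (m + 1), X.δ j.succ.succ a = X.δ 2 (z j)) ∧ (∀ j, X.δ 0 (z j) = x j) ∧
      (∀ j, X.δ 1 (z j) = X.σ 0 (X.δ 0 (x j))) ∧ (∀ j, front 2 (by omega) (z j) = t) ∧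
      (∀ i j : Fin m, i ≤ j →
        X.δ i.succ.succ.succ (z j.succ) = X.δ j.succ.succ.succ (z i.castSucc)) := by
  obtain ⟨z, hz₀, hz₁, hzt, hz⟩ : ∃ z : Fin (m + 1) → X _⦋m + 2⦌, (∀ j, X.δ 0 (z j) = x j) ∧
      (∀ j, X.δ 1 (z j) = X.σ 0 (X.δ 0 (x j))) ∧ (∀ j, front 2 (by omega) (z j) = t) ∧
      (∀ i j : Fin m, i ≤ j →
        X.δ i.succ.succ.succ (z j.succ) = X.δ j.succ.succ.succ (z i.castSucc)) := by
    -- For `m = 0` the only face `x j` is the initial edge itself, and `t` extends it.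
    obtain _ | m := m
    · have hx₀ (j) : X.δ 0 t = x j := (he j).symm.trans (front_self _)
      exact ⟨fun _ ↦ t, hx₀, fun j ↦ by rw [ht, hx₀ j], fun _ ↦ front_self _, fun i ↦ i.elim0⟩
    -- One simplicial section extends all the `x j` simultaneously, so compatibility of the `z j`
    -- follows from that of the `x j`.
    · obtain ⟨s, hs⟩ := exists_section_of_rlp _ (underTriangleTail_rlp t ht)
      let b (j : Fin (m + 2)) : (underEdge (X.δ 0 t) : SSet.{w}) _⦋m⦌ := ⟨x j, he j⟩
      have h₀ (j) : X.δ 0 (show X _⦋m + 3⦌ from (s.app _ (b j)).1) = x j :=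
        congrArg Subtype.val (show (underTriangleTail t).app _ (s.app _ (b j)) = b j from
          ConcreteCategory.congr_hom (NatTrans.congr_app hs (op ⦋m⦌)) (b j))
      refine ⟨fun j ↦ (s.app _ (b j)).1, h₀, fun j ↦ ?_, fun j ↦ (s.app _ (b j)).2.1, ?_⟩
      · refine (s.app _ (b j)).2.2.trans ?_
        exact congrArg (fun y ↦ X.σ 0 (X.δ 0 y)) (h₀ j)
      · intro i j hij
        obtain _ | m := m
        · obtain rfl : j = 0 := Subsingleton.elim (α := Fin 1) _ _
          obtain rfl : i = 0 := Subsingleton.elim (α := Fin 1) _ _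
          exact ((front_eq_δ_last _).symm.trans (s.app _ (b 1)).2.1).trans
            ((front_eq_δ_last _).symm.trans (s.app _ (b 0)).2.1).symm
        · have hδ (k : ℕ) (i : Fin (k + 2)) (y : (underTriangle t : SSet.{w}) _⦋k + 1⦌) :
              ((underTriangle t : SSet.{w}).δ i y).1 =
                X.δ i.succ.succ.succ (show X _⦋k + 4⦌ from y.1) := by
            refine Eq.trans (dec_δ _ i _) ?_
            refine Eq.trans (dec_δ _ i.succ _) ?_
            exact dec_δ _ i.succ.succ _
          have hb : (underEdge (X.δ 0 t) : SSet.{w}).δ i (b j.succ) =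
              (underEdge (X.δ 0 t) : SSet.{w}).δ j (b i.castSucc) := by
            refine Subtype.ext ?_
            refine ((dec_δ _ i _).trans (dec_δ _ i.succ _)).trans ((hx i j hij).trans ?_)
            exact ((dec_δ _ j _).trans (dec_δ _ j.succ _)).symm
          have h := congrArg (s.app (op ⦋m⦌)) hb
          have nat (i) (y : (underEdge (X.δ 0 t) : SSet.{w}) _⦋m + 1⦌) :
              s.app (op ⦋m⦌) ((underEdge (X.δ 0 t) : SSet.{w}).δ i y) =
                (underTriangle t : SSet.{w}).δ i (s.app (op ⦋m + 1⦌) y) :=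
            ConcreteCategory.congr_hom (s.naturality (SimplexCategory.δ i).op) y
          rw [nat, nat] at h
          have h' := congrArg Subtype.val h
          rw [hδ, hδ] at h'
          exact h'
  obtain ⟨a, ha₀, ha⟩ := exists_filler_one y (fun j ↦ X.δ 2 (z j)) (fun i j hij ↦ by
      obtain _ | m := m
      · exact i.elim0
      rw [← δ_δ (i := 2) (j := i.succ.succ) (i' := 2) (j' := i.succ.succ.succ)
          (Fin.succ_le_succ_iff.2 (Fin.succ_le_succ_iff.2 (Fin.zero_le _))) rfl rfl,
        ← δ_δ (i := 2) (j := j.succ.succ) (i' := 2) (j' := j.succ.succ.succ)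
          (Fin.succ_le_succ_iff.2 (Fin.succ_le_succ_iff.2 (Fin.zero_le _))) rfl rfl, hz i j hij])
    (fun j ↦ by
      rw [δ_δ (i := 0) (j := 1) (i' := 0) (j' := 2) (by simp) rfl rfl, hz₀, hy])
  exact ⟨a, z, ha₀, ha, hz₀, hz₁, hzt, hz⟩

/-- Horns `Λ[m + 2, 0]` in a quasi-category whose initial edge is invertible have fillers. -/
lemma exists_specialHorn_filler {X : SSet.{w}} [SSet.Quasicategory X] (t t' : X _⦋2⦌)
    (ht : X.δ 1 t = X.σ 0 (X.δ 0 (X.δ 0 t))) (ht' : X.δ 1 t' = X.σ 0 (X.δ 0 (X.δ 0 t')))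
    (htt' : X.δ 2 t = X.δ 0 t') {m : ℕ} (y : X _⦋m + 1⦌)
    (x : Fin (m + 1) → X _⦋m + 1⦌)
    (hx : ∀ i j : Fin m, i ≤ j →
      X.δ i.succ.succ (x j.succ) = X.δ j.succ.succ (x i.castSucc))
    (hy : ∀ j, X.δ 1 (x j) = X.δ j.succ y) (he : ∀ j, front 1 (by omega) (x j) = X.δ 0 t) :
    ∃ s : X _⦋m + 2⦌, X.δ 1 s = y ∧ ∀ j : Fin (m + 1), X.δ j.succ.succ s = x j := by
  -- The face `δ 1 a` fits in the place of the missing face: `hδa` checks the common boundary with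
  -- the `x j`. It does not yet fill the horn.
  obtain ⟨a, z, ha₀, ha, hz₀, hz₁, hzt, hz⟩ := exists_horn_extension t ht y x hx hy he
  have hf (j) : front 1 (by omega) (z j) = X.δ 2 t := by
    rw [← hzt j]
    exact ((front_eq_δ_last (n := 1) _).symm.trans (front_map _ _ _ (fun _ ↦ rfl) _)).symm
  have hδa (j : Fin (m + 1)) : X.δ j.succ (X.δ 1 a) = X.δ 0 (x j) := by
    rw [← δ_δ (i := 1) (j := j.succ) (i' := 1) (j' := j.succ.succ)
      (by simp [Fin.le_def]) rfl rfl, ha, δ_δ (i := 1) (j := 1) (i' := 1) (j' := 2) le_rfl rfl rfl,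
      hz₁]
    exact δ_σ_succ 0 _
  -- The simplices `σ 0 (δ 1 a)`, `a` and `z j` are the faces `1`, `2` and `j + 3` of a horn `Λ[m +
  -- 3, 0]` with initial edge `δ 2 t = δ 0 t'`, so it can be extended in its turn by means of `t'`.
  obtain ⟨a', z', ha₀', ha', hz₀', hz₁', -, -⟩ := exists_horn_extension t' ht' (m := m + 1)
    (X.σ 0 (X.δ 1 a)) (Fin.cases a z) (fun i j hij ↦ by
      cases i using Fin.cases with
      | zero =>
        cases j using Fin.cases with
        | zero => exact (ha 0).symm
        | succ j => exact (ha _).symm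
      | succ i =>
        cases j using Fin.cases with
        | zero => simp at hij
        | succ j => exact hz i j (by simpa using hij))
    (fun j ↦ by
      cases j using Fin.cases with
      | zero => exact (δ_σ_succ 0 _).symm
      | succ j =>
        refine (hz₁ j).trans ?_
        rw [← hδa]
        exact (δ_σ_of_gt (i := j.succ) (j := 0) (by simp [Fin.lt_def]) _).symm)
    (fun j ↦ by
      rw [← htt']
      cases j using Fin.cases with
      | succ j => exact hf j
      | zero =>
        change front 1 _ a = _
        obtain _ | m := m
        · exact (front_eq_δ_last a).trans ((ha 0).trans (congrArg _
            ((front_self (z 0)).symm.trans (hzt 0))))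
        · rw [← front_δ (by omega) (Fin.last _) (by simp) a]
          have := ha (Fin.last _)
          rw [Fin.succ_last, Fin.succ_last] at this
          rw [this, ← hzt (Fin.last _)]
          refine ((δ_front (n := m + 2) (k := 1) (by omega) 2 _)).symm)
  have hτ (j : Fin (m + 2)) : X.δ j.succ (X.δ 1 a') = X.δ 0 ((Fin.cases a z : Fin (m + 2) → _) j) := by
    rw [← δ_δ (i := 1) (j := j.succ) (i' := 1) (j' := j.succ.succ)
      (by simp [Fin.le_def]) rfl rfl, ha', δ_δ (i := 1) (j := 1) (i' := 1) (j' := 2) le_rfl rfl rfl,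
      hz₁']
    exact δ_σ_succ 0 _
  -- The candidate for the missing face of the larger horn has faces `δ 0 a = y` and `δ 0 (z j) = x
  -- j`, so it fills the original horn.
  exact ⟨X.δ 1 a', (hτ 0).trans ha₀, fun j ↦ (hτ j.succ).trans (hz₀ j)⟩

end Decalage
end SimpCat

namespace SimpCat

/-! ### Invertible edges and the homotopy category of a quasi-category. -/

section Invertible

variable {X : SSet.{w}}

-- The homotopy category only involves simplices of dimension at most `2`. The three filling axioms
-- come from inner horns of dimensions `2` and `3`; of a `3`-dimensional filler only the missing
-- face is retained.
open SSet.Truncated (HomotopyCategory₂ Quasicategory₂) in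
open SSet.Truncated.HomotopyCategory₂ in
instance quasicategory₂_truncation [SSet.Quasicategory X] :
    Quasicategory₂ ((SSet.truncation 2).obj X) where
  fill21 {x₀ x₁ x₂} e₀₁ e₁₂ := by
    let e (e₀₁ : SSet.Edge (X := X) x₀ x₁) (e₁₂ : SSet.Edge (X := X) x₁ x₂) :
        Nonempty (Σ e₀₂ : SSet.Edge (X := X) x₀ x₂, SSet.Edge.CompStruct e₀₁ e₁₂ e₀₂) := by
      obtain ⟨s, hs⟩ := exists_innerHorn_filler (X := X) (n := 0) 1 (by decide) (by decide)
        ![e₁₂.edge, e₁₂.edge, e₀₁.edge] (by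
          intro i j hij hi hj
          fin_cases i <;> fin_cases j <;> first
            | exact absurd hij (by decide)
            | exact absurd rfl hi
            | exact absurd rfl hj
            | exact (e₀₁.tgt_eq.trans e₁₂.src_eq.symm))
      have h₀ : X.δ 0 s = e₁₂.edge := hs 0 (by decide)
      have h₂ : X.δ 2 s = e₀₁.edge := hs 2 (by decide)
      refine ⟨⟨SSet.Edge.mk (X.δ 1 s) ?_ ?_, SSet.Edge.CompStruct.mk s h₂ h₀ rfl⟩⟩
      · rw [← δ_δ (i := 1) (j := 1) (i' := 1) (j' := 2) le_rfl rfl rfl, h₂, e₀₁.src_eq]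
      · rw [δ_δ (i := 0) (j := 0) (i' := 0) (j' := 1) le_rfl rfl rfl, h₀, e₁₂.tgt_eq]
    exact e e₀₁ e₁₂
  fill31 {x₀ x₁ x₂ x₃ e₀₁ e₁₂ e₂₃ e₀₂ e₁₃ e₀₃} f₃ f₀ f₂ := by
    let e {e₀₁ : SSet.Edge (X := X) x₀ x₁} {e₁₂ : SSet.Edge (X := X) x₁ x₂}
        {e₂₃ : SSet.Edge (X := X) x₂ x₃}
        {e₀₂ : SSet.Edge (X := X) x₀ x₂} {e₁₃ : SSet.Edge (X := X) x₁ x₃}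
        {e₀₃ : SSet.Edge (X := X) x₀ x₃}
        (f₃ : SSet.Edge.CompStruct e₀₁ e₁₂ e₀₂) (f₀ : SSet.Edge.CompStruct e₁₂ e₂₃ e₁₃)
        (f₂ : SSet.Edge.CompStruct e₀₁ e₁₃ e₀₃) :
        Nonempty (SSet.Edge.CompStruct e₀₂ e₂₃ e₀₃) := by
      obtain ⟨s, hs⟩ := exists_innerHorn_filler (X := X) (n := 1) 1 (by decide) (by decide)
        ![f₀.simplex, f₀.simplex, f₂.simplex, f₃.simplex] (by
          intro i j hij hi hj
          fin_cases i <;> fin_cases j <;> first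
            | exact absurd hij (by decide)
            | exact absurd rfl hi
            | exact absurd rfl hj
            | exact f₂.d₀.trans f₀.d₁.symm
            | exact f₃.d₀.trans f₀.d₂.symm
            | exact f₃.d₂.trans f₂.d₂.symm)
      have h₀ : X.δ 0 s = f₀.simplex := hs 0 (by decide)
      have h₂ : X.δ 2 s = f₂.simplex := hs 2 (by decide)
      have h₃ : X.δ 3 s = f₃.simplex := hs 3 (by decide)
      refine ⟨SSet.Edge.CompStruct.mk (X.δ 1 s) ?_ ?_ ?_⟩
      · rw [← f₃.d₁, ← h₃]
        exact (δ_δ (i := 1) (j := 2) (i' := 1) (j' := 3) (by decide) rfl rfl _).symm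
      · rw [← f₀.d₀, ← h₀]
        exact (δ_δ (i := 0) (j := 0) (i' := 0) (j' := 1) (by decide) rfl rfl _)
      · rw [← f₂.d₁, ← h₂]
        exact (δ_δ (i := 1) (j := 1) (i' := 1) (j' := 2) (by decide) rfl rfl _).symm
    exact e f₃ f₀ f₂
  fill32 {x₀ x₁ x₂ x₃ e₀₁ e₁₂ e₂₃ e₀₂ e₁₃ e₀₃} f₃ f₀ f₁ := by
    let e {e₀₁ : SSet.Edge (X := X) x₀ x₁} {e₁₂ : SSet.Edge (X := X) x₁ x₂}
        {e₂₃ : SSet.Edge (X := X) x₂ x₃}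
        {e₀₂ : SSet.Edge (X := X) x₀ x₂} {e₁₃ : SSet.Edge (X := X) x₁ x₃}
        {e₀₃ : SSet.Edge (X := X) x₀ x₃}
        (f₃ : SSet.Edge.CompStruct e₀₁ e₁₂ e₀₂) (f₀ : SSet.Edge.CompStruct e₁₂ e₂₃ e₁₃)
        (f₁ : SSet.Edge.CompStruct e₀₂ e₂₃ e₀₃) :
        Nonempty (SSet.Edge.CompStruct e₀₁ e₁₃ e₀₃) := by
      obtain ⟨s, hs⟩ := exists_innerHorn_filler (X := X) (n := 1) 2 (by decide) (by decide)
        ![f₀.simplex, f₁.simplex, f₁.simplex, f₃.simplex] (by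
          intro i j hij hi hj
          fin_cases i <;> fin_cases j <;> first
            | exact absurd hij (by decide)
            | exact absurd rfl hi
            | exact absurd rfl hj
            | exact f₁.d₀.trans f₀.d₀.symm
            | exact f₃.d₀.trans f₀.d₂.symm
            | exact f₃.d₁.trans f₁.d₂.symm)
      have h₀ : X.δ 0 s = f₀.simplex := hs 0 (by decide)
      have h₁ : X.δ 1 s = f₁.simplex := hs 1 (by decide)
      have h₃ : X.δ 3 s = f₃.simplex := hs 3 (by decide)
      refine ⟨SSet.Edge.CompStruct.mk (X.δ 2 s) ?_ ?_ ?_⟩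
      · rw [← f₃.d₂, ← h₃]
        exact (δ_δ (i := 2) (j := 2) (i' := 2) (j' := 3) (by decide) rfl rfl _).symm
      · rw [← f₀.d₁, ← h₀]
        exact (δ_δ (i := 0) (j := 1) (i' := 0) (j' := 2) (by decide) rfl rfl _)
      · rw [← f₁.d₁, ← h₁]
        exact (δ_δ (i := 1) (j := 1) (i' := 1) (j' := 2) (by decide) rfl rfl _)
    exact e f₃ f₀ f₁

/-- The homotopy category of a quasi-category. -/
abbrev Ho (X : SSet.{w}) := SSet.Truncated.HomotopyCategory₂ ((SSet.truncation 2).obj X)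

variable [SSet.Quasicategory X]

/-- The morphism in the homotopy category given by an edge. -/
def homCls {x y : X _⦋0⦌} (e : SSet.Edge x y) :
    (SSet.Truncated.HomotopyCategory₂.mk x : Ho X) ⟶ SSet.Truncated.HomotopyCategory₂.mk y :=
  SSet.Truncated.HomotopyCategory₂.homMk e.toTruncated

lemma homCls_id (x : X _⦋0⦌) : homCls (SSet.Edge.id x) = 𝟙 _ := rfl

lemma homCls_surjective {x y : X _⦋0⦌} : Function.Surjective (homCls (x := x) (y := y)) :=
  SSet.Truncated.HomotopyCategory₂.homMk_surjective

lemma nonempty_compStruct_iff {x y z : X _⦋0⦌} {f : SSet.Edge x y} {g : SSet.Edge y z}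
    {h : SSet.Edge x z} : Nonempty (f.CompStruct g h) ↔ homCls f ≫ homCls g = homCls h :=
  SSet.Truncated.Edge.CompStruct.nonempty_iff

/-- An inverse morphism is represented by an edge, and equality of composites in the homotopy
category is witnessed by actual `2`-simplices. This makes two-out-of-three available for invertible
edges. -/
lemma isInvertible_iff_isIso {x y : X _⦋0⦌} (e : SSet.Edge x y) :
    IsInvertible e.edge ↔ IsIso (homCls e) := by
  have h : Nonempty e.InvStruct ↔ IsIso (homCls e) := by
    refine ⟨fun ⟨I⟩ ↦ ⟨homCls I.inv, nonempty_compStruct_iff.1 ⟨I.homInvId⟩,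
      nonempty_compStruct_iff.1 ⟨I.invHomId⟩⟩, fun ⟨g, h₁, h₂⟩ ↦ ?_⟩
    obtain ⟨g, rfl⟩ := homCls_surjective g
    rw [← homCls_id, ← nonempty_compStruct_iff] at h₁ h₂
    exact ⟨⟨g, h₁.some, h₂.some⟩⟩
  rw [← h]
  exact ⟨fun ⟨I⟩ ↦ ⟨I.ofEq rfl⟩, fun ⟨I⟩ ↦ ⟨I.ofEq rfl⟩⟩

lemma exists_compStruct (t : X _⦋2⦌) :
    ∃ (x y z : X _⦋0⦌) (f : SSet.Edge x y) (g : SSet.Edge y z) (h : SSet.Edge x z),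
      f.edge = X.δ 2 t ∧ g.edge = X.δ 0 t ∧ h.edge = X.δ 1 t ∧ homCls f ≫ homCls g = homCls h := by
  obtain ⟨x, y, z, f, g, h, s, rfl⟩ := SSet.Edge.CompStruct.exists_of_simplex t
  exact ⟨x, y, z, f, g, h, s.d₂.symm, s.d₀.symm, s.d₁.symm, nonempty_compStruct_iff.1 ⟨s⟩⟩

lemma IsInvertible.two_of_three₁ {t : X _⦋2⦌} (h₀ : IsInvertible (X.δ 0 t))
    (h₂ : IsInvertible (X.δ 2 t)) : IsInvertible (X.δ 1 t) := by
  obtain ⟨x, y, z, f, g, h, hf, hg, hh, e⟩ := exists_compStruct t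
  rw [← hf, isInvertible_iff_isIso] at h₂
  rw [← hg, isInvertible_iff_isIso] at h₀
  rw [← hh, isInvertible_iff_isIso, ← e]
  infer_instance

lemma IsInvertible.two_of_three₂ {t : X _⦋2⦌} (h₀ : IsInvertible (X.δ 0 t))
    (h₁ : IsInvertible (X.δ 1 t)) : IsInvertible (X.δ 2 t) := by
  obtain ⟨x, y, z, f, g, h, hf, hg, hh, e⟩ := exists_compStruct t
  rw [← hh, isInvertible_iff_isIso, ← e] at h₁
  rw [← hg, isInvertible_iff_isIso] at h₀
  rw [← hf, isInvertible_iff_isIso]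
  exact IsIso.of_isIso_comp_right _ (homCls g)

lemma IsInvertible.two_of_three₀ {t : X _⦋2⦌} (h₁ : IsInvertible (X.δ 1 t))
    (h₂ : IsInvertible (X.δ 2 t)) : IsInvertible (X.δ 0 t) := by
  obtain ⟨x, y, z, f, g, h, hf, hg, hh, e⟩ := exists_compStruct t
  rw [← hh, isInvertible_iff_isIso, ← e] at h₁
  rw [← hf, isInvertible_iff_isIso] at h₂
  rw [← hg, isInvertible_iff_isIso]
  exact IsIso.of_isIso_comp_left (homCls f) _

/-- Each triangle exhibits a one-sided inverse of `f` up to an isomorphism, so `f` becomes both a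
split monomorphism and a split epimorphism. -/
lemma isInvertible_of_inverses {f : X _⦋1⦌} {t t' : X _⦋2⦌} (h₂ : X.δ 2 t = f)
    (h₁ : IsInvertible (X.δ 1 t)) (h₀' : X.δ 0 t' = f) (h₁' : IsInvertible (X.δ 1 t')) :
    IsInvertible f := by
  subst h₂
  obtain ⟨x, y, z, f, g, h, hf, hg, hh, e⟩ := exists_compStruct t
  obtain ⟨x', y', z', f', g', h', hf', hg', hh', e'⟩ := exists_compStruct t'
  have hfg : f.edge = g'.edge := by rw [hf, hg', h₀']
  obtain rfl : x = y' := by rw [← f.src_eq, hfg, g'.src_eq]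
  obtain rfl : y = z' := by rw [← f.tgt_eq, hfg, g'.tgt_eq]
  obtain rfl : f = g' := SSet.Edge.ext hfg
  rw [← hh, isInvertible_iff_isIso, ← e] at h₁
  rw [← hh', isInvertible_iff_isIso, ← e'] at h₁'
  rw [← hf, isInvertible_iff_isIso]
  have : IsSplitMono (homCls f) := ⟨⟨⟨homCls g ≫ inv (homCls f ≫ homCls g), by
    rw [← Category.assoc, IsIso.hom_inv_id]⟩⟩⟩
  have : IsSplitEpi (homCls f) := ⟨⟨⟨inv (homCls f' ≫ homCls f) ≫ homCls f', by
    rw [Category.assoc, IsIso.inv_hom_id]⟩⟩⟩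
  exact isIso_of_mono_of_isSplitEpi (homCls f)

end Invertible

/-! ### The groupoid core of a quasi-category is a Kan complex. -/

section

variable {X : SSet.{w}}

lemma isInvertible_degenerate (x : X _⦋0⦌) : IsInvertible (X.σ 0 x) :=
  ⟨(SSet.Edge.InvStruct.invStructId x).ofEq rfl⟩

lemma kanComplex_of_filler
    (h : ∀ (n : ℕ) (k : Fin (n + 3)) (x : Fin (n + 3) → X _⦋n + 1⦌),
      (∀ i j : Fin (n + 2), i ≤ j → i.castSucc ≠ k → j.succ ≠ k →
        X.δ i (x j.succ) = X.δ j (x i.castSucc)) →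
      ∃ s : X _⦋n + 2⦌, ∀ j, j ≠ k → X.δ j s = x j) : SSet.KanComplex X := by
  rw [SSet.KanComplex.iff]
  intro n k f hf
  obtain _ | n := n
  -- A horn in `Δ[1]` is a single vertex, filled by a degenerate edge; this is why the hypothesis
  -- starts in dimension `2`.
  · obtain ⟨x, hx⟩ : ∃ x : Δ[0] ⟶ X, ∀ j hj, f j hj = x := by
      obtain rfl | rfl : k = 0 ∨ k = 1 := by fin_cases k <;> simp
      · exact ⟨f 1 (by decide), fun j hj ↦ by fin_cases j; exacts [absurd rfl hj, rfl]⟩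
      · exact ⟨f 0 (by decide), fun j hj ↦ by fin_cases j; exacts [rfl, absurd rfl hj]⟩
    refine ⟨SSet.stdSimplex.σ 0 ≫ x, fun j hj ↦ ?_⟩
    rw [hx]
    fin_cases j
    · exact SSet.stdSimplex.δ_comp_σ_self_assoc (i := 0) x
    · exact SSet.stdSimplex.δ_comp_σ_succ_assoc (i := 0) x
  · obtain ⟨j₀, hj₀⟩ := exists_ne k
    rw [SSet.horn.isCompatible_iff] at hf
    obtain ⟨s, hs⟩ := h n k
      (fun j ↦ if hj : j = k then SSet.yonedaEquiv (f j₀ hj₀) else SSet.yonedaEquiv (f j hj)) (by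
        intro i j hij hi hj
        have := hf i.castSucc j.succ hi hj (Fin.castSucc_lt_succ_iff.2 hij)
        rw [Fin.pred_succ, Fin.castPred_castSucc] at this
        rw [dif_neg hi, dif_neg hj, ← SSet.stdSimplex.yonedaEquiv_δ_comp,
          ← SSet.stdSimplex.yonedaEquiv_δ_comp, this])
    refine ⟨SSet.yonedaEquiv.symm s, fun j hj ↦ SSet.yonedaEquiv.injective ?_⟩
    rw [SSet.stdSimplex.yonedaEquiv_δ_comp, Equiv.apply_symm_apply, hs j hj, dif_neg hj]

lemma exists_horn_filler [SSet.KanComplex X] {n : ℕ} (k : Fin (n + 3))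
    (x : Fin (n + 3) → X _⦋n + 1⦌)
    (hx : ∀ i j : Fin (n + 2), i ≤ j → i.castSucc ≠ k → j.succ ≠ k →
      X.δ i (x j.succ) = X.δ j (x i.castSucc)) :
    ∃ s : X _⦋n + 2⦌, ∀ j, j ≠ k → X.δ j s = x j := by
  have hf : SSet.horn.IsCompatible (i := k)
      (fun j (_ : j ≠ k) ↦ SSet.yonedaEquiv.symm (x j)) := by
    rw [SSet.horn.isCompatible_iff]
    intro i j hi hj hij
    obtain ⟨i, rfl⟩ := i.eq_castSucc_of_ne_last (Fin.ne_last_of_lt hij)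
    obtain ⟨j, rfl⟩ := j.eq_succ_of_ne_zero (Fin.ne_zero_of_lt hij)
    apply SSet.yonedaEquiv.injective
    rw [SSet.stdSimplex.yonedaEquiv_δ_comp, SSet.stdSimplex.yonedaEquiv_δ_comp,
      Equiv.apply_symm_apply, Equiv.apply_symm_apply, Fin.pred_succ, Fin.castPred_castSucc]
    exact (hx i j (by simpa [Fin.castSucc_lt_succ_iff] using hij) hi hj).symm
  obtain ⟨s, hs⟩ := hf.exists_lift_of_kanComplex
  refine ⟨SSet.yonedaEquiv s, fun j hj ↦ ?_⟩
  rw [← SSet.stdSimplex.yonedaEquiv_δ_comp, hs j hj, Equiv.apply_symm_apply]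

lemma isInvertible_of_kanComplex [SSet.KanComplex X] (e : X _⦋1⦌) : IsInvertible e := by
  -- An outer horn made of `e` and a degenerate edge gives an inverse on one side, and the opposite
  -- outer horn gives one on the other side. The entries at the omitted indices `0` and `2` are
  -- placeholders.
  obtain ⟨s, hs⟩ := exists_horn_filler (X := X) (n := 0) 0 ![e, X.σ 0 (X.δ 1 e), e] (by
    intro i j hij hi hj
    fin_cases i <;> fin_cases j <;> first
      | exact absurd hij (by decide)
      | exact absurd rfl hi
      | exact absurd rfl hj
      | exact (δ_σ_succ (0 : Fin 1) (X.δ 1 e)).symm)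
  obtain ⟨s', hs'⟩ := exists_horn_filler (X := X) (n := 0) 2 ![e, X.σ 0 (X.δ 0 e), e] (by
    intro i j hij hi hj
    fin_cases i <;> fin_cases j <;> first
      | exact absurd hij (by decide)
      | exact absurd rfl hi
      | exact absurd rfl hj
      | exact (δ_σ_self (0 : Fin 1) (X.δ 0 e)))
  refine isInvertible_of_inverses (t := s) (t' := s')
    (hs 2 (by decide)) ?_ (hs' 0 (by decide)) ?_
  · rw [hs 1 (by decide)]
    exact isInvertible_degenerate _
  · rw [hs' 1 (by decide)]
    exact isInvertible_degenerate _

lemma mem_groupoidCore_of_kanComplex [SSet.KanComplex X] {n : SimplexCategoryᵒᵖ} (x : X.obj n) :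
    x ∈ (groupoidCore X).obj n :=
  fun _ ↦ isInvertible_of_kanComplex _

/-- An operator `[1] ⟶ [1]` is the identity or factors through `[0]`, so the other edges of `e` are
degenerate. -/
lemma mem_groupoidCore_of_isInvertible {e : X _⦋1⦌} (he : IsInvertible e) :
    e ∈ (groupoidCore X).obj _ := by
  intro φ
  by_cases hφ : Function.Surjective φ.unop.toOrderHom
  · have : Epi φ.unop := SimplexCategory.epi_iff_surjective.2 hφ
    have h : φ.unop = 𝟙 _ := SimplexCategory.eq_id_of_epi _
    obtain rfl : φ = 𝟙 _ := Quiver.Hom.unop_inj h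
    rwa [X.map_id_apply]
  · obtain ⟨i, ψ, hψ⟩ := SimplexCategory.eq_comp_δ_of_not_surjective φ.unop hφ
    obtain rfl : φ = (SimplexCategory.δ i).op ≫ ψ.op := Quiver.Hom.unop_inj hψ
    have hψ' : ψ = SimplexCategory.σ 0 := by
      ext j : 3
      exact Subsingleton.elim (α := Fin 1) _ _
    rw [hψ', Functor.map_comp_apply]
    exact isInvertible_degenerate _

/-- An edge of a simplex of dimension at least `2` misses a vertex, so it lies in a face. -/
lemma mem_groupoidCore_of_faces {n : ℕ} {x : X _⦋n + 2⦌}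
    (hx : ∀ j, X.δ j x ∈ (groupoidCore X).obj _) : x ∈ (groupoidCore X).obj _ := by
  intro φ
  have hφ : ¬ Function.Surjective φ.unop.toOrderHom := fun h ↦ by
    have : Fintype.card (Fin (n + 3)) ≤ Fintype.card (Fin 2) := Fintype.card_le_of_surjective _ h
    simp at this
  obtain ⟨i, ψ, hψ⟩ := SimplexCategory.eq_comp_δ_of_not_surjective φ.unop hφ
  obtain rfl : φ = (SimplexCategory.δ i).op ≫ ψ.op := Quiver.Hom.unop_inj hψ
  rw [Functor.map_comp_apply]
  exact hx i _

/-- In dimension `2` the missing edge is invertible by two-out-of-three. In higher dimensions each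
face of the missing face is a face of one of the given faces. -/
lemma δ_mem_groupoidCore_of_horn [SSet.Quasicategory X] {n : ℕ} (k : Fin (n + 3)) {s : X _⦋n + 2⦌}
    (hs : ∀ j, j ≠ k → X.δ j s ∈ (groupoidCore X).obj _) :
    s ∈ (groupoidCore X).obj _ := by
  refine mem_groupoidCore_of_faces fun j ↦ ?_
  by_cases hj : j ≠ k
  · exact hs j hj
  obtain rfl : j = k := not_not.1 hj
  obtain _ | n := n
  · refine mem_groupoidCore_of_isInvertible ?_
    have h {e : X _⦋1⦌} (he : e ∈ (groupoidCore X).obj _) : IsInvertible e := by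
      simpa using he (𝟙 _)
    fin_cases j
    · exact IsInvertible.two_of_three₀ (h (hs 1 (by decide))) (h (hs 2 (by decide)))
    · exact IsInvertible.two_of_three₁ (h (hs 0 (by decide))) (h (hs 2 (by decide)))
    · exact IsInvertible.two_of_three₂ (h (hs 0 (by decide))) (h (hs 1 (by decide)))
  · refine mem_groupoidCore_of_faces fun i ↦ ?_
    obtain hij | hij := lt_or_ge i.castSucc j
    · obtain ⟨j, rfl⟩ := j.eq_succ_of_ne_zero (Fin.ne_zero_of_lt hij)
      rw [δ_δ i j (Fin.castSucc_lt_succ_iff.1 hij) rfl rfl]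
      exact (groupoidCore X).map _ (hs _ hij.ne)
    · obtain ⟨j, rfl⟩ := j.eq_castSucc_of_ne_last
        (Fin.ne_last_of_lt (lt_of_le_of_lt hij (Fin.castSucc_lt_last i)))
      rw [← δ_δ j i (by simpa using hij) rfl rfl]
      exact (groupoidCore X).map _ (hs _ (by simpa [Fin.lt_def, Fin.le_def] using (lt_of_le_of_lt hij (Fin.castSucc_lt_succ (i := i))).ne'))

/-- The two triangles witnessing invertibility of the initial edge are the `t` and `t'` of
`exists_specialHorn_filler`. The initial edge belongs to every face of index at least `2`; reading
it off the last face is a matter of convenience, justified by `hf`. -/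
lemma exists_outerHorn_filler [SSet.Quasicategory X] {m : ℕ} (x : Fin (m + 3) → X _⦋m + 1⦌)
    (hx : ∀ i j : Fin (m + 2), i ≤ j → i.castSucc ≠ 0 →
      X.δ i (x j.succ) = X.δ j (x i.castSucc))
    (he : IsInvertible (front 1 (by omega) (x (Fin.last _)))) :
    ∃ s : X _⦋m + 2⦌, ∀ j, j ≠ 0 → X.δ j s = x j := by
  obtain ⟨I⟩ := he
  have hf (j : Fin (m + 1)) : front 1 (by omega) (x j.succ.succ) =
      front 1 (by omega) (x (Fin.last _)) := by
    obtain _ | m := m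
    · obtain rfl : j = 0 := Subsingleton.elim (α := Fin 1) _ _
      rfl
    · have key (i j : Fin (m + 1)) (hij : i ≤ j) : front 1 (by omega) (x j.succ.succ.succ) =
          front 1 (by omega) (x i.castSucc.succ.succ) := by
        have := hx i.succ.succ j.succ.succ (by simpa using hij)
          (fun h ↦ Fin.succ_ne_zero _ (Fin.castSucc_injective _ h))
        rw [← front_δ (by omega) i.succ.succ (by simp), this,
          front_δ (by omega) j.succ.succ (by simp)]
        rfl
      obtain ⟨j, rfl⟩ | rfl : (∃ k : Fin (m + 1), j = k.castSucc) ∨ j = Fin.last _ := by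
        cases j using Fin.lastCases with
        | last => exact .inr rfl
        | cast j => exact .inl ⟨j, rfl⟩
      · rw [← key j (Fin.last _) (Fin.le_last _)]
        rfl
      · rfl
  obtain ⟨s, hs₁, hs⟩ := exists_specialHorn_filler (X := X) I.invHomId.simplex I.homInvId.simplex
    (by rw [I.invHomId.d₁, I.invHomId.d₀, SSet.Edge.tgt_eq]; rfl)
    (by rw [I.homInvId.d₁, I.homInvId.d₀, SSet.Edge.tgt_eq]; rfl)
    (by rw [I.homInvId.d₀, I.invHomId.d₂]) (x 1) (fun j ↦ x j.succ.succ)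
    (fun i j hij ↦ hx i.succ.succ j.succ.succ (by simpa using hij)
          (fun h ↦ Fin.succ_ne_zero _ (Fin.castSucc_injective _ h)))
    (fun j ↦ hx 1 j.succ (by simp [Fin.le_def]) (by simp))
    (fun j ↦ by rw [hf, I.invHomId.d₀]; rfl)
  refine ⟨s, fun j hj ↦ ?_⟩
  cases j using Fin.cases with
  | zero => exact absurd rfl hj
  | succ j =>
    cases j using Fin.cases with
    | zero => exact hs₁
    | succ j => exact hs j

lemma quasicategory_of_faces
    (h : ∀ (n : ℕ) (k : Fin (n + 3)) (x : Fin (n + 3) → X _⦋n + 1⦌), 0 < k → k < Fin.last _ →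
      (∀ i j : Fin (n + 2), i ≤ j → i.castSucc ≠ k → j.succ ≠ k →
        X.δ i (x j.succ) = X.δ j (x i.castSucc)) →
      ∃ s : X _⦋n + 2⦌, ∀ j, j ≠ k → X.δ j s = x j) : SSet.Quasicategory X where
  hornFilling' n k σ₀ h0 hn := by
    have hf := SSet.horn.IsCompatible.of_hom σ₀
    obtain ⟨j₀, hj₀⟩ := exists_ne k
    rw [SSet.horn.isCompatible_iff] at hf
    obtain ⟨s, hs⟩ := h n k (fun j ↦ if hj : j = k then SSet.yonedaEquiv (SSet.horn.ι k j₀ hj₀ ≫ σ₀)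
        else SSet.yonedaEquiv (SSet.horn.ι k j hj ≫ σ₀)) h0 hn (by
      intro i j hij hi hj
      have := hf i.castSucc j.succ hi hj (Fin.castSucc_lt_succ_iff.2 hij)
      rw [Fin.pred_succ, Fin.castPred_castSucc] at this
      rw [dif_neg hi, dif_neg hj, ← SSet.stdSimplex.yonedaEquiv_δ_comp,
        ← SSet.stdSimplex.yonedaEquiv_δ_comp, this])
    refine ⟨SSet.yonedaEquiv.symm s, SSet.horn.hom_ext' fun j hj ↦ SSet.yonedaEquiv.injective ?_⟩
    rw [SSet.horn.ι_ι_assoc, SSet.stdSimplex.yonedaEquiv_δ_comp, Equiv.apply_symm_apply, hs j hj,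
      dif_neg hj]

/-- Faces of an outer or inner horn in the opposite simplicial set. -/
lemma exists_filler_of_op {n : ℕ} {k : Fin (n + 3)} {x : Fin (n + 3) → X _⦋n + 1⦌}
    (hx : ∀ i j : Fin (n + 2), i ≤ j → i.castSucc ≠ k → j.succ ≠ k →
      X.δ i (x j.succ) = X.δ j (x i.castSucc))
    (h : ∀ y : Fin (n + 3) → X.op _⦋n + 1⦌, (∀ j, y j = SSet.opObjEquiv.symm (x j.rev)) →
      (∀ i j : Fin (n + 2), i ≤ j → i.castSucc ≠ k.rev → j.succ ≠ k.rev →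
        X.op.δ i (y j.succ) = X.op.δ j (y i.castSucc)) →
      ∃ s : X.op _⦋n + 2⦌, ∀ j, j ≠ k.rev → X.op.δ j s = y j) :
    ∃ s : X _⦋n + 2⦌, ∀ j, j ≠ k → X.δ j s = x j := by
  obtain ⟨s, hs⟩ := h (fun j ↦ SSet.opObjEquiv.symm (x j.rev)) (fun _ ↦ rfl)
    (fun i j hij hi hj ↦ by
      refine (SSet.op_δ _ _ _).trans (Eq.trans ?_ (SSet.op_δ _ _ _).symm)
      have := hx j.rev i.rev (Fin.rev_le_rev.2 hij)
        (fun h ↦ hj (by rw [← h, Fin.rev_castSucc, Fin.rev_rev]))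
        (fun h ↦ hi (by rw [← h, Fin.rev_succ, Fin.rev_rev]))
      rw [← Fin.rev_succ, ← Fin.rev_castSucc] at this
      exact congrArg _ this.symm)
  refine ⟨SSet.opObjEquiv s, fun j hj ↦ ?_⟩
  refine (SSet.δ_opObjEquiv X j s).trans ?_
  refine (congrArg _ (hs j.rev fun h ↦ hj (Fin.rev_injective h))).trans ?_
  exact congrArg x (Fin.rev_rev j)

instance quasicategory_op [SSet.Quasicategory X] : SSet.Quasicategory X.op := by
  refine quasicategory_of_faces fun n k y h0 hn hy ↦ ?_
  obtain ⟨s, hs⟩ := exists_innerHorn_filler (X := X) k.rev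
    (by rwa [← Fin.rev_last, Fin.rev_lt_rev]) (by rwa [← Fin.rev_zero, Fin.rev_lt_rev])
    (fun j ↦ SSet.opObjEquiv (y j.rev)) (fun i j hij hi hj ↦ by
      have := hy j.rev i.rev (Fin.rev_le_rev.2 hij)
        (fun h ↦ hj (by rw [← h, Fin.rev_castSucc, Fin.rev_rev]))
        (fun h ↦ hi (by rw [← h, Fin.rev_succ, Fin.rev_rev]))
      rw [← Fin.rev_succ, ← Fin.rev_castSucc] at this
      refine (SSet.δ_opObjEquiv _ _ _).trans (Eq.trans ?_ (SSet.δ_opObjEquiv _ _ _).symm)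
      exact congrArg _ this.symm)
  refine ⟨SSet.opObjEquiv.symm s, fun j hj ↦ ?_⟩
  refine (SSet.op_δ _ _ _).trans ?_
  exact (hs j.rev fun h ↦ hj (Fin.rev_injective h)).trans (congrArg y (Fin.rev_rev j))

lemma IsInvertible.op {e : X _⦋1⦌} (h : IsInvertible e) :
    IsInvertible (X := X.op) (SSet.opObjEquiv.symm e) := by
  obtain ⟨I⟩ := h
  have hδ {n : ℕ} (i : Fin (n + 2)) (x : X _⦋n + 1⦌) :
      X.op.δ i (SSet.opObjEquiv.symm x) = SSet.opObjEquiv.symm (X.δ i.rev x) := SSet.op_δ X i _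
  have hσ {n : ℕ} (i : Fin (n + 1)) (x : X _⦋n⦌) :
      X.op.σ i (SSet.opObjEquiv.symm x) = SSet.opObjEquiv.symm (X.σ i.rev x) := SSet.op_σ X i _
  have h₀ := (hδ 0 e).trans (congrArg SSet.opObjEquiv.symm I.inv.tgt_eq.symm)
  have h₁ := (hδ 1 e).trans (congrArg SSet.opObjEquiv.symm I.inv.src_eq.symm)
  let inv' : SSet.Edge (X := X.op) (X.op.δ 0 (SSet.opObjEquiv.symm e))
      (X.op.δ 1 (SSet.opObjEquiv.symm e)) :=
    SSet.Edge.mk (SSet.opObjEquiv.symm I.inv.edge) ((hδ 1 _).trans h₀.symm)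
      ((hδ 0 _).trans h₁.symm)
  refine ⟨{
    inv := inv'
    homInvId := SSet.Edge.CompStruct.mk (SSet.opObjEquiv.symm I.invHomId.simplex)
      ((hδ 2 _).trans (congrArg SSet.opObjEquiv.symm I.invHomId.d₀))
      ((hδ 0 _).trans (congrArg SSet.opObjEquiv.symm I.invHomId.d₂))
      ((hδ 1 _).trans ((congrArg SSet.opObjEquiv.symm I.invHomId.d₁).trans ?_))
    invHomId := SSet.Edge.CompStruct.mk (SSet.opObjEquiv.symm I.homInvId.simplex)
      ((hδ 2 _).trans (congrArg SSet.opObjEquiv.symm I.homInvId.d₀))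
      ((hδ 0 _).trans (congrArg SSet.opObjEquiv.symm I.homInvId.d₂))
      ((hδ 1 _).trans ((congrArg SSet.opObjEquiv.symm I.homInvId.d₁).trans ?_)) }⟩
  · exact ((congrArg (X.op.σ 0) (hδ 1 e)).trans (hσ 0 _)).symm
  · exact ((congrArg (X.op.σ 0) (hδ 0 e)).trans (hσ 0 _)).symm

/-- Inner horns are filled in `X`. Horns at the first vertex have an invertible initial edge, and
horns at the last vertex become such horns in `X.op`. In every case the filler has invertible edges
by `δ_mem_groupoidCore_of_horn`. -/
lemma kanComplex_groupoidCore [SSet.Quasicategory X] :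
    SSet.KanComplex (groupoidCore X : SSet.{w}) := by
  refine kanComplex_of_filler fun n k x hx ↦ ?_
  have hx' (i j : Fin (n + 2)) (hij : i ≤ j) (hi : i.castSucc ≠ k) (hj : j.succ ≠ k) :
      X.δ i (x j.succ).1 = X.δ j (x i.castSucc).1 := congrArg Subtype.val (hx i j hij hi hj)
  obtain ⟨s, hs⟩ : ∃ s : X _⦋n + 2⦌, ∀ j, j ≠ k → X.δ j s = (x j).1 := by
    obtain rfl | h0 := eq_or_ne k 0
    · exact exists_outerHorn_filler (fun j ↦ (x j).1)
        (fun i j hij hi ↦ hx' i j hij hi (Fin.succ_ne_zero _)) ((x (Fin.last _)).2 _)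
    obtain rfl | hn := eq_or_ne k (Fin.last _)
    · refine exists_filler_of_op hx' fun y hy hy' ↦ ?_
      rw [Fin.rev_last] at hy' ⊢
      refine exists_outerHorn_filler (X := X.op) y
        (fun i j hij hi ↦ hy' i j hij hi (Fin.succ_ne_zero _)) ?_
      rw [hy]
      exact ((x _).2 _).op
    exact exists_innerHorn_filler k (Fin.pos_iff_ne_zero.2 h0) (Fin.lt_last_iff_ne_last.2 hn) _ hx'
  exact ⟨⟨s, δ_mem_groupoidCore_of_horn k fun j hj ↦ by rw [hs j hj]; exact (x j).2⟩,
    fun j hj ↦ Subtype.ext (hs j hj)⟩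

end

end SimpCat

namespace SimpCat

/-! ### Calculus of weights: levelwise cotensors, representable cells and their lifting properties.
-/

section Weights

variable {A : Type w} [EnrichedCategory SSet.{w} A]

lemma act_idn (W : Weight A) {a : A} {n : SimplexCategoryᵒᵖ} (x : (W.obj a).obj n) :
    act W (idn a n) x = x := by
  rw [act, SFunctor.mapS_idn, evalS_idn]

lemma act_comp (W : Weight A) {a b c : A} {n : SimplexCategoryᵒᵖ} (f : (Fun.{w} a b).obj n)
    (g : (Fun.{w} b c).obj n) (x : (W.obj a).obj n) :
    act W (comp f g) x = act W g (act W f x) := by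
  rw [act, SFunctor.mapS_comp, evalS_comp]
  rfl

/-- A weight presented by the action of `n`-simplices on `n`-simplices. -/
def mkWeight (obj : A → SSet.{w})
    (act : ∀ {a b : A} {n : SimplexCategoryᵒᵖ}, (Fun.{w} a b).obj n → (obj a).obj n → (obj b).obj n)
    (act_map : ∀ {a b : A} {n m : SimplexCategoryᵒᵖ} (f : (Fun.{w} a b).obj n) (φ : n ⟶ m)
      (x : (obj a).obj n), (obj b).map φ (act f x) = act ((Fun.{w} a b).map φ f) ((obj a).map φ x))
    (act_idn : ∀ {a : A} {n : SimplexCategoryᵒᵖ} (x : (obj a).obj n), act (idn a n) x = x)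
    (act_comp : ∀ {a b c : A} {n : SimplexCategoryᵒᵖ} (f : (Fun.{w} a b).obj n)
      (g : (Fun.{w} b c).obj n) (x : (obj a).obj n), act (comp f g) x = act g (act f x)) :
    Weight A where
  toEnrichedFunctor := mkEnrichedFunctor A SSet.{w} obj
    (fun {a b n} f ↦ mkHom (obj a) (obj b) n (fun _ φ x ↦ act ((Fun.{w} a b).map φ f) x)
      (fun ψ φ x ↦ by rw [act_map, Functor.map_comp_apply]))
    (fun φ f ↦ hom_ext fun m ψ x ↦ by
      rw [evalS_map, evalS_mkHom, evalS_mkHom, Functor.map_comp_apply])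
    (fun a n ↦ hom_ext fun m φ x ↦ by rw [evalS_mkHom, evalS_idn, map_idn, act_idn])
    (fun f g ↦ hom_ext fun m φ x ↦ by
      rw [evalS_mkHom, evalS_comp, evalS_mkHom, evalS_mkHom, map_comp, act_comp])

lemma act_mkWeight (obj : A → SSet.{w})
    (act' : ∀ {a b : A} {n : SimplexCategoryᵒᵖ}, (Fun.{w} a b).obj n → (obj a).obj n → (obj b).obj n)
    (h₁ h₂ h₃) {a b : A} {n : SimplexCategoryᵒᵖ} (f : (Fun.{w} a b).obj n) (x : (obj a).obj n) :
    act (mkWeight obj act' h₁ h₂ h₃) f x = act' f x := by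
  change act' ((Fun.{w} a b).map (𝟙 n) f) x = _
  rw [Functor.map_id_apply]

lemma act_cellWeight (U : SSet.{w}) (a : A) {b c : A} {n : SimplexCategoryᵒᵖ}
    (f : (Fun.{w} b c).obj n) (x : ((cellWeight U a).obj b).obj n) :
    act (cellWeight U a) f x = pair (X := U) (Y := Fun.{w} a c) x.1 (comp x.2 f) := by
  change pair (X := U) (Y := Fun.{w} a c) x.1 (comp x.2 ((Fun.{w} b c).map (𝟙 n) f)) = _
  rw [Functor.map_id_apply]

@[ext]
lemma Weight.hom_ext {V W : Weight A} {f g : V ⟶ W} (h : ∀ a, f.app a = g.app a) : f = g :=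
  WeightHom.ext (funext h)

@[simp]
lemma Weight.comp_app {U V W : Weight A} (f : U ⟶ V) (g : V ⟶ W) (a : A) :
    (f ≫ g).app a = f.app a ≫ g.app a := rfl

lemma Weight.app_map {V W : Weight A} (f : V ⟶ W) {a : A} {n m : SimplexCategoryᵒᵖ} (φ : n ⟶ m)
    (x : (V.obj a).obj n) :
    (f.app a).app m ((V.obj a).map φ x) = (W.obj a).map φ ((f.app a).app n x) :=
  ConcreteCategory.congr_hom ((f.app a).naturality φ) x

/-- The action of an `n`-simplex of the simplicial set of maps `V ⟶ W`, along `φ : [m] ⟶ [n]`. -/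
def natEval {V W : Weight A} {n m : SimplexCategoryᵒᵖ} (h : (Fun.{w} V W).obj n) (φ : n ⟶ m)
    {a : A} (x : (V.obj a).obj m) : (W.obj a).obj m :=
  evalS (SFunctor.component h a) φ x

lemma natEval_map {V W : Weight A} {n m k : SimplexCategoryᵒᵖ} (h : (Fun.{w} V W).obj n)
    (ψ : n ⟶ m) (φ : m ⟶ k) {a : A} (x : (V.obj a).obj k) :
    natEval ((Fun.{w} V W).map ψ h) φ x = natEval h (ψ ≫ φ) x := rfl

lemma map_natEval {V W : Weight A} {n m k : SimplexCategoryᵒᵖ} (h : (Fun.{w} V W).obj n)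
    (φ : n ⟶ m) (ψ : m ⟶ k) {a : A} (x : (V.obj a).obj m) :
    (W.obj a).map ψ (natEval h φ x) = natEval h (φ ≫ ψ) ((V.obj a).map ψ x) :=
  map_evalS _ _ _ _

lemma natEval_comp {U V W : Weight A} {n m : SimplexCategoryᵒᵖ} (h : (Fun.{w} U V).obj n)
    (k : (Fun.{w} V W).obj n) (φ : n ⟶ m) {a : A} (x : (U.obj a).obj m) :
    natEval (comp h k) φ x = natEval k φ (natEval h φ x) := rfl

lemma natEval_idn (V : Weight A) {n m : SimplexCategoryᵒᵖ} (φ : n ⟶ m) {a : A}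
    (x : (V.obj a).obj m) : natEval (idn V n) φ x = x := rfl

lemma natEval_act {V W : Weight A} {n m : SimplexCategoryᵒᵖ} (h : (Fun.{w} V W).obj n) (φ : n ⟶ m)
    {a b : A} (f : (Fun.{w} a b).obj m) (x : (V.obj a).obj m) :
    natEval h φ (act V f x) = act W f (natEval h φ x) := by
  have := congrArg (fun k ↦ evalS k (𝟙 m) x)
    ((show (SFunctor.natSSet V W).obj n from h).2 φ f)
  exact ((congrArg (fun ψ ↦ evalS (SFunctor.component h b) ψ (act V f x))
    (Category.comp_id φ)).symm.trans this.symm).trans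
    (congrArg (fun ψ ↦ act W f (evalS (SFunctor.component h a) ψ x)) (Category.comp_id φ))

lemma nat_ext {V W : Weight A} {n : SimplexCategoryᵒᵖ} {h k : (Fun.{w} V W).obj n}
    (H : ∀ (a : A) (m : SimplexCategoryᵒᵖ) (φ : n ⟶ m) (x : (V.obj a).obj m),
      natEval h φ x = natEval k φ x) : h = k :=
  Subtype.ext (funext fun a ↦ hom_ext fun m φ x ↦ H a m φ x)

/-- An `n`-simplex of the simplicial set of maps `V ⟶ W`, given by its action. -/
def mkNat (V W : Weight A) (n : SimplexCategoryᵒᵖ)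
    (app : ∀ (a : A) (m : SimplexCategoryᵒᵖ), (n ⟶ m) → (V.obj a).obj m → (W.obj a).obj m)
    (nat : ∀ (a : A) {m k : SimplexCategoryᵒᵖ} (ψ : m ⟶ k) (φ : n ⟶ m) (x : (V.obj a).obj m),
      app a k (φ ≫ ψ) ((V.obj a).map ψ x) = (W.obj a).map ψ (app a m φ x))
    (equivariant : ∀ {a b : A} {m : SimplexCategoryᵒᵖ} (φ : n ⟶ m) (f : (Fun.{w} a b).obj m)
      (x : (V.obj a).obj m), app b m φ (act V f x) = act W f (app a m φ x)) :
    (Fun.{w} V W).obj n :=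
  show (SFunctor.natSSet V W).obj n from
    ⟨fun a ↦ mkHom (V.obj a) (W.obj a) n (app a) (nat a), by
      intro a b m φ f
      refine SimpCat.hom_ext fun k ψ x ↦ ?_
      rw [evalS_comp, evalS_comp, evalS_mapS, evalS_mapS]
      exact (equivariant (φ ≫ ψ) ((Fun.{w} a b).map ψ f) x).symm⟩

/-- The map of simplicial sets of maps of weights induced by precomposition. -/
def preFun {V W : Weight A} (u : V ⟶ W) (G : Weight A) : Fun.{w} W G ⟶ Fun.{w} V G where
  app n := ↾fun h ↦ mkNat V G n (fun a m φ x ↦ natEval h φ ((u.app a).app m x))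
    (fun a m k ψ φ x ↦ by rw [map_natEval, Weight.app_map])
    (fun φ f x ↦ by rw [u.naturality, natEval_act])
  naturality _ _ _ := rfl

/-- The map of simplicial sets of maps of weights induced by postcomposition. -/
def postFun (V : Weight A) {G H : Weight A} (u : G ⟶ H) : Fun.{w} V G ⟶ Fun.{w} V H where
  app n := ↾fun h ↦ mkNat V H n (fun a m φ x ↦ (u.app a).app m (natEval h φ x))
    (fun a m k ψ φ x ↦ by rw [← Weight.app_map, map_natEval])
    (fun φ f x ↦ by rw [natEval_act, u.naturality])
  naturality _ _ _ := rfl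

/-- The levelwise cotensor `a ↦ Fun S (G a)`. -/
def cot (S : SSet.{w}) (G : Weight A) : Weight A :=
  mkWeight (fun a ↦ Fun.{w} S (G.obj a))
    (fun {a b n} f x ↦ mkHom S (G.obj b) n
      (fun m φ s ↦ act G ((Fun.{w} a b).map φ f) (evalS x φ s))
      (fun ψ φ s ↦ by rw [act_map, ← map_evalS, Functor.map_comp_apply]))
    (fun f φ x ↦ SimpCat.hom_ext fun m ψ s ↦ by
      rw [evalS_map, evalS_mkHom, evalS_mkHom, evalS_map, Functor.map_comp_apply])
    (fun x ↦ SimpCat.hom_ext fun m φ s ↦ by rw [evalS_mkHom, map_idn, act_idn])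
    (fun f g x ↦ SimpCat.hom_ext fun m φ s ↦ by
      rw [evalS_mkHom, evalS_mkHom, evalS_mkHom, map_comp, act_comp])

lemma act_cot (S : SSet.{w}) (G : Weight A) {a b : A} {n m : SimplexCategoryᵒᵖ}
    (f : (Fun.{w} a b).obj n) (x : (Fun.{w} S (G.obj a)).obj n) (φ : n ⟶ m) (s : S.obj m) :
    evalS (Y := G.obj b) (act (cot S G) f x) φ s =
      act G ((Fun.{w} a b).map φ f) (evalS x φ s) :=
  congrArg (fun f ↦ act G ((Fun.{w} a b).map φ f) (evalS x φ s)) ((Fun.{w} a b).map_id_apply n f)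

/-- Precomposition on internal homs of simplicial sets. -/
def preS {S T : SSet.{w}} (i : S ⟶ T) (X : SSet.{w}) : Fun.{w} T X ⟶ Fun.{w} S X where
  app n := ↾fun h ↦ mkHom S X n (fun m φ s ↦ evalS h φ (i.app m s)) (fun {m k} ψ φ s ↦ by
    rw [map_evalS]
    exact congrArg _ (ConcreteCategory.congr_hom (i.naturality ψ) s))
  naturality _ _ _ := rfl

/-- Functoriality of the levelwise cotensor in the simplicial set. -/
def cotMap {S T : SSet.{w}} (i : S ⟶ T) (G : Weight A) : cot T G ⟶ cot S G where
  app a := preS i (G.obj a)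
  naturality {a b n} f x := SimpCat.hom_ext fun m φ s ↦ by
    refine (act_cot T G f x φ (i.app m s)).trans ?_
    exact (act_cot S G f ((preS i (G.obj a)).app n x) φ s).symm

/-- Maps of weights into a cotensor, as maps into a simplicial set of maps of weights. -/
def toCot {S : SSet.{w}} {V G : Weight A} (h : S ⟶ Fun.{w} V G) : V ⟶ cot S G where
  app a :=
    { app n := ↾fun x ↦ mkHom S (G.obj a) n
        (fun m φ s ↦ natEval (h.app m s) (𝟙 m) ((V.obj a).map φ x)) (fun {m k} ψ φ s ↦ by
          have : h.app k (S.map ψ s) = (Fun.{w} V G).map ψ (h.app m s) :=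
            ConcreteCategory.congr_hom (h.naturality ψ) s
          rw [map_natEval, this, natEval_map, Category.id_comp, Category.comp_id,
            Functor.map_comp_apply])
      naturality n m ψ := by
        ext x
        refine SimpCat.hom_ext fun k φ s ↦ ?_
        exact congrArg (natEval (h.app k s) (𝟙 k)) ((V.obj a).map_comp_apply ψ φ x).symm }
  naturality {a b n} f x := SimpCat.hom_ext fun m φ s ↦ by
    refine Eq.trans ?_ (act_cot S G f _ φ s).symm
    change natEval (h.app m s) (𝟙 m) ((V.obj b).map φ (act V f x)) =
      act G ((Fun.{w} a b).map φ f) (natEval (h.app m s) (𝟙 m) ((V.obj a).map φ x))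
    rw [act_map, natEval_act]

lemma evalS_toCot {S : SSet.{w}} {V G : Weight A} (h : S ⟶ Fun.{w} V G) {a : A}
    {n m : SimplexCategoryᵒᵖ} (x : (V.obj a).obj n) (φ : n ⟶ m) (s : S.obj m) :
    evalS (Y := G.obj a) (((toCot h).app a).app n x) φ s =
      natEval (h.app m s) (𝟙 m) ((V.obj a).map φ x) := rfl

/-- Maps into a simplicial set of maps of weights, from a map of weights into a cotensor. -/
def ofCot {S : SSet.{w}} {V G : Weight A} (k : V ⟶ cot S G) : S ⟶ Fun.{w} V G where
  app n := ↾fun s ↦ mkNat V G n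
    (fun a m φ x ↦ evalS (Y := G.obj a) ((k.app a).app m x) (𝟙 m) (S.map φ s))
    (fun a m l ψ φ x ↦ by
      rw [Weight.app_map, Functor.map_comp_apply]
      exact (congrArg (fun χ ↦ evalS (Y := G.obj a) ((k.app a).app m x) χ _)
        ((Category.comp_id ψ).trans (Category.id_comp ψ).symm)).trans
        (map_evalS (Y := G.obj a) ((k.app a).app m x) (𝟙 m) ψ (S.map φ s)).symm)
    (fun {a b m} φ f x ↦ by
      rw [k.naturality f x]
      refine (act_cot S G f _ _ _).trans ?_
      rw [Functor.map_id_apply])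
  naturality n m ψ := by
    ext s
    refine nat_ext fun a k' φ x ↦ ?_
    exact congrArg (evalS (Y := G.obj a) ((k.app a).app k' x) (𝟙 k'))
      (S.map_comp_apply ψ φ s).symm

lemma natEval_ofCot {S : SSet.{w}} {V G : Weight A} (k : V ⟶ cot S G) {a : A}
    {n m : SimplexCategoryᵒᵖ} (s : S.obj n) (φ : n ⟶ m) (x : (V.obj a).obj m) :
    natEval ((ofCot k).app n s) φ x =
      evalS (Y := G.obj a) ((k.app a).app m x) (𝟙 m) (S.map φ s) := rfl

lemma ofCot_toCot {S : SSet.{w}} {V G : Weight A} (h : S ⟶ Fun.{w} V G) :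
    ofCot (toCot h) = h := by
  ext n s
  refine nat_ext fun a m φ x ↦ ?_
  refine (natEval_ofCot (toCot h) s φ x).trans ?_
  rw [evalS_toCot, Functor.map_id_apply]
  have : h.app m (S.map φ s) = (Fun.{w} V G).map φ (h.app n s) :=
    ConcreteCategory.congr_hom (h.naturality φ) s
  rw [this, natEval_map, Category.comp_id]
  rfl

lemma toCot_ofCot {S : SSet.{w}} {V G : Weight A} (k : V ⟶ cot S G) : toCot (ofCot k) = k := by
  refine Weight.hom_ext fun a ↦ ?_
  ext n x
  refine SimpCat.hom_ext fun m φ s ↦ ?_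
  refine (evalS_toCot (ofCot k) x φ s).trans ?_
  rw [natEval_ofCot, Weight.app_map, Functor.map_id_apply]
  exact (evalS_map (Y := G.obj a) ((k.app a).app n x) φ (𝟙 m) s).trans (by rw [Category.comp_id]; rfl)

lemma toCot_injective {S : SSet.{w}} {V G : Weight A} :
    Function.Injective (toCot : (S ⟶ Fun.{w} V G) → (V ⟶ cot S G)) :=
  Function.LeftInverse.injective ofCot_toCot

lemma toCot_comp {S : SSet.{w}} {V W G : Weight A} (u : V ⟶ W) (h : S ⟶ Fun.{w} W G) :
    toCot (h ≫ preFun u G) = u ≫ toCot h := by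
  refine Weight.hom_ext fun a ↦ ?_
  ext n x
  refine SimpCat.hom_ext fun m φ s ↦ ?_
  exact congrArg (natEval (h.app m s) (𝟙 m)) (Weight.app_map u φ x)

lemma toCot_precomp {S T : SSet.{w}} (i : S ⟶ T) {V G : Weight A} (h : T ⟶ Fun.{w} V G) :
    toCot (i ≫ h) = toCot h ≫ cotMap i G := rfl

/-- Lifting against a simplicial set of maps of weights, in terms of cotensors. -/
lemma hasLiftingProperty_preFun {S T : SSet.{w}} (i : S ⟶ T) {V W : Weight A} (u : V ⟶ W)
    (G : Weight A) [HasLiftingProperty u (cotMap i G)] : HasLiftingProperty i (preFun u G) := by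
  constructor
  intro f g sq
  have sq' : CommSq (toCot g) u (cotMap i G) (toCot f) :=
    ⟨by rw [← toCot_comp, sq.w, toCot_precomp]⟩
  exact ⟨⟨⟨ofCot sq'.lift, toCot_injective (by rw [toCot_precomp, toCot_ofCot, sq'.fac_right]),
    toCot_injective (by rw [toCot_comp, toCot_ofCot, sq'.fac_left])⟩⟩⟩

/-- Lifting into a simplicial set of maps of weights, in terms of cotensors. -/
lemma exists_extension_of_cot {S T : SSet.{w}} (i : S ⟶ T) {E W : Weight A} (hE : IsInitial E)
    (G : Weight A) [HasLiftingProperty (hE.to W) (cotMap i G)] (f : S ⟶ Fun.{w} W G) :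
    ∃ g : T ⟶ Fun.{w} W G, i ≫ g = f := by
  have sq : CommSq (hE.to (cot T G)) (hE.to W) (cotMap i G) (toCot f) := ⟨hE.hom_ext _ _⟩
  exact ⟨ofCot sq.lift, toCot_injective (by rw [toCot_precomp, toCot_ofCot, sq.fac_right])⟩

/-- Maps of weights out of `U × Fun a -`. -/
def cellDesc {U : SSet.{w}} {a : A} {G : Weight A} (g : U ⟶ G.obj a) : cellWeight U a ⟶ G where
  app b :=
    { app n := ↾fun p ↦ act G (b := b) p.2 (g.app n p.1)
      naturality n m φ := by
        ext p
        refine Eq.trans ?_ (act_map G (b := b) p.2 φ (g.app n p.1)).symm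
        exact congrArg (act G ((Fun.{w} a b).map φ p.2))
          (ConcreteCategory.congr_hom (g.naturality φ) p.1) }
  naturality {b c n} f p := by
    refine (congrArg (fun q : (U ⊗ Fun.{w} a c).obj n ↦ act G (b := c) q.2 (g.app n q.1))
      (act_cellWeight U a f p)).trans ?_
    exact act_comp G p.2 f _

/-- The map `U ⟶ U × Fun a a` given by the identity of `a`. -/
def cellUnit (U : SSet.{w}) (a : A) : U ⟶ (cellWeight U a).obj a where
  app n := ↾fun x ↦ pair (X := U) (Y := Fun.{w} a a) x (idn a n)
  naturality n m φ := by
    ext x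
    exact Prod.ext rfl (map_idn a φ).symm

lemma cellUnit_desc {U : SSet.{w}} {a : A} {G : Weight A} (g : U ⟶ G.obj a) :
    cellUnit U a ≫ (cellDesc g).app a = g := by
  ext n x
  exact act_idn G _

/-- Enriched Yoneda: every simplex of `U × Fun a b` is a translate of one of the form `(s, id)`. -/
lemma cell_hom_ext {U : SSet.{w}} {a : A} {G : Weight A} {f g : cellWeight U a ⟶ G}
    (h : cellUnit U a ≫ f.app a = cellUnit U a ≫ g.app a) : f = g := by
  refine Weight.hom_ext fun b ↦ ?_
  ext n p
  have hp : p = act (cellWeight U a) p.2 ((cellUnit U a).app n p.1) := by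
    rw [act_cellWeight]
    exact Prod.ext rfl (idn_comp _).symm
  rw [hp]
  refine (f.naturality _ _).trans (Eq.trans ?_ (g.naturality _ _).symm)
  exact congrArg (act G p.2) (ConcreteCategory.congr_hom (NatTrans.congr_app h n) p.1)

lemma cellMap_desc {U V : SSet.{w}} (i : U ⟶ V) {a : A} {G : Weight A} (g : V ⟶ G.obj a) :
    cellMap i a ≫ cellDesc g = cellDesc (i ≫ g) := rfl

lemma cellUnit_naturality {U V : SSet.{w}} (i : U ⟶ V) (a : A) :
    cellUnit U a ≫ (cellMap i a).app a = i ≫ cellUnit V a := rfl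

/-- By enriched Yoneda, the lifting problem for weights is a lifting problem of simplicial sets at
the single object `a`. -/
lemma hasLiftingProperty_cellMap {U V : SSet.{w}} (i : U ⟶ V) (a : A) {G H : Weight A}
    (p : G ⟶ H) [HasLiftingProperty i (p.app a)] : HasLiftingProperty (cellMap i a) p := by
  constructor
  intro f g sq
  have sq' : CommSq (cellUnit U a ≫ f.app a) i (p.app a) (cellUnit V a ≫ g.app a) := ⟨by
    rw [Category.assoc, ← Weight.comp_app, sq.w, Weight.comp_app, ← Category.assoc,
      cellUnit_naturality, Category.assoc]⟩
  refine ⟨⟨⟨cellDesc sq'.lift, cell_hom_ext ?_, cell_hom_ext ?_⟩⟩⟩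
  · rw [cellMap_desc, cellUnit_desc, sq'.fac_left]
  · rw [Weight.comp_app, ← Category.assoc, cellUnit_desc, sq'.fac_right]

/-- Maps of weights which levelwise belong to a class of maps. -/
def levelwise (P : MorphismProperty SSet.{w}) : MorphismProperty (Weight A) :=
  fun _ _ f ↦ ∀ a, P (f.app a)

end Weights

/-! ### Restriction maps between internal homs into a Kan complex. -/

section InternalHom

lemma preS_eq {S T : SSet.{w}} (i : S ⟶ T) (X : SSet.{w}) :
    preS i X = (MonoidalClosed.pre i).app X := by
  apply MonoidalClosed.uncurry_injective
  exact (MonoidalClosed.uncurry_eq _).trans (MonoidalClosed.uncurry_pre i X).symm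

-- The restriction map is the Leibniz internal hom of `i` with the Kan fibration from `X` to the
-- terminal simplicial set.
open SSet.modelCategoryQuillen HomotopicalAlgebra in
lemma preS_fibration {S T : SSet.{w}} (i : S ⟶ T) [Mono i] (X : SSet.{w}) [SSet.KanComplex X] :
    SSet.modelCategoryQuillen.J.rlp (preS i X) := by
  have : Fibration ((MonoidalClosed.pre i).app X) :=
    SSet.fibration_pullbackObjObjπ (Functor.PullbackObjObj.ofIsTerminal
      MonoidalClosed.internalHom i (terminal.from X) terminalIsTerminal)
  rw [← SSet.modelCategoryQuillen.fibrations_eq, preS_eq]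
  exact (HomotopicalAlgebra.fibration_iff _).1 this

-- By adjunction, lifting against a boundary inclusion amounts to extending along its
-- pushout-product with `i`, which is anodyne because `i` is.
open SSet.modelCategoryQuillen HomotopicalAlgebra in
lemma preS_trivialFibration {S T : SSet.{w}} (i : S ⟶ T) (hi : SSet.anodyneExtensions i)
    (Z : SSet.{w}) [SSet.KanComplex Z] : SSet.modelCategoryQuillen.I.rlp (preS i Z) := by
  rw [preS_eq]
  rintro _ _ _ ⟨n⟩
  let sq₁₂ := Functor.PushoutObjObj.ofHasPushout (curriedTensor SSet) i ∂Δ[n].ι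
  let sq₁₃ := Functor.PullbackObjObj.ofIsTerminal
    MonoidalClosed.internalHom i (terminal.from Z) terminalIsTerminal
  suffices HasLiftingProperty ∂Δ[n].ι sq₁₃.π from this
  refine (MonoidalClosed.internalHomAdjunction₂.hasLiftingProperty_iff sq₁₂ sq₁₃).1 ?_
  refine SSet.anodyneExtensions_pushoutObjObjι' sq₁₂ hi _ ?_
  rw [← HomotopicalAlgebra.fibration_iff]
  exact inferInstanceAs (Fibration (terminal.from Z))

end InternalHom

end SimpCat

namespace SimpCat

/-! ### Homotopies over the free-living isomorphism, and equivalences. -/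

section Homotopy

variable {X Y Z : SSet.{w}}

/-- The homotopy on `n`-simplices. -/
abbrev happ {S : SSet.{w}} (h : X ⊗ S ⟶ Y) {n : SimplexCategoryᵒᵖ} (x : X.obj n) (s : S.obj n) :
    Y.obj n :=
  h.app n (pair (X := X) (Y := S) x s)

/-- Currying for maps of simplicial sets. -/
def curryS {S : SSet.{w}} (h : X ⊗ S ⟶ Y) : X ⟶ Fun.{w} S Y where
  app n := ↾fun x ↦ mkHom S Y n (fun _ φ s ↦ happ h (X.map φ x) s) (fun {m k} ψ φ s ↦ by
    rw [Functor.map_comp_apply]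
    exact ConcreteCategory.congr_hom (h.naturality ψ) (pair (X := X) (Y := S) (X.map φ x) s))
  naturality n m φ := by
    ext x
    refine hom_ext fun k ψ s ↦ ?_
    change happ h (X.map ψ (X.map φ x)) s = happ h (X.map (φ ≫ ψ) x) s
    rw [Functor.map_comp_apply]

/-- Uncurrying for maps of simplicial sets. -/
def uncurryS {S : SSet.{w}} (h : X ⟶ Fun.{w} S Y) : X ⊗ S ⟶ Y where
  app n := ↾fun p ↦ evalS (h.app n p.1) (𝟙 n) p.2
  naturality n m φ := by
    ext p
    have h₁ : h.app m (X.map φ p.1) = (Fun.{w} S Y).map φ (h.app n p.1) :=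
      ConcreteCategory.congr_hom (h.naturality φ) p.1
    refine (congrArg (fun k ↦ evalS k (𝟙 m) (S.map φ p.2)) h₁).trans ?_
    rw [evalS_map]
    exact ((map_evalS (h.app n p.1) (𝟙 n) φ p.2).trans
      (congrArg (fun ψ ↦ evalS (h.app n p.1) ψ _) (by simp))).symm

lemma evalS_curryS {S : SSet.{w}} (h : X ⊗ S ⟶ Y) {n m : SimplexCategoryᵒᵖ} (x : X.obj n)
    (φ : n ⟶ m) (s : S.obj m) : evalS ((curryS h).app n x) φ s = happ h (X.map φ x) s := rfl

/-- The constant simplex at a vertex. -/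
abbrev constSimplex (v : X _⦋0⦌) (n : SimplexCategoryᵒᵖ) : X.obj n :=
  X.map (n.unop.const _ 0).op v

lemma map_constSimplex (v : X _⦋0⦌) {n m : SimplexCategoryᵒᵖ} (φ : n ⟶ m) :
    X.map φ (constSimplex v n) = constSimplex v m := by
  rw [constSimplex, ← Functor.map_comp_apply]
  rfl

lemma atVertex_app (h : X ⊗ SSet.coherentIso.{w} ⟶ Y) (v : SSet.coherentIso.{w} _⦋0⦌)
    {n : SimplexCategoryᵒᵖ} (x : X.obj n) :
    (atVertex h v).app n x = happ h x (constSimplex v n) := rfl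

lemma atVertex_eq_iff (h : X ⊗ SSet.coherentIso.{w} ⟶ Y) (v : SSet.coherentIso.{w} _⦋0⦌)
    (f : X ⟶ Y) : atVertex h v = f ↔
      ∀ (n : SimplexCategoryᵒᵖ) (x : X.obj n), happ h x (constSimplex v n) = f.app n x := by
  refine ⟨fun h n x ↦ by rw [← h, atVertex_app], fun h ↦ ?_⟩
  ext n x
  exact h n x

/-- The two vertices of the free-living isomorphism. -/
def isoVertex (b : Bool) : SSet.coherentIso.{w} _⦋0⦌ :=
  if b then SSet.coherentIso.x₁ else SSet.coherentIso.x₀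

/-- The discrete simplicial set on two points. -/
def twoPoints : SSet.{w} := (Functor.const _).obj (ULift Bool)

/-- The inclusion of the vertices of the free-living isomorphism. -/
def twoPointsι : twoPoints.{w} ⟶ SSet.coherentIso.{w} where
  app n := ↾fun b ↦ constSimplex (isoVertex b.down) n
  naturality n m φ := by
    refine ConcreteCategory.hom_ext _ _ fun b ↦ ?_
    exact (map_constSimplex (isoVertex b.down) φ).symm

lemma constSimplex_injective {v v' : X _⦋0⦌} {n : SimplexCategoryᵒᵖ}
    (h : constSimplex v n = constSimplex v' n) : v = v' := by
  have := congrArg (X.map (SimplexCategory.const ⦋0⦌ n.unop 0).op) h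
  rw [map_constSimplex, map_constSimplex] at this
  have h0 : (SimplexCategory.const ⦋0⦌ ⦋0⦌ 0) = 𝟙 _ := by
    ext i : 3
    exact Subsingleton.elim (α := Fin 1) _ _
  change X.map (SimplexCategory.const ⦋0⦌ ⦋0⦌ 0).op v =
    X.map (SimplexCategory.const ⦋0⦌ ⦋0⦌ 0).op v' at this
  rwa [h0, op_id, Functor.map_id_apply, Functor.map_id_apply] at this

lemma x₀_ne_x₁ : SSet.coherentIso.x₀.{w} ≠ SSet.coherentIso.x₁ := by
  intro h
  have : WalkingIso.zero.{w} = WalkingIso.one :=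
    congrArg (fun F : ComposableArrows WalkingIso.{w} 0 ↦ F.obj 0) h
  have := congrArg WalkingIso.equivBool this
  exact absurd this (by decide)

instance mono_twoPointsι : Mono twoPointsι.{w} := by
  rw [NatTrans.mono_iff_mono_app]
  intro n
  rw [mono_iff_injective]
  rintro ⟨b⟩ ⟨b'⟩ h
  have := constSimplex_injective (v := isoVertex b) (v' := isoVertex b') h
  obtain _ | _ := b <;> obtain _ | _ := b'
  · rfl
  · exact absurd this x₀_ne_x₁
  · exact absurd this.symm x₀_ne_x₁
  · rfl

lemma mono_whiskerLeft (X : SSet.{w}) {S T : SSet.{w}} (i : S ⟶ T) [Mono i] : Mono (X ◁ i) := by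
  rw [NatTrans.mono_iff_mono_app]
  intro n
  rw [mono_iff_injective]
  rintro ⟨x, s⟩ ⟨x', s'⟩ h
  have hi : Function.Injective (i.app n) := by
    rw [← mono_iff_injective]
    infer_instance
  exact Prod.ext (congrArg (fun p : X.obj n × T.obj n ↦ p.1) h)
    (hi (congrArg (fun p : X.obj n × T.obj n ↦ p.2) h))

/-- This coface is the horn inclusion `Λ[1, 0] ⟶ Δ[1]`, whose source has `δ 1` as its only face. -/
lemma anodyneExtensions_δ_one :
    SSet.anodyneExtensions (SSet.stdSimplex.δ 1 : (Δ[0] : SSet.{w}) ⟶ Δ[1]) := by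
  intro E B p hp
  constructor
  intro f g sq
  have hf : SSet.horn.IsCompatible (i := (0 : Fin 2)) (fun _ _ ↦ f) := trivial
  have : HasLiftingProperty (Λ[1, 0].ι : (Λ[1, 0] : SSet.{w}) ⟶ Δ[1]) p :=
    SSet.anodyneExtensions.horn_ι (n := 1) 0 _ hp
  have sq' : CommSq hf.desc Λ[1, 0].ι p g := ⟨SSet.horn.hom_ext' fun j hj ↦ by
    obtain rfl : j = 1 := by fin_cases j; exacts [absurd rfl hj, rfl]
    rw [SSet.horn.IsCompatible.ι_desc_assoc, SSet.horn.ι_ι_assoc, sq.w]⟩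
  refine ⟨⟨⟨sq'.lift, ?_, sq'.fac_right⟩⟩⟩
  rw [← SSet.horn.ι_ι (0 : Fin 2) 1 (by decide), Category.assoc, sq'.fac_left,
    SSet.horn.IsCompatible.ι_desc]

/-- A pair of maps as a map from a product with two points. -/
def pairMap (f g : X ⟶ Y) : X ⊗ twoPoints.{w} ⟶ Y where
  app n := ↾fun p ↦ if (show ULift Bool from p.2).down then g.app n p.1 else f.app n p.1
  naturality n m φ := by
    ext p
    obtain ⟨x, ⟨_ | _⟩⟩ := p
    · exact ConcreteCategory.congr_hom (f.naturality φ) x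
    · exact ConcreteCategory.congr_hom (g.naturality φ) x

/-- A homotopy relating any two lifts of the same map along a map with the right lifting property
with respect to monomorphisms. -/
lemma exists_homotopy_of_rlp {p : Y ⟶ Z} (hp : SSet.modelCategoryQuillen.I.rlp p) (f g : X ⟶ Y)
    (hfg : f ≫ p = g ≫ p) : ∃ h : X ⊗ SSet.coherentIso.{w} ⟶ Y,
      atVertex h SSet.coherentIso.x₀ = f ∧ atVertex h SSet.coherentIso.x₁ = g := by
  rw [← SSet.rlp_monomorphisms] at hp
  have : HasLiftingProperty (X ◁ twoPointsι.{w}) p := hp _ (mono_whiskerLeft _ _)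
  -- The homotopy is a lift of the constant homotopy downstairs, with prescribed ends `f` and `g`.
  have sq : CommSq (pairMap f g) (X ◁ twoPointsι.{w}) p
      (CartesianMonoidalCategory.fst X _ ≫ f ≫ p) := ⟨by
    ext n ⟨x, ⟨_ | _⟩⟩
    · rfl
    · exact (ConcreteCategory.congr_hom (NatTrans.congr_app hfg n) x).symm⟩
  refine ⟨sq.lift, ?_, ?_⟩
  · rw [atVertex_eq_iff]
    intro n x
    have := (ConcreteCategory.congr_hom (NatTrans.congr_app sq.fac_left n)
      (pair (X := X) (Y := twoPoints.{w}) x ⟨false⟩))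
    exact this
  · rw [atVertex_eq_iff]
    intro n x
    have := (ConcreteCategory.congr_hom (NatTrans.congr_app sq.fac_left n)
      (pair (X := X) (Y := twoPoints.{w}) x ⟨true⟩))
    exact this

lemma atVertex_whisker {T : SSet.{w}} (f : T ⟶ X) (h : X ⊗ SSet.coherentIso.{w} ⟶ Y) (g : Y ⟶ Z) (v) :
    atVertex (f ▷ _ ≫ h ≫ g) v = f ≫ atVertex h v ≫ g := rfl

/-- The edge of the free-living isomorphism, as a map from the interval. -/
def isoEdge : (Δ[1] : SSet.{w}) ⟶ SSet.coherentIso.{w} :=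
  SSet.yonedaEquiv.symm SSet.coherentIso.hom.edge

lemma δ_one_isoEdge : SSet.stdSimplex.δ 1 ≫ isoEdge.{w} = SSet.const SSet.coherentIso.x₀ := by
  rw [isoEdge, SSet.stdSimplex.δ_comp_yonedaEquiv_symm, SSet.Edge.src_eq,
    SSet.yonedaEquiv_symm_zero]

lemma δ_zero_isoEdge : SSet.stdSimplex.δ 0 ≫ isoEdge.{w} = SSet.const SSet.coherentIso.x₁ := by
  rw [isoEdge, SSet.stdSimplex.δ_comp_yonedaEquiv_symm, SSet.Edge.tgt_eq,
    SSet.yonedaEquiv_symm_zero]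

/-- Concatenation of homotopies into a Kan complex. -/
lemma exists_concat [SSet.KanComplex Y] (h k : X ⊗ SSet.coherentIso.{w} ⟶ Y)
    (hk : atVertex h SSet.coherentIso.x₁ = atVertex k SSet.coherentIso.x₀) :
    ∃ l : X ⊗ SSet.coherentIso.{w} ⟶ Y,
      atVertex l SSet.coherentIso.x₀ = atVertex h SSet.coherentIso.x₀ ∧
      atVertex l SSet.coherentIso.x₁ = atVertex k SSet.coherentIso.x₁ := by
  -- The homotopy `h` is transported along `k`. The map from homotopies in `Y` to their pairs of
  -- endpoints is a Kan fibration; `b'` is a path of endpoints that keeps the start of `h` fixed and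
  -- moves its end along `k`. Lifting it from `h` and evaluating at the vertex `1` of `Δ[1]` gives
  -- the concatenation.
  let b' : (X ⊗ Δ[1]) ⊗ twoPoints.{w} ⟶ Y :=
    pairMap (CartesianMonoidalCategory.fst X _ ≫ atVertex h SSet.coherentIso.x₀) (X ◁ isoEdge ≫ k)
  have hb : X ◁ SSet.stdSimplex.δ 1 ≫ X ◁ isoEdge ≫ k = CartesianMonoidalCategory.fst X _ ≫
      atVertex k SSet.coherentIso.x₀ := by
    rw [← whiskerLeft_comp_assoc, δ_one_isoEdge]
    rfl
  have hb' : CartesianMonoidalCategory.lift (𝟙 X) (SSet.const (SSet.stdSimplex.obj₀Equiv.symm 1)) ≫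
      X ◁ isoEdge ≫ k = atVertex k SSet.coherentIso.x₁ := by
    have h : (SSet.const (SSet.stdSimplex.obj₀Equiv.symm 1) : X ⟶ Δ[1]) ≫ isoEdge =
        SSet.const SSet.coherentIso.x₁ := by
      have := δ_zero_isoEdge.{w}
      rw [SSet.stdSimplex.δ_zero_eq_const] at this
      rw [SSet.const_comp] at this ⊢
      rw [← SSet.yonedaEquiv_const (isoEdge.{w}.app (op ⦋0⦌) _), this, SSet.yonedaEquiv_const]
    rw [CartesianMonoidalCategory.lift_whiskerLeft_assoc, h]
    rfl
  have sq : CommSq (CartesianMonoidalCategory.fst X Δ[0] ≫ curryS h)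
      (X ◁ (SSet.stdSimplex.δ 1 : Δ[0] ⟶ Δ[1])) (preS twoPointsι Y) (curryS b') := ⟨by
    ext n p
    refine hom_ext fun m φ c ↦ ?_
    obtain ⟨_ | _⟩ := c
    · rfl
    · have h₁ := ConcreteCategory.congr_hom (NatTrans.congr_app hb m) ((X ⊗ Δ[0]).map φ p)
      have h₂ := ConcreteCategory.congr_hom (NatTrans.congr_app hk m) (X.map φ p.1)
      exact h₂.trans h₁.symm⟩
  have : HasLiftingProperty (X ◁ (SSet.stdSimplex.δ 1 : Δ[0] ⟶ Δ[1])) (preS twoPointsι Y) :=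
    anodyneExtensions_δ_one.whiskerLeft X _ (preS_fibration _ _)
  let z : X ⟶ X ⊗ Δ[1] :=
    CartesianMonoidalCategory.lift (𝟙 X) (SSet.const (SSet.stdSimplex.obj₀Equiv.symm 1))
  have key (c : Bool) {n : SimplexCategoryᵒᵖ} (x : X.obj n) :
      happ (uncurryS (z ≫ sq.lift)) x (constSimplex (isoVertex c) n) =
        happ b' ((X ⊗ Δ[1]).map (𝟙 n) (z.app n x)) (ULift.up c : twoPoints.{w}.obj n) := by
    have h₁ : (preS twoPointsι Y).app n (sq.lift.app n (z.app n x)) =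
        (curryS b').app n (z.app n x) :=
      ConcreteCategory.congr_hom (NatTrans.congr_app sq.fac_right n) (z.app n x)
    refine Eq.trans ?_ (evalS_curryS b' (z.app n x) (𝟙 n) (ULift.up c : twoPoints.{w}.obj n))
    rw [← h₁]
    rfl
  refine ⟨uncurryS (z ≫ sq.lift), ?_, ?_⟩
  · rw [atVertex_eq_iff]
    intro n x
    refine (key false x).trans ?_
    rw [Functor.map_id_apply]
    rfl
  · rw [atVertex_eq_iff]
    intro n x
    refine (key true x).trans ?_
    rw [Functor.map_id_apply]
    exact ConcreteCategory.congr_hom (NatTrans.congr_app hb' n) x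

/-- A section `s` of `p` is an inverse up to homotopy, since `𝟙 Y` and `p ≫ s` both lift `p`. One of
the two homotopies of the composite is a concatenation, which takes place in `X`; this is where `X`
being Kan enters. -/
lemma IsEquivalence.comp_of_rlp {f : X ⟶ Y} (hf : IsEquivalence f) {p : Y ⟶ Z}
    (hp : SSet.modelCategoryQuillen.I.rlp p) [SSet.KanComplex X] : IsEquivalence (f ≫ p) := by
  obtain ⟨g, h, k, h₀, h₁, k₀, k₁⟩ := hf
  obtain ⟨s, hs⟩ := exists_section_of_rlp p hp
  obtain ⟨l, l₀, l₁⟩ := exists_homotopy_of_rlp hp (𝟙 Y) (p ≫ s) (by simp [hs])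
  obtain ⟨m, m₀, m₁⟩ := exists_concat h (f ▷ _ ≫ l ≫ g) (by
    rw [atVertex_whisker, l₀, h₁, Category.id_comp])
  refine ⟨s ≫ g, m, s ▷ _ ≫ k ≫ p, m₀.trans h₀, ?_, ?_, ?_⟩
  · rw [m₁, atVertex_whisker, l₁]
    simp only [Category.assoc]
  · rw [atVertex_whisker, k₀]
    simp only [Category.assoc]
  · rw [atVertex_whisker, k₁, Category.id_comp, hs]

lemma IsEquivalence.comp_iso {f : X ⟶ Y} (hf : IsEquivalence f) (e : Y ≅ Z) :
    IsEquivalence (f ≫ e.hom) := by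
  obtain ⟨g, h, k, h₀, h₁, k₀, k₁⟩ := hf
  refine ⟨e.inv ≫ g, h, e.inv ▷ _ ≫ k ≫ e.hom, h₀, ?_, ?_, ?_⟩
  · rw [h₁]
    simp
  · rw [atVertex_whisker, k₀]
    simp
  · rw [atVertex_whisker, k₁]
    simp

lemma isEquivalence_of_iso (e : X ≅ Y) : IsEquivalence e.hom := by
  refine ⟨e.inv, CartesianMonoidalCategory.fst _ _, CartesianMonoidalCategory.fst _ _,
    rfl, ?_, ?_, rfl⟩
  · exact e.hom_inv_id.symm
  · exact e.inv_hom_id.symm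

lemma mem_groupoidCore_map (f : X ⟶ Y) {n : SimplexCategoryᵒᵖ} {x : X.obj n}
    (hx : x ∈ (groupoidCore X).obj n) : f.app n x ∈ (groupoidCore Y).obj n := by
  intro φ
  have : Y.map φ (f.app n x) = f.app _ (X.map φ x) :=
    (ConcreteCategory.congr_hom (f.naturality φ) x).symm
  rw [this]
  exact (hx φ).map f

/-- The map induced on groupoid cores. -/
def coreMap (f : X ⟶ Y) : (groupoidCore X : SSet.{w}) ⟶ groupoidCore Y where
  app n := ↾fun x ↦ ⟨f.app n x.1, mem_groupoidCore_map f x.2⟩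
  naturality n m φ := by
    ext x
    have := ConcreteCategory.congr_hom (f.naturality φ) x.1
    exact Subtype.ext this

/-- Any two objects of the walking isomorphism are uniquely isomorphic, so every edge is the image
of the generic invertible edge under a functor. -/
lemma mem_groupoidCore_coherentIso {n : SimplexCategoryᵒᵖ} (x : SSet.coherentIso.{w}.obj n) :
    x ∈ (groupoidCore SSet.coherentIso.{w}).obj n := by
  intro φ
  let e : ComposableArrows WalkingIso.{w} 1 := SSet.coherentIso.{w}.map φ x
  refine ⟨SSet.coherentIso.invStructOfEqMapHom
    (g := nerveMap (WalkingIso.fromIso (Codiscrete.iso e.left e.right))) ?_⟩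
  exact ComposableArrows.ext₁ rfl rfl (Subsingleton.elim _ _)

/-- The homotopy induced on groupoid cores. -/
def coreHomotopy (h : X ⊗ SSet.coherentIso.{w} ⟶ Y) :
    (groupoidCore X : SSet.{w}) ⊗ SSet.coherentIso.{w} ⟶ groupoidCore Y where
  app n := ↾fun p ↦ ⟨happ h p.1.1 p.2,
    mem_groupoidCore_map h (fun φ ↦ (p.1.2 φ).pair (mem_groupoidCore_coherentIso p.2 φ))⟩
  naturality n m φ := by
    ext p
    have := ConcreteCategory.congr_hom (h.naturality φ)
      (pair (X := X) (Y := SSet.coherentIso.{w}) p.1.1 p.2)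
    exact Subtype.ext this

/-- Homotopies parametrised by the free-living isomorphism restrict to cores, because all edges of
the parameter are invertible. -/
lemma IsEquivalence.core {f : X ⟶ Y} (hf : IsEquivalence f) : IsEquivalence (coreMap f) := by
  obtain ⟨g, h, k, h₀, h₁, k₀, k₁⟩ := hf
  refine ⟨coreMap g, coreHomotopy h, coreHomotopy k, ?_, ?_, ?_, ?_⟩ <;>
    rw [atVertex_eq_iff] at * <;> intro n x <;> apply Subtype.ext
  · exact h₀ n x.1
  · exact h₁ n x.1
  · exact k₀ n x.1
  · exact k₁ n x.1

end Homotopy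

end SimpCat

namespace SimpCat

/-! ### Cofibrant weights, and lifting properties of cell complexes and projective anodyne
extensions. -/

section Lifting

lemma kanComplex_of_hornFilling {X : SSet.{w}}
    (h : ∀ (n : ℕ) (i : Fin (n + 2)) (f : (Λ[n + 1, i] : SSet) ⟶ X),
      ∃ g : Δ[n + 1] ⟶ X, Λ[n + 1, i].ι ≫ g = f) : SSet.KanComplex X := by
  rw [SSet.KanComplex.iff]
  intro n i f hf
  obtain ⟨g, hg⟩ := h n i hf.desc
  refine ⟨g, fun j hj ↦ ?_⟩
  rw [← SSet.horn.ι_ι i j hj, Category.assoc, hg, SSet.horn.IsCompatible.ι_desc]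

variable {A : Type w} [EnrichedCategory SSet.{w} A]

variable (A) in
/-- Levelwise Kan fibrations of weights. -/
abbrev kanFib : MorphismProperty (Weight A) := levelwise SSet.modelCategoryQuillen.J.rlp

variable (A) in
/-- Levelwise trivial fibrations of weights. -/
abbrev trivFib : MorphismProperty (Weight A) := levelwise SSet.modelCategoryQuillen.I.rlp

/-- By transposition, `u` has to lift against the restriction of `G` from `Δ[n]`-cotensors to
`∂Δ[n]`-cotensors, which is a levelwise Kan fibration. -/
lemma preFun_rlp {V W : Weight A} {u : V ⟶ W} (hu : (kanFib A).llp u) {G : Weight A}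
    (hG : IsLevelwiseKan G) : SSet.modelCategoryQuillen.I.rlp (preFun u G) := by
  rintro _ _ _ ⟨n⟩
  have : HasLiftingProperty u (cotMap ∂Δ[n].ι G) := hu _ fun a ↦ by
    have := hG a
    exact preS_fibration _ _
  exact hasLiftingProperty_preFun _ _ _

/-- The weight is projectively cofibrant: the map from the empty weight has the left lifting
property with respect to levelwise trivial fibrations. -/
def IsCofibrant (W : Weight A) : Prop :=
  ∃ (E : Weight A) (hE : IsInitial E), (trivFib A).llp (hE.to W)

/-- The same transposition with horns in place of boundaries: restriction of cotensors is then a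
levelwise trivial fibration, so cofibrancy of `W` suffices. -/
lemma IsCofibrant.kanComplex_fun {W : Weight A} (hW : IsCofibrant W) {G : Weight A}
    (hG : IsLevelwiseKan G) : SSet.KanComplex (Fun.{w} W G) := by
  obtain ⟨E, hE, h⟩ := hW
  refine kanComplex_of_hornFilling fun n i f ↦ ?_
  have : HasLiftingProperty (hE.to W) (cotMap Λ[n + 1, i].ι G) := h _ fun a ↦ by
    have := hG a
    exact preS_trivialFibration _ (SSet.anodyneExtensions.horn_ι i) _
  exact exists_extension_of_cot _ hE G f

lemma kanFib_le_llp_projectiveHorn (p) : (kanFib A).llp (projectiveHorn (A := A) p) := by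
  intro G H q hq
  have : HasLiftingProperty Λ[p.1.1 + 1, p.1.2].ι (q.app p.2) :=
    SSet.anodyneExtensions.horn_ι p.1.2 _ (hq p.2)
  exact hasLiftingProperty_cellMap _ _ _

lemma trivFib_le_llp_projectiveCell (p) : (trivFib A).llp (projectiveCell (A := A) p) := by
  intro G H q hq
  have : HasLiftingProperty ∂Δ[p.1].ι (q.app p.2) := hq p.2 _ ⟨p.1⟩
  exact hasLiftingProperty_cellMap _ _ _

lemma llp_of_relativeCellComplex {T : MorphismProperty (Weight A)} {ι : Type w}
    {X Y : ι → Weight A} {i : ∀ p, X p ⟶ Y p} (h : ∀ p, T.llp (i p)) {V W : Weight A} {f : V ⟶ W}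
    (hf : Nonempty (HomotopicalAlgebra.RelativeCellComplex.{w} (fun (_ : ℕ) p ↦ i p) f)) :
    T.llp f := by
  obtain ⟨c⟩ := hf
  have hT : T ≤ (MorphismProperty.ofHoms i).rlp := by
    intro _ _ q hq _ _ _ ⟨p⟩
    exact h p q hq
  exact MorphismProperty.antitone_llp hT _
    ((MorphismProperty.ofHoms i).transfiniteCompositionsOfShape_pushouts_coproducts_le_llp_rlp ℕ _
      ⟨c.transfiniteCompositionOfShape⟩)

lemma trivFib_le_kanFib : trivFib A ≤ kanFib A := fun _ _ _ hq a ↦ by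
  have := hq a
  rw [← SSet.rlp_monomorphisms] at this
  intro _ _ i hi
  simp only [SSet.modelCategoryQuillen.J, MorphismProperty.iSup_iff] at hi
  obtain ⟨n, ⟨k⟩⟩ := hi
  exact this _ (inferInstanceAs (Mono _))

lemma IsProjectiveAnodyne.llp {V W : Weight A} {u : V ⟶ W} (hu : IsProjectiveAnodyne u) :
    (kanFib A).llp u :=
  llp_of_relativeCellComplex kanFib_le_llp_projectiveHorn hu

lemma IsFlexible.isCofibrant {W : Weight A} (hW : IsFlexible W) : IsCofibrant W := by
  obtain ⟨E, hE, h⟩ := hW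
  exact ⟨E, hE, llp_of_relativeCellComplex trivFib_le_llp_projectiveCell h⟩

lemma IsCofibrant.of_llp {V W : Weight A} (hV : IsCofibrant V) {u : V ⟶ W}
    (hu : (kanFib A).llp u) : IsCofibrant W := by
  obtain ⟨E, hE, h⟩ := hV
  refine ⟨E, hE, ?_⟩
  rw [← hE.hom_ext (hE.to V ≫ u) (hE.to W)]
  exact MorphismProperty.comp_mem _ _ _ h (MorphismProperty.antitone_llp trivFib_le_kanFib _ hu)

end Lifting

/-! ### Cones in the core, and homotopy limits with levelwise Kan weights. -/

section Core

variable {K : Type u} [EnrichedCategory SSet.{w} K]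
  {A : Type w} [EnrichedCategory SSet.{w} A]

lemma isLevelwiseKan_funAlong [QCatEnriched.{w} K] (L : Core K) (F : SFunctor A (Core K)) :
    IsLevelwiseKan (funAlong L F) := fun a ↦ by
  have := QCatEnriched.quasicategory (C := K) L.obj (F.obj a).obj
  exact kanComplex_groupoidCore (X := Fun.{w} L.obj (F.obj a).obj)

/-- Cones weighted by a levelwise Kan weight have legs in the core. -/
def coneLift {W : Weight A} (hW : IsLevelwiseKan W) {F : SFunctor A (Core K)} {L : K}
    (c : Cone W F.toBase L) : Cone W F (Core.mk L) where
  app a :=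
    { app n := ↾fun x ↦ (⟨c.leg x, by
        have := hW a
        exact mem_groupoidCore_map (c.app a) (mem_groupoidCore_of_kanComplex x)⟩ :
          (groupoidCore (Fun.{w} L (F.obj a).obj) : SSet.{w}).obj n)
      naturality n m φ := by
        ext x
        have := ConcreteCategory.congr_hom ((c.app a).naturality φ) x
        exact Subtype.ext this }
  naturality {a b n} f x := by
    refine Eq.trans (Subtype.ext ?_) (act_funAlong (Core.mk L) F f _).symm
    exact (c.naturality f x).trans (act_funAlong L F.toBase f _)

lemma coneLift_comp {W : Weight A} (hW : IsLevelwiseKan W) {F : SFunctor A (Core K)} {L : K}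
    (c : Cone W F.toBase L) : coneLift hW c ≫ funAlongInclusion (Core.mk L) F = c := rfl

/-- Evaluation of maps of weights. -/
def evalMap (V W : Weight A) (a : A) : Fun.{w} V W ⊗ V.obj a ⟶ W.obj a where
  app n := ↾fun p ↦ natEval p.1 (𝟙 n) p.2
  naturality n m φ := by
    ext p
    change natEval ((Fun.{w} V W).map φ p.1) (𝟙 m) ((V.obj a).map φ p.2) =
      (W.obj a).map φ (natEval p.1 (𝟙 n) p.2)
    rw [natEval_map, map_natEval, Category.comp_id, Category.id_comp]

/-- Evaluation is a map out of a product; it is applied to a pair whose components both have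
invertible edges, the second one because `V` is levelwise Kan. -/
lemma natEval_mem_groupoidCore {V W : Weight A} (hV : IsLevelwiseKan V) {n : SimplexCategoryᵒᵖ}
    {h : (Fun.{w} V W).obj n} (hh : h ∈ (groupoidCore (Fun.{w} V W)).obj n) {a : A}
    {m : SimplexCategoryᵒᵖ} (φ : n ⟶ m) (x : (V.obj a).obj m) :
    natEval h φ x ∈ (groupoidCore (W.obj a)).obj m := by
  have h₁ : natEval h φ x = (evalMap V W a).app m
      (pair (X := Fun.{w} V W) (Y := V.obj a) ((Fun.{w} V W).map φ h) x) :=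
    (congrArg (fun ψ ↦ natEval h ψ x) (Category.comp_id φ)).symm
  rw [h₁]
  have := hV a
  refine mem_groupoidCore_map (evalMap V W a) fun ψ ↦ ?_
  exact ((groupoidCore _).map φ hh ψ).pair (isInvertible_of_kanComplex _)

/-- For a levelwise Kan and cofibrant weight, the simplicial sets of weighted cones in the core
are the groupoid cores of those in the ambient simplicial category. -/
def coreConesIso [QCatEnriched.{w} K] {W : Weight A} (hW : IsLevelwiseKan W) (hW' : IsCofibrant W)
    (F : SFunctor A (Core K)) (X : Core K) :
    (groupoidCore (Fun.{w} W (funAlong X.obj F.toBase)) : SSet.{w}) ≅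
      Fun.{w} W (funAlong X F) where
  hom :=
    { app n := ↾fun h ↦ mkNat W (funAlong X F) n
        (fun a m φ x ↦ ⟨natEval h.1 φ x, natEval_mem_groupoidCore hW h.2 φ x⟩)
        (fun a m k ψ φ x ↦ Subtype.ext (map_natEval h.1 φ ψ x).symm)
        (fun {a b m} φ f x ↦ by
          refine Eq.trans (Subtype.ext ?_) (act_funAlong X F f _).symm
          exact (natEval_act h.1 φ f x).trans (act_funAlong X.obj F.toBase f _))
      naturality _ _ _ := rfl }
  inv :=
    { app n := ↾fun h ↦ ⟨(postFun W (funAlongInclusion X F)).app n h,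
        -- Simplices of cones in the core form a Kan complex, so their edges are invertible there,
        -- and hence also among cones in `K`.
        have := hW'.kanComplex_fun (isLevelwiseKan_funAlong X F)
        mem_groupoidCore_map _ (mem_groupoidCore_of_kanComplex h)⟩
      naturality _ _ _ := rfl }
  hom_inv_id := rfl
  inv_hom_id := rfl

/-- Homotopy limits weighted by levelwise Kan weights are homotopy limits in the core, also for
weights related to the given one by a projective anodyne map. -/
lemma isHomotopyLimit_core [QCatEnriched.{w} K] {V W : Weight A} (hW : IsLevelwiseKan W)
    (hW' : IsCofibrant W) {u : V ⟶ W} (hu : (kanFib A).llp u) {F : SFunctor A (Core K)} {L : K}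
    {c : Cone W F.toBase L} (hc : c.IsHomotopyLimit) :
    Cone.IsHomotopyLimit (W := V) (F := F) (L := Core.mk L) (u ≫ coneLift hW c) := by
  intro X
  -- The comparison map in the core is the core of the comparison map in `K`, then this isomorphism,
  -- then restriction along `u`.
  have h₁ := ((hc X.obj).core).comp_iso (coreConesIso hW hW' F X)
  have := QCatEnriched.quasicategory (C := K) X.obj L
  have := kanComplex_groupoidCore (X := Fun.{w} X.obj L)
  exact h₁.comp_of_rlp (preFun_rlp hu (isLevelwiseKan_funAlong X F))

lemma exists_coneLift_isHomotopyLimit [QCatEnriched.{w} K] {W W' : Weight A} {u : W ⟶ W'}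
    {F : SFunctor A (Core K)} {L : K} {c : Cone W' F.toBase L} (hW : IsFlexible W)
    (hu : IsProjectiveAnodyne u) (hW' : IsLevelwiseKan W') (hc : c.IsHomotopyLimit) :
    ∃ d : Cone W' F (Core.mk L), d ≫ funAlongInclusion (Core.mk L) F = c ∧
      Cone.IsHomotopyLimit (W := W) (F := F) (L := Core.mk L) (u ≫ d) :=
  ⟨coneLift hW' c, coneLift_comp hW' c,
    isHomotopyLimit_core hW' (hW.isCofibrant.of_llp hu.llp) hu.llp hc⟩

end Core

end SimpCat

namespace SimpCat

/-! ### Colimits of weights are computed levelwise. -/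

section Colimits

variable {A : Type w} [EnrichedCategory SSet.{w} A]

/-- The functor sending a weight `W` to the set of `n`-simplices of `W b`. -/
@[simps obj]
def ev (b : A) (n : SimplexCategoryᵒᵖ) : Weight A ⥤ Type w where
  obj W := (W.obj b).obj n
  map f := (f.app b).app n

/-- The simplicial structure of weights, as a natural transformation. -/
def evMap (b : A) {n m : SimplexCategoryᵒᵖ} (φ : n ⟶ m) : ev b n ⟶ ev b m where
  app W := (W.obj b).map φ
  naturality _ _ f := ((f.app b).naturality φ).symm

/-- The action of simplices of `A` on weights, as a natural transformation. -/
def evAct {a b : A} {n : SimplexCategoryᵒᵖ} (f : (Fun.{w} a b).obj n) : ev a n ⟶ ev b n where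
  app W := ↾fun x ↦ act W f x
  naturality V W g := by
    ext x
    exact (g.naturality f x).symm

/-- The right adjoint of `ev a n`. -/
def coev (a : A) (n : SimplexCategoryᵒᵖ) (S : Type w) : Weight A :=
  mkWeight (fun b ↦
      { obj m := (m ⟶ n) × (Fun.{w} b a).obj n → S
        map ψ := ↾fun h p ↦ h (ψ ≫ p.1, p.2)
        map_id m := by ext h p; exact congrArg (fun q ↦ h (q, p.2)) (Category.id_comp _)
        map_comp φ ψ := by
          ext h p
          exact congrArg (fun q ↦ h (q, p.2)) (Category.assoc _ _ _) })
    (fun {b c m} e h p ↦ h (p.1, comp ((Fun.{w} b c).map p.1 e) p.2))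
    (fun {b c m k} f φ x ↦ funext fun p ↦
      congrArg (fun q ↦ x (φ ≫ p.1, comp q p.2)) ((Fun.{w} b c).map_comp_apply φ p.1 f))
    (fun x ↦ funext fun p ↦ by rw [map_idn, idn_comp])
    (fun f g x ↦ funext fun p ↦ by rw [map_comp, comp_assoc])

/-- The transpose of a function on `W(a)ₙ`. -/
def toCoev {a : A} {n : SimplexCategoryᵒᵖ} {S : Type w} {W : Weight A}
    (t : (W.obj a).obj n → S) : W ⟶ coev a n S where
  app b :=
    { app m := ↾fun x p ↦ t (act W p.2 ((W.obj b).map p.1 x))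
      naturality m k φ := by
        ext x
        funext p
        exact congrArg (fun y ↦ t (act W p.2 y)) ((W.obj b).map_comp_apply φ p.1 x).symm }
  naturality {b c m} f x := by
    refine Eq.trans ?_ (act_mkWeight _ _ _ _ _ f _).symm
    funext p
    change t (act W p.2 ((W.obj c).map p.1 (act W f x))) =
      t (act W (comp ((Fun.{w} b c).map p.1 f) p.2) ((W.obj b).map p.1 x))
    rw [act_map, act_comp]

/-- `ev a n` is a left adjoint. -/
def evAdj (a : A) (n : SimplexCategoryᵒᵖ) (S : Type w) (W : Weight A) :
    (W ⟶ coev a n S) ≃ ((ev a n).obj W ⟶ S) where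
  toFun g := ↾fun x ↦ (g.app a).app n x (𝟙 n, idn a n)
  invFun t := toCoev fun x ↦ t x
  left_inv g := by
    refine Weight.hom_ext fun b ↦ ?_
    ext m x
    funext p
    change (g.app a).app n (act W p.2 ((W.obj b).map p.1 x)) (𝟙 n, idn a n) =
      (g.app b).app m x p
    rw [g.naturality, Weight.app_map]
    refine (congrFun (act_mkWeight _ _ _ _ _ p.2 _) _).trans ?_
    change (g.app b).app m x (p.1 ≫ 𝟙 n, comp ((Fun.{w} b a).map (𝟙 n) p.2) (idn a n)) = _
    rw [Category.comp_id, comp_idn, Functor.map_id_apply]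
  right_inv t := by
    ext x
    exact congrArg t ((act_idn W _).trans ((W.obj a).map_id_apply n x))

/-- This gives preservation of colimits by evaluation; together with `isColimitOfEv` it reduces
questions about colimits of weights to sets of simplices. -/
lemma ev_isLeftAdjoint (a : A) (n : SimplexCategoryᵒᵖ) : (ev a n).IsLeftAdjoint :=
  (Adjunction.adjunctionOfEquivRight (F := ev a n) (G_obj := coev a n)
    (fun W S ↦ (evAdj a n S W).symm) (fun V W S f t ↦ by
      refine Weight.hom_ext fun b ↦ ?_
      ext m x
      refine funext fun p ↦ congrArg t ?_
      refine (f.naturality p.2 _).trans ?_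
      exact congrArg (act W p.2) (Weight.app_map f p.1 x))).isLeftAdjoint

instance (a : A) (n : SimplexCategoryᵒᵖ) : PreservesColimitsOfSize.{v, u} (ev a n) :=
  have := ev_isLeftAdjoint a n
  (Adjunction.ofIsLeftAdjoint (ev a n)).leftAdjoint_preservesColimits

/-- Applied to `evMap` and `evAct`, this says that maps defined on each set of simplices separately
assemble to a map of weights. -/
lemma desc_naturality {J : Type u} [Category.{v} J] {F : J ⥤ Weight A} {P Q : Weight A ⥤ Type w}
    (τ : P ⟶ Q) (c s : Cocone F) (hP : IsColimit (P.mapCocone c)) (hQ : IsColimit (Q.mapCocone c)) :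
    τ.app c.pt ≫ hQ.desc (Q.mapCocone s) = hP.desc (P.mapCocone s) ≫ τ.app s.pt := by
  refine hP.hom_ext fun j ↦ ?_
  have h₁ := hQ.fac (Q.mapCocone s) j
  have h₂ := hP.fac_assoc (P.mapCocone s) j (τ.app s.pt)
  rw [h₂]
  simp only [Functor.mapCocone_ι_app] at h₁ ⊢
  exact (τ.naturality_assoc (c.ι.app j) _).trans
    ((congrArg _ h₁).trans (τ.naturality (s.ι.app j)).symm)

/-- A cocone of weights which is levelwise a colimit is a colimit. -/
noncomputable def isColimitOfEv {J : Type u} [Category.{v} J] {F : J ⥤ Weight A} (c : Cocone F)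
    (h : ∀ a n, IsColimit ((ev a n).mapCocone c)) : IsColimit c where
  desc s :=
    { app a :=
        { app n := (h a n).desc ((ev a n).mapCocone s)
          naturality n m φ := desc_naturality (evMap a φ) c s (h a n) (h a m) }
      naturality {a b n} f x :=
        ConcreteCategory.congr_hom (desc_naturality (evAct f) c s (h a n) (h b n)) x }
  fac s j := by
    refine Weight.hom_ext fun a ↦ ?_
    ext n x
    exact ConcreteCategory.congr_hom ((h a n).fac ((ev a n).mapCocone s) j) x
  uniq s m hm := by
    refine Weight.hom_ext fun a ↦ ?_
    refine NatTrans.ext (funext fun n ↦ ?_)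
    exact (h a n).uniq ((ev a n).mapCocone s) _ fun j ↦ congrArg (ev a n).map (hm j)

/-- Levelwise colimits of weights. -/
noncomputable def colimWeight {J : Type u} [Category.{v} J] [HasColimitsOfShape J (Type w)]
    (F : J ⥤ Weight A) : Weight A :=
  mkWeight (fun b ↦
      { obj n := colimit (F ⋙ ev b n)
        map φ := colimMap (Functor.whiskerLeft F (evMap b φ))
        map_id n := by
          refine colimit.hom_ext fun j ↦ ?_
          rw [ι_colimMap, Category.comp_id]
          exact (congrArg (· ≫ _) (CategoryTheory.Functor.map_id _ _)).trans (Category.id_comp _)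
        map_comp φ ψ := by
          refine colimit.hom_ext fun j ↦ ?_
          rw [ι_colimMap, ι_colimMap_assoc, ι_colimMap, ← Category.assoc]
          exact (congrArg (· ≫ _) (CategoryTheory.Functor.map_comp _ _ _)) })
    (fun {a b n} f ↦ colimMap (Functor.whiskerLeft F (evAct f)))
    (fun {a b n m} f φ x ↦ by
      refine ConcreteCategory.congr_hom (f := colimMap (Functor.whiskerLeft F (evAct f)) ≫
        colimMap (Functor.whiskerLeft F (evMap b φ))) (g := colimMap (Functor.whiskerLeft F
        (evMap a φ)) ≫ colimMap (Functor.whiskerLeft F (evAct ((Fun.{w} a b).map φ f)))) ?_ x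
      refine colimit.hom_ext fun j ↦ ?_
      rw [ι_colimMap_assoc, ι_colimMap, ι_colimMap_assoc, ι_colimMap, ← Category.assoc,
        ← Category.assoc]
      refine congrArg (· ≫ _) ?_
      ext x
      exact act_map (F.obj j) f φ x)
    (fun {a n} x ↦ by
      refine ConcreteCategory.congr_hom (f := colimMap (Functor.whiskerLeft F (evAct (idn a n))))
        (g := 𝟙 _) ?_ x
      refine colimit.hom_ext fun j ↦ ?_
      rw [ι_colimMap, Category.comp_id]
      refine (congrArg (· ≫ _) ?_).trans (Category.id_comp _)
      ext x
      exact act_idn (F.obj j) x)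
    (fun {a b c n} f g x ↦ by
      refine ConcreteCategory.congr_hom (f := colimMap (Functor.whiskerLeft F (evAct (comp f g))))
        (g := colimMap (Functor.whiskerLeft F (evAct f)) ≫
          colimMap (Functor.whiskerLeft F (evAct g))) ?_ x
      refine colimit.hom_ext fun j ↦ ?_
      rw [ι_colimMap_assoc, ι_colimMap, ι_colimMap, ← Category.assoc]
      refine congrArg (· ≫ _) ?_
      ext x
      exact act_comp (F.obj j) f g x)

/-- The levelwise colimit cocone. -/
noncomputable def colimCocone {J : Type u} [Category.{v} J] [HasColimitsOfShape J (Type w)]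
    (F : J ⥤ Weight A) : Cocone F where
  pt := colimWeight F
  ι :=
    { app j :=
        { app b :=
            { app n := colimit.ι (F ⋙ ev b n) j
              naturality n m φ := (ι_colimMap (Functor.whiskerLeft F (evMap b φ)) j).symm }
          naturality {a b n} f x := by
            refine Eq.trans ?_ (act_mkWeight _ _ _ _ _ f _).symm
            exact (ConcreteCategory.congr_hom
              (ι_colimMap (Functor.whiskerLeft F (evAct f)) j) x).symm }
      naturality i j φ := by
        refine Weight.hom_ext fun b ↦ NatTrans.ext (funext fun n ↦ ?_)
        exact (colimit.w (F ⋙ ev b n) φ).trans (Category.comp_id _).symm }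

/-- The levelwise colimit cocone is a colimit. -/
noncomputable def isColimitColimCocone {J : Type u} [Category.{v} J]
    [HasColimitsOfShape J (Type w)] (F : J ⥤ Weight A) : IsColimit (colimCocone F) :=
  isColimitOfEv _ fun a n ↦ (colimit.isColimit (F ⋙ ev a n)).ofIsoColimit (Cocone.ext (Iso.refl _))

instance {J : Type u} [Category.{v} J] [HasColimitsOfShape J (Type w)] :
    HasColimitsOfShape J (Weight A) where
  has_colimit F := ⟨⟨⟨_, isColimitColimCocone F⟩⟩⟩

lemma isIso_of_bijective {V W : Weight A} (f : V ⟶ W)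
    (h : ∀ a n, Function.Bijective ((f.app a).app n)) : IsIso f := by
  let g : W ⟶ V :=
    { app a :=
        { app n := ↾(Equiv.ofBijective _ (h a n)).symm
          naturality n m φ := by
            ext x
            obtain ⟨x, rfl⟩ := (h a n).2 x
            refine (h a m).1 ?_
            refine (Equiv.apply_symm_apply (Equiv.ofBijective _ (h a m)) _).trans ?_
            refine Eq.trans ?_ (Weight.app_map f φ _).symm
            exact congrArg _ (Equiv.apply_symm_apply (Equiv.ofBijective _ (h a n)) _).symm }
      naturality {a b n} e x := by
        refine (h b n).1 ?_
        refine (Equiv.apply_symm_apply (Equiv.ofBijective _ (h b n)) _).trans ?_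
        refine Eq.trans ?_ (f.naturality e _).symm
        exact congrArg _ (Equiv.apply_symm_apply (Equiv.ofBijective _ (h a n)) _).symm }
  refine ⟨g, Weight.hom_ext fun a ↦ ?_, Weight.hom_ext fun a ↦ ?_⟩
  · ext n x
    exact Equiv.symm_apply_apply (Equiv.ofBijective _ (h a n)) x
  · ext n x
    exact Equiv.apply_symm_apply (Equiv.ofBijective _ (h a n)) x

lemma isEmpty_of_isInitial {E : Weight A} (hE : IsInitial E) (a : A) (n : SimplexCategoryᵒᵖ) :
    IsEmpty ((E.obj a).obj n) :=
  ((Types.initial_iff_empty _).1 ⟨hE.isInitialObj (ev a n) E⟩)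

end Colimits

end SimpCat

/-! ### An explicit model for attaching cells to a weight. -/

namespace SimpCat

variable {A : Type w} [EnrichedCategory SSet.{w} A]

/-- A small family of cells `U i × Fun (a i) - ⊆ V i × Fun (a i) -` together with
attaching maps to a weight. -/
structure CellData (X : Weight A) where
  ι : Type w
  V : ι → SSet.{w}
  U : ∀ i, (V i).Subcomplex
  a : ι → A
  g : ∀ i, (U i : SSet.{w}) ⟶ X.obj (a i)

namespace CellData

variable {X : Weight A} (D : CellData X)

/-- The simplices of the weight obtained by attaching cells. -/
abbrev Simplex (b : A) (n : SimplexCategoryᵒᵖ) : Type w :=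
  (X.obj b).obj n ⊕ Σ i, {s : (D.V i).obj n // s ∉ (D.U i).obj n} × (Fun.{w} (D.a i) b).obj n

variable {D} in
open Classical in
/-- The simplices of the attached cells. -/
noncomputable def cellIn {b : A} {n : SimplexCategoryᵒᵖ} (i : D.ι) (s : (D.V i).obj n)
    (f : (Fun.{w} (D.a i) b).obj n) : D.Simplex b n :=
  if h : s ∈ (D.U i).obj n then Sum.inl (act X f ((D.g i).app n ⟨s, h⟩))
  else Sum.inr ⟨i, ⟨s, h⟩, f⟩

lemma cellIn_of_mem {b : A} {n : SimplexCategoryᵒᵖ} {i : D.ι} {s : (D.V i).obj n}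
    (h : s ∈ (D.U i).obj n) (f : (Fun.{w} (D.a i) b).obj n) :
    cellIn i s f = Sum.inl (act X f ((D.g i).app n ⟨s, h⟩)) := dif_pos h

lemma cellIn_of_notMem {b : A} {n : SimplexCategoryᵒᵖ} {i : D.ι} {s : (D.V i).obj n}
    (h : s ∉ (D.U i).obj n) (f : (Fun.{w} (D.a i) b).obj n) :
    cellIn i s f = Sum.inr ⟨i, ⟨s, h⟩, f⟩ := dif_neg h

/-- The simplicial operators of the weight obtained by attaching cells. -/
noncomputable def simplexMap {b : A} {n m : SimplexCategoryᵒᵖ} (φ : n ⟶ m) :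
    D.Simplex b n → D.Simplex b m :=
  Sum.elim (fun x ↦ Sum.inl ((X.obj b).map φ x))
    (fun p ↦ cellIn p.1 ((D.V p.1).map φ p.2.1.1) ((Fun.{w} (D.a p.1) b).map φ p.2.2))

lemma simplexMap_cellIn {b : A} {n m : SimplexCategoryᵒᵖ} (φ : n ⟶ m) {i : D.ι}
    (s : (D.V i).obj n) (f : (Fun.{w} (D.a i) b).obj n) :
    D.simplexMap φ (cellIn i s f) = cellIn i ((D.V i).map φ s) ((Fun.{w} (D.a i) b).map φ f) := by
  by_cases h : s ∈ (D.U i).obj n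
  · rw [cellIn_of_mem D h, cellIn_of_mem D ((D.U i).map φ h)]
    refine congrArg Sum.inl ((act_map X f φ _).trans ?_)
    exact congrArg _ (ConcreteCategory.congr_hom ((D.g i).naturality φ) ⟨s, h⟩).symm
  · rw [cellIn_of_notMem D h]
    rfl

/-- The action of simplices of `A` on the weight obtained by attaching cells. -/
def simplexAct {b c : A} {n : SimplexCategoryᵒᵖ} (e : (Fun.{w} b c).obj n) :
    D.Simplex b n → D.Simplex c n :=
  Sum.map (act X e) fun p ↦ ⟨p.1, p.2.1, comp p.2.2 e⟩

lemma simplexAct_cellIn {b c : A} {n : SimplexCategoryᵒᵖ} (e : (Fun.{w} b c).obj n) {i : D.ι}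
    (s : (D.V i).obj n) (f : (Fun.{w} (D.a i) b).obj n) :
    D.simplexAct e (cellIn i s f) = cellIn i s (comp f e) := by
  by_cases h : s ∈ (D.U i).obj n
  · rw [cellIn_of_mem D h, cellIn_of_mem D h, act_comp]
    rfl
  · rw [cellIn_of_notMem D h, cellIn_of_notMem D h]
    rfl

-- The second case admits all simplices of the cell, including those glued to `X`. Since `cellIn`
-- commutes with operators and with the action, proofs by this principle need not ask whether a face
-- falls into the attaching locus.
@[elab_as_elim]
lemma simplex_cases {b : A} {n : SimplexCategoryᵒᵖ} {P : D.Simplex b n → Prop}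
    (h₁ : ∀ x, P (Sum.inl x)) (h₂ : ∀ i s f, P (cellIn i s f)) (x : D.Simplex b n) : P x := by
  rcases x with x | ⟨i, s, f⟩
  · exact h₁ x
  · rw [← cellIn_of_notMem D s.2]
    exact h₂ _ _ _

lemma simplexMap_id {b : A} {n : SimplexCategoryᵒᵖ} (x : D.Simplex b n) :
    D.simplexMap (𝟙 n) x = x := by
  refine D.simplex_cases (fun x ↦ ?_) (fun i s f ↦ ?_) x
  · exact congrArg Sum.inl ((X.obj b).map_id_apply n x)
  · rw [simplexMap_cellIn, Functor.map_id_apply, Functor.map_id_apply]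

lemma simplexMap_comp {b : A} {n m k : SimplexCategoryᵒᵖ} (φ : n ⟶ m) (ψ : m ⟶ k)
    (x : D.Simplex b n) : D.simplexMap (φ ≫ ψ) x = D.simplexMap ψ (D.simplexMap φ x) := by
  refine D.simplex_cases (fun x ↦ ?_) (fun i s f ↦ ?_) x
  · exact congrArg Sum.inl ((X.obj b).map_comp_apply φ ψ x)
  · rw [simplexMap_cellIn, simplexMap_cellIn, simplexMap_cellIn, Functor.map_comp_apply,
      Functor.map_comp_apply]

/-- The simplicial sets of the weight obtained by attaching cells. -/
noncomputable def attachObj (b : A) : SSet.{w} where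
  obj n := D.Simplex b n
  map φ := ↾(D.simplexMap φ)
  map_id _ := ConcreteCategory.hom_ext _ _ fun x ↦ D.simplexMap_id x
  map_comp φ ψ := ConcreteCategory.hom_ext _ _ fun x ↦ D.simplexMap_comp φ ψ x

/-- The weight obtained by attaching cells. -/
noncomputable def attach : Weight A :=
  mkWeight D.attachObj
    D.simplexAct
    (fun f φ x ↦ by
      refine D.simplex_cases (fun x ↦ ?_) (fun i s g ↦ ?_) x
      · exact congrArg Sum.inl (act_map X f φ x)
      · refine (congrArg (D.simplexMap φ) (D.simplexAct_cellIn f s g)).trans ?_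
        refine (D.simplexMap_cellIn φ _ _).trans ?_
        refine Eq.trans ?_ (congrArg (D.simplexAct _) (D.simplexMap_cellIn φ s g)).symm
        rw [simplexAct_cellIn, map_comp])
    (fun x ↦ by
      refine D.simplex_cases (fun x ↦ ?_) (fun i s g ↦ ?_) x
      · exact congrArg Sum.inl (act_idn X x)
      · rw [simplexAct_cellIn, comp_idn])
    (fun f g x ↦ by
      refine D.simplex_cases (fun x ↦ ?_) (fun i s g ↦ ?_) x
      · exact congrArg Sum.inl (act_comp X f g x)
      · rw [simplexAct_cellIn, simplexAct_cellIn, simplexAct_cellIn, comp_assoc])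

lemma act_attach {b c : A} {n : SimplexCategoryᵒᵖ} (e : (Fun.{w} b c).obj n)
    (x : D.Simplex b n) : act D.attach e x = D.simplexAct e x :=
  act_mkWeight D.attachObj D.simplexAct _ _ _ e x

/-- The inclusion of a weight in the weight obtained by attaching cells to it. -/
noncomputable def inclusion : X ⟶ D.attach where
  app b := { app n := ↾fun x ↦ (Sum.inl x : D.Simplex b n) }
  naturality e x := (D.act_attach e (Sum.inl x)).symm

/-- The inclusions of the attached cells. -/
noncomputable def cell (i : D.ι) : cellWeight (D.V i) (D.a i) ⟶ D.attach where
  app b :=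
    { app n := ↾fun p ↦ (cellIn i p.1 p.2 : D.Simplex b n)
      naturality n m φ := by
        ext p
        exact (D.simplexMap_cellIn φ p.1 p.2).symm }
  naturality {b c n} e p := by
    refine Eq.trans ?_ (D.act_attach e _).symm
    refine Eq.trans ?_ (D.simplexAct_cellIn e p.1 p.2).symm
    exact congrArg (fun q : (D.V i ⊗ Fun.{w} (D.a i) c).obj n ↦
      (cellIn i q.1 q.2 : D.Simplex c n)) (act_cellWeight _ _ e p)

@[elab_as_elim]
lemma attach_cases {b : A} {n : SimplexCategoryᵒᵖ} {P : (D.attach.obj b).obj n → Prop}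
    (h₁ : ∀ x, P ((D.inclusion.app b).app n x))
    (h₂ : ∀ i (p : ((cellWeight (D.V i) (D.a i)).obj b).obj n), P (((D.cell i).app b).app n p))
    (x) : P x :=
  D.simplex_cases h₁ (fun i s f ↦ h₂ i (pair (X := D.V i) (Y := Fun.{w} (D.a i) b) s f)) x

lemma hom_ext {Y : Weight A} {f g : D.attach ⟶ Y} (h₁ : D.inclusion ≫ f = D.inclusion ≫ g)
    (h₂ : ∀ i, D.cell i ≫ f = D.cell i ≫ g) : f = g := by
  refine Weight.hom_ext fun b ↦ NatTrans.ext (funext fun n ↦ ConcreteCategory.hom_ext _ _ fun x ↦ ?_)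
  refine D.attach_cases (fun x ↦ ?_) (fun i p ↦ ?_) x
  · exact congrArg (fun k : X ⟶ Y ↦ (k.app b).app n x) h₁
  · exact congrArg (fun k : cellWeight (D.V i) (D.a i) ⟶ Y ↦ (k.app b).app n p) (h₂ i)

lemma cellMap_cell (i : D.ι) :
    cellMap (D.U i).ι (D.a i) ≫ D.cell i = cellDesc (D.g i) ≫ D.inclusion := by
  refine Weight.hom_ext fun b ↦ ?_
  ext n p
  exact D.cellIn_of_mem p.1.2 p.2

/-- Maps out of the weight obtained by attaching cells, on simplices. -/
def descFun {Y : Weight A} (f : X ⟶ Y) (h : ∀ i, D.V i ⟶ Y.obj (D.a i)) {b : A}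
    {n : SimplexCategoryᵒᵖ} : D.Simplex b n → (Y.obj b).obj n :=
  Sum.elim (fun x ↦ (f.app b).app n x) (fun p ↦ act Y p.2.2 ((h p.1).app n p.2.1.1))

lemma descFun_cellIn {Y : Weight A} {f : X ⟶ Y} {h : ∀ i, D.V i ⟶ Y.obj (D.a i)}
    (hw : ∀ i, (D.U i).ι ≫ h i = D.g i ≫ f.app (D.a i)) {b : A} {n : SimplexCategoryᵒᵖ} (i : D.ι)
    (s : (D.V i).obj n) (e : (Fun.{w} (D.a i) b).obj n) :
    D.descFun f h (cellIn i s e) = act Y e ((h i).app n s) := by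
  by_cases hs : s ∈ (D.U i).obj n
  · rw [cellIn_of_mem D hs]
    refine (f.naturality e _).trans ?_
    exact congrArg (act Y e)
      (ConcreteCategory.congr_hom (NatTrans.congr_app (hw i) n) ⟨s, hs⟩).symm
  · rw [cellIn_of_notMem D hs]
    rfl

lemma descFun_simplexMap {Y : Weight A} {f : X ⟶ Y} {h : ∀ i, D.V i ⟶ Y.obj (D.a i)}
    (hw : ∀ i, (D.U i).ι ≫ h i = D.g i ≫ f.app (D.a i)) {b : A} {n m : SimplexCategoryᵒᵖ}
    (φ : n ⟶ m) (x : D.Simplex b n) :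
    D.descFun f h (D.simplexMap φ x) = (Y.obj b).map φ (D.descFun f h x) := by
  refine D.simplex_cases (fun x ↦ ?_) (fun i s e ↦ ?_) x
  · exact Weight.app_map f φ x
  · rw [simplexMap_cellIn, D.descFun_cellIn hw, D.descFun_cellIn hw, act_map]
    exact congrArg _ (ConcreteCategory.congr_hom ((h i).naturality φ) s)

/-- Maps out of the weight obtained by attaching cells. -/
noncomputable def desc {Y : Weight A} (f : X ⟶ Y) (h : ∀ i, D.V i ⟶ Y.obj (D.a i))
    (hw : ∀ i, (D.U i).ι ≫ h i = D.g i ≫ f.app (D.a i)) : D.attach ⟶ Y where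
  app b :=
    { app n := ↾(D.descFun f h)
      naturality n m φ := ConcreteCategory.hom_ext _ _ fun x ↦ D.descFun_simplexMap hw φ x }
  naturality {b c n} e x := by
    refine (congrArg (D.descFun f h) (D.act_attach e x)).trans ?_
    refine D.simplex_cases (fun x ↦ ?_) (fun i s e' ↦ ?_) x
    · exact f.naturality e x
    · refine (congrArg (D.descFun f h) (D.simplexAct_cellIn e s e')).trans ?_
      refine (D.descFun_cellIn hw i _ _).trans ?_
      exact (act_comp Y e' e _).trans (congrArg (act Y e) (D.descFun_cellIn hw i s e').symm)

variable {Y : Weight A} (f : X ⟶ Y) (h : ∀ i, D.V i ⟶ Y.obj (D.a i))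
    (hw : ∀ i, (D.U i).ι ≫ h i = D.g i ≫ f.app (D.a i))

lemma inclusion_desc : D.inclusion ≫ D.desc f h hw = f := rfl

lemma cell_desc (i : D.ι) : D.cell i ≫ D.desc f h hw = cellDesc (h i) := by
  refine Weight.hom_ext fun b ↦ ?_
  ext n p
  exact D.descFun_cellIn hw i p.1 p.2

/-- Lifts are chosen on each cell separately and glued by the universal property of the attachment.
-/
lemma llp_inclusion {T : MorphismProperty (Weight A)}
    (hD : ∀ i, T.llp (cellMap (D.U i).ι (D.a i))) : T.llp D.inclusion := by
  intro G H q hq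
  constructor
  intro f g sq
  have (i : D.ι) : CommSq (cellDesc (D.g i) ≫ f) (cellMap (D.U i).ι (D.a i)) q (D.cell i ≫ g) :=
    ⟨by rw [Category.assoc, sq.w, ← Category.assoc, ← cellMap_cell, Category.assoc]⟩
  have lift (i : D.ι) := hD i q hq
  let l (i : D.ι) : cellWeight (D.V i) (D.a i) ⟶ G := (this i).lift
  refine ⟨⟨⟨D.desc f (fun i ↦ cellUnit _ _ ≫ (l i).app (D.a i)) (fun i ↦ ?_), ?_, ?_⟩⟩⟩
  · rw [← Category.assoc, ← cellUnit_naturality, Category.assoc, ← Weight.comp_app,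
      (this i).fac_left, Weight.comp_app, ← Category.assoc, cellUnit_desc]
  · exact D.inclusion_desc _ _ _
  · refine D.hom_ext ?_ fun i ↦ ?_
    · rw [← Category.assoc, inclusion_desc, sq.w]
    · rw [← Category.assoc, cell_desc, ← (this i).fac_right]
      refine congrArg (· ≫ q) (cell_hom_ext ?_)
      rw [cellUnit_desc]

open HomotopicalAlgebra in
/-- The inclusion of a weight in the weight obtained by attaching cells. -/
noncomputable def attachCells {α : Type u} {V : α → SSet.{w}} (U : ∀ p, (V p).Subcomplex)
    (a : α → A) {ι : Type w} (π : ι → α) (g : ∀ i, (U (π i) : SSet.{w}) ⟶ X.obj (a (π i))) :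
    AttachCells.{w} (fun p ↦ cellMap (U p).ι (a p))
      (inclusion ⟨ι, fun i ↦ V (π i), fun i ↦ U (π i), fun i ↦ a (π i), g⟩) where
  ι := ι
  π := π
  cofan₁ := Cofan.mk _ (Sigma.ι fun i ↦ cellWeight (U (π i) : SSet.{w}) (a (π i)))
  cofan₂ := Cofan.mk _ (Sigma.ι fun i ↦ cellWeight (V (π i)) (a (π i)))
  isColimit₁ := coproductIsCoproduct _
  isColimit₂ := coproductIsCoproduct _
  m := Limits.Sigma.map fun i ↦ cellMap (U (π i)).ι (a (π i))
  g₁ := Sigma.desc fun i ↦ cellDesc (g i)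
  g₂ := Sigma.desc fun i ↦ cell ⟨ι, fun i ↦ V (π i), fun i ↦ U (π i), fun i ↦ a (π i), g⟩ i
  hm i := by simp
  isPushout := by
    let D : CellData X := ⟨ι, fun i ↦ V (π i), fun i ↦ U (π i), fun i ↦ a (π i), g⟩
    refine IsPushout.of_isColimit' ⟨?_⟩ (PushoutCocone.IsColimit.mk _
      (fun s ↦ D.desc s.inl (fun i ↦ cellUnit _ _ ≫
        (Sigma.ι (fun i ↦ cellWeight (V (π i)) (a (π i))) i ≫ s.inr).app _) fun i ↦ ?_)
      (fun s ↦ D.inclusion_desc _ _ _) (fun s ↦ ?_) (fun s k hk₁ hk₂ ↦ ?_))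
    · refine Sigma.hom_ext _ _ fun i ↦ ?_
      rw [Sigma.ι_desc_assoc, Limits.Sigma.ι_map_assoc, Sigma.ι_desc]
      exact (D.cellMap_cell i).symm
    · have := congrArg (fun k ↦ cellUnit _ _ ≫ (Sigma.ι (fun i ↦ cellWeight (U (π i) : SSet.{w})
        (a (π i))) i ≫ k).app (a (π i))) s.condition
      simp only [Sigma.ι_desc_assoc, Limits.Sigma.ι_map_assoc, Weight.comp_app] at this
      rw [← Category.assoc, cellUnit_desc, ← Category.assoc, cellUnit_naturality,
        Category.assoc] at this
      exact this.symm
    · refine Sigma.hom_ext _ _ fun i ↦ ?_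
      rw [Sigma.ι_desc_assoc]
      refine (D.cell_desc _ _ _ i).trans (cell_hom_ext ?_)
      rw [cellUnit_desc]
    · refine D.hom_ext hk₁ fun i ↦ ?_
      rw [cell_desc]
      refine cell_hom_ext ?_
      rw [cellUnit_desc, ← hk₂, Sigma.ι_desc_assoc]

end CellData

end SimpCat

/-! ### Bases of weights, and their stability under cell attachment and countable composition. -/

namespace SimpCat

variable {A : Type w} [EnrichedCategory SSet.{w} A]

/-- A family of sets of simplices of `W`, closed under degeneracies, which freely generates `W`
relatively to `V` under the action of simplices of `A`. -/
structure IsRelBasis {V W : Weight A} (u : V ⟶ W)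
    (G : ∀ (a : A) (n : SimplexCategoryᵒᵖ), Set ((W.obj a).obj n)) : Prop where
  map_mem {a : A} {n m : SimplexCategoryᵒᵖ} (φ : n ⟶ m) [Epi φ.unop] {g : (W.obj a).obj n} :
    g ∈ G a n → (W.obj a).map φ g ∈ G a m
  injective (b : A) (n : SimplexCategoryᵒᵖ) : Function.Injective ((u.app b).app n)
  disjoint {a b : A} {n : SimplexCategoryᵒᵖ} {g : (W.obj a).obj n} (f : (Fun.{w} a b).obj n)
    (x : (V.obj b).obj n) : g ∈ G a n → act W f g ≠ (u.app b).app n x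
  act_inj {a a' b : A} {n : SimplexCategoryᵒᵖ} {g : (W.obj a).obj n} {g' : (W.obj a').obj n}
    {f : (Fun.{w} a b).obj n} {f' : (Fun.{w} a' b).obj n} : g ∈ G a n → g' ∈ G a' n →
    act W f g = act W f' g' →
    (⟨a, g, f⟩ : Σ a, (W.obj a).obj n × (Fun.{w} a b).obj n) = ⟨a', g', f'⟩
  surj {b : A} {n : SimplexCategoryᵒᵖ} (y : (W.obj b).obj n) :
    (∃ x, (u.app b).app n x = y) ∨
      ∃ (a : A) (g : (W.obj a).obj n) (f : (Fun.{w} a b).obj n), g ∈ G a n ∧ act W f g = y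

/-- A family of sets of simplices of `W`, closed under degeneracies, which freely generates `W`
under the action of simplices of `A`. -/
structure IsBasis (W : Weight A) (G : ∀ (a : A) (n : SimplexCategoryᵒᵖ), Set ((W.obj a).obj n)) :
    Prop where
  map_mem {a : A} {n m : SimplexCategoryᵒᵖ} (φ : n ⟶ m) [Epi φ.unop] {g : (W.obj a).obj n} :
    g ∈ G a n → (W.obj a).map φ g ∈ G a m
  act_inj {a a' b : A} {n : SimplexCategoryᵒᵖ} {g : (W.obj a).obj n} {g' : (W.obj a').obj n}
    {f : (Fun.{w} a b).obj n} {f' : (Fun.{w} a' b).obj n} : g ∈ G a n → g' ∈ G a' n →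
    act W f g = act W f' g' →
    (⟨a, g, f⟩ : Σ a, (W.obj a).obj n × (Fun.{w} a b).obj n) = ⟨a', g', f'⟩
  surj {b : A} {n : SimplexCategoryᵒᵖ} (y : (W.obj b).obj n) :
    ∃ (a : A) (g : (W.obj a).obj n) (f : (Fun.{w} a b).obj n), g ∈ G a n ∧ act W f g = y

lemma act_inj_app {V W : Weight A} (u : V ⟶ W)
    (hu : ∀ (b : A) (n : SimplexCategoryᵒᵖ), Function.Injective ((u.app b).app n)) {a a' b : A}
    {n : SimplexCategoryᵒᵖ} {g : (V.obj a).obj n} {g' : (V.obj a').obj n}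
    {f : (Fun.{w} a b).obj n} {f' : (Fun.{w} a' b).obj n}
    (h : act V f g = act V f' g' →
      (⟨a, g, f⟩ : Σ a, (V.obj a).obj n × (Fun.{w} a b).obj n) = ⟨a', g', f'⟩)
    (h' : act W f ((u.app a).app n g) = act W f' ((u.app a').app n g')) :
    (⟨a, (u.app a).app n g, f⟩ : Σ a, (W.obj a).obj n × (Fun.{w} a b).obj n) =
      ⟨a', (u.app a').app n g', f'⟩ := by
  rw [← u.naturality, ← u.naturality] at h'
  exact congrArg (fun p : Σ a, (V.obj a).obj n × (Fun.{w} a b).obj n ↦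
    (⟨p.1, (u.app p.1).app n p.2.1, p.2.2⟩ : Σ a, (W.obj a).obj n × (Fun.{w} a b).obj n))
      (h (hu b n h'))

lemma IsBasis.comp {V W : Weight A} {u : V ⟶ W} {G H} (hG : IsBasis V G) (hH : IsRelBasis u H) :
    IsBasis W fun a n ↦ (u.app a).app n '' G a n ∪ H a n where
  map_mem {a n m} φ _ g := by
    rintro (⟨g, hg, rfl⟩ | hg)
    · exact Or.inl ⟨_, hG.map_mem φ hg, Weight.app_map u φ g⟩
    · exact Or.inr (hH.map_mem φ hg)
  act_inj {a a' b n g g' f f'} := by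
    rintro (⟨g, hg, rfl⟩ | hg) (⟨g', hg', rfl⟩ | hg') h
    · exact act_inj_app u hH.injective (hG.act_inj hg hg') h
    · rw [← u.naturality] at h
      exact (hH.disjoint _ _ hg' h.symm).elim
    · rw [← u.naturality] at h
      exact (hH.disjoint _ _ hg h).elim
    · exact hH.act_inj hg hg' h
  surj {b n} y := by
    obtain ⟨x, rfl⟩ | ⟨a, g, f, hg, rfl⟩ := hH.surj y
    · obtain ⟨a, g, f, hg, rfl⟩ := hG.surj x
      exact ⟨a, _, f, Or.inl ⟨g, hg, rfl⟩, (u.naturality f g).symm⟩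
    · exact ⟨a, g, f, Or.inr hg, rfl⟩

lemma isBasis_of_isEmpty {V : Weight A} (h : ∀ a n, IsEmpty ((V.obj a).obj n)) :
    IsBasis V fun _ _ ↦ ∅ where
  map_mem _ _ _ h := h.elim
  act_inj h := h.elim
  surj {b n} y := ((h b n).false y).elim

lemma bijective_of_iso {V W : Weight A} (e : V ≅ W) (a : A) (n : SimplexCategoryᵒᵖ) :
    Function.Bijective ((e.hom.app a).app n) :=
  ((ev a n).mapIso e).toEquiv.bijective

lemma IsRelBasis.comp_iso {V W W' : Weight A} {u : V ⟶ W} {G} (h : IsRelBasis u G) (e : W ≅ W') :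
    IsRelBasis (u ≫ e.hom) fun a n ↦ (e.hom.app a).app n '' G a n where
  map_mem {a n m} φ _ g := by
    rintro ⟨g, hg, rfl⟩
    exact ⟨_, h.map_mem φ hg, Weight.app_map _ φ g⟩
  injective b n := (bijective_of_iso e b n).1.comp (h.injective b n)
  disjoint {a b n g} f x := by
    rintro ⟨g, hg, rfl⟩ hx
    rw [← e.hom.naturality] at hx
    exact h.disjoint _ _ hg ((bijective_of_iso e b n).1 hx)
  act_inj {a a' b n g g' f f'} := by
    rintro ⟨g, hg, rfl⟩ ⟨g', hg', rfl⟩ hx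
    exact act_inj_app _ (fun b n ↦ (bijective_of_iso e b n).1) (h.act_inj hg hg') hx
  surj {b n} y := by
    obtain ⟨y, rfl⟩ := (bijective_of_iso e b n).2 y
    obtain ⟨x, rfl⟩ | ⟨a, g, f, hg, rfl⟩ := h.surj y
    · exact Or.inl ⟨x, rfl⟩
    · exact Or.inr ⟨a, _, f, ⟨g, hg, rfl⟩, (e.hom.naturality f g).symm⟩

namespace CellData

variable {X : Weight A} (D : CellData X)

/-- The generators of the weight obtained by attaching cells. -/
inductive IsGenerator : ∀ {a : A} {n : SimplexCategoryᵒᵖ}, D.Simplex a n → Prop where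
  | mk {n : SimplexCategoryᵒᵖ} (i : D.ι) (s : {s : (D.V i).obj n // s ∉ (D.U i).obj n}) :
      IsGenerator (Sum.inr ⟨i, s, idn (D.a i) n⟩)

/-- Epimorphisms of the simplex category split, so `s` is recovered from its degeneracy by a
simplicial operator. The complement of a simplicial subset is thus stable under degeneracies. -/
lemma notMem_map {S : SSet.{w}} (T : S.Subcomplex) {n m : SimplexCategoryᵒᵖ} (φ : n ⟶ m)
    [Epi φ.unop] {s : S.obj n} (hs : s ∉ T.obj n) : S.map φ s ∉ T.obj m := by
  have := isSplitEpi_of_epi φ.unop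
  intro h
  refine hs ?_
  have h' := T.map (section_ φ.unop).op h
  have h'' : S.map (section_ φ.unop).op (S.map φ s) = s := by
    have e : φ ≫ (section_ φ.unop).op = 𝟙 n := Quiver.Hom.unop_inj (IsSplitEpi.id φ.unop)
    rw [← Functor.map_comp_apply, e]
    exact S.map_id_apply _ _
  rw [← h'']
  exact h'

/-- Every new simplex is `(s, f)` with `s` outside the attaching locus, and it is uniquely the
translate by `f` of `(s, id)`. The shape of the cells plays no role, so boundaries and horns are
treated alike. -/
lemma isRelBasis : IsRelBasis D.inclusion fun _ _ ↦ {y | D.IsGenerator y} where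
  map_mem {a n m} φ _ g := by
    rintro ⟨i, s⟩
    refine ((congrArg (D.IsGenerator ·) ?_).mpr
      (IsGenerator.mk i ⟨_, notMem_map (D.U i) φ s.2⟩) :)
    refine (D.cellIn_of_notMem (notMem_map (D.U i) φ s.2) _).trans ?_
    rw [map_idn]
  injective b n := Sum.inl_injective
  disjoint {a b n g} f x := by
    rintro ⟨i, s⟩ h
    have := (D.act_attach f _).symm.trans h
    cases this
  act_inj {a a' b n g g' f f'} := by
    rintro ⟨i, s⟩ ⟨i', s'⟩ h
    have h' := ((D.act_attach f _).symm.trans h).trans (D.act_attach f' _)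
    replace h' := Sum.inr_injective h'
    beta_reduce at h'
    rw [idn_comp, idn_comp] at h'
    cases h'
    rfl
  surj {b n} y := by
    rcases (y : D.Simplex b n) with x | ⟨i, s, f⟩
    · exact Or.inl ⟨x, rfl⟩
    · refine Or.inr ⟨D.a i, _, f, IsGenerator.mk i s, (D.act_attach f _).trans ?_⟩
      refine congrArg (fun f ↦ (Sum.inr ⟨i, s, f⟩ : D.Simplex b n)) (idn_comp f)

open HomotopicalAlgebra in
/-- Attached cells have a relative basis. -/
lemma exists_isRelBasis {α : Type u} {V : α → SSet.{w}} {U : ∀ p, (V p).Subcomplex}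
    {a : α → A} {Y : Weight A} {f : X ⟶ Y}
    (c : AttachCells.{w} (fun p ↦ cellMap (U p).ι (a p)) f) : ∃ G, IsRelBasis f G := by
  -- The abstract pushout is identified with the explicit model having the same attaching maps, and
  -- the basis is transported along this isomorphism.
  let D : CellData X := ⟨c.ι, fun i ↦ V (c.π i), fun i ↦ U (c.π i), fun i ↦ a (c.π i),
    fun i ↦ cellUnit _ _ ≫ (c.cofan₁.inj i ≫ c.g₁).app _⟩
  have hg (i : c.ι) : cellDesc (D.g i) = c.cofan₁.inj i ≫ c.g₁ :=
    cell_hom_ext (by rw [cellUnit_desc])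
  have hw (i : c.ι) : cellMap (U (c.π i)).ι (a (c.π i)) ≫ c.cell i = cellDesc (D.g i) ≫ f := by
    rw [hg, AttachCells.cell_def, Category.assoc, c.isPushout.w, c.hm_assoc]
  let p : D.attach ⟶ Y := D.desc f (fun i ↦ cellUnit _ _ ≫ (c.cell i).app _) fun i ↦ by
    have := congrArg (fun k : cellWeight (D.U i : SSet) (D.a i) ⟶ Y ↦
      cellUnit _ _ ≫ k.app (D.a i)) (hw i)
    simp only [Weight.comp_app] at this
    rw [← Category.assoc, cellUnit_naturality, ← Category.assoc, cellUnit_desc,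
      Category.assoc] at this
    exact this
  have hp (i : c.ι) : D.cell i ≫ p = c.cell i :=
    (D.cell_desc _ _ _ i).trans (cell_hom_ext (by rw [cellUnit_desc]))
  let q₀ : c.cofan₂.pt ⟶ D.attach := Cofan.IsColimit.desc c.isColimit₂ fun i ↦ D.cell i
  have hq₀ (i : c.ι) : c.cofan₂.inj i ≫ q₀ = D.cell i := Cofan.IsColimit.fac c.isColimit₂ _ i
  let q : Y ⟶ D.attach := c.isPushout.desc D.inclusion q₀ (by
    refine Cofan.IsColimit.hom_ext c.isColimit₁ _ _ fun i ↦ ?_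
    rw [← Category.assoc, ← hg, c.hm_assoc, hq₀]
    exact (D.cellMap_cell i).symm)
  have hq₁ : f ≫ q = D.inclusion := c.isPushout.inl_desc _ _ _
  have hq (i : c.ι) : c.cell i ≫ q = D.cell i := by
    rw [AttachCells.cell_def, Category.assoc, c.isPushout.inr_desc, hq₀]
  let e : D.attach ≅ Y := ⟨p, q,
    D.hom_ext (by rw [← Category.assoc, D.inclusion_desc, hq₁, Category.comp_id])
      (fun i ↦ by rw [← Category.assoc, hp, hq, Category.comp_id]),
    c.hom_ext (by rw [← Category.assoc, hq₁, D.inclusion_desc, Category.comp_id])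
      (fun i ↦ by rw [← Category.assoc, hq, hp, Category.comp_id])⟩
  exact ⟨_, D.isRelBasis.comp_iso e⟩

end CellData

section Tower

variable {F : ℕ ⥤ Weight A}

lemma tower_map_injective
    (hF : ∀ k b n, Function.Injective (((F.map (homOfLE (Nat.le_succ k))).app b).app n))
    {i j : ℕ} (f : i ⟶ j) (b : A) (n : SimplexCategoryᵒᵖ) :
    Function.Injective (((F.map f).app b).app n) := by
  have h := leOfHom f
  obtain rfl : f = homOfLE h := rfl
  induction h with
  | refl =>
    have : F.map (homOfLE (le_refl i)) = 𝟙 _ := F.map_id i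
    rw [this]
    exact Function.injective_id
  | @step j h ih =>
    have : F.map (homOfLE (Nat.le_trans h (Nat.le_succ j))) =
        F.map (homOfLE h) ≫ F.map (homOfLE (Nat.le_succ j)) := by
      rw [← F.map_comp]
      rfl
    rw [this]
    exact (hF j b n).comp ih

variable {c : Cocone F} (hc : IsColimit c)
include hc

lemma tower_jointly_surjective {b : A} {n : SimplexCategoryᵒᵖ} (y : (c.pt.obj b).obj n) :
    ∃ (k : ℕ) (x : ((F.obj k).obj b).obj n), (WeightHom.app (c.ι.app k) b).app n x = y :=
  Types.jointly_surjective _ (isColimitOfPreserves (ev b n) hc) y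

lemma tower_ι_eq_iff {b : A} {n : SimplexCategoryᵒᵖ} {k : ℕ} (x y : ((F.obj k).obj b).obj n) :
    (WeightHom.app (c.ι.app k) b).app n x = (WeightHom.app (c.ι.app k) b).app n y ↔
      ∃ (j : ℕ) (f : k ⟶ j), ((F.map f).app b).app n x = ((F.map f).app b).app n y :=
  Types.FilteredColimit.isColimit_eq_iff' (isColimitOfPreserves (ev b n) hc) x y

lemma tower_ι_injective
    (hF : ∀ k b n, Function.Injective (((F.map (homOfLE (Nat.le_succ k))).app b).app n))
    (k : ℕ) (b : A) (n : SimplexCategoryᵒᵖ) :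
    Function.Injective ((WeightHom.app (c.ι.app k) b).app n) := fun x y h ↦ by
  obtain ⟨j, f, h⟩ := (tower_ι_eq_iff hc x y).1 h
  exact tower_map_injective hF f b n h

omit hc in
lemma tower_ι_map {i j : ℕ} (f : i ⟶ j) {b : A} {n : SimplexCategoryᵒᵖ}
    (x : ((F.obj i).obj b).obj n) :
    (WeightHom.app (c.ι.app j) b).app n (((F.map f).app b).app n x) =
      (WeightHom.app (c.ι.app i) b).app n x :=
  congrArg (fun k : F.obj i ⟶ c.pt ↦ (k.app b).app n x) (c.w f)

/-- A translate of a generator added at stage `k + 1` never comes from stage `k`. Hence generators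
of different stages have disjoint orbits, and the union of the bases is free. -/
lemma isRelBasis_tower {G : ∀ (k : ℕ) (a n), Set (((F.obj (k + 1)).obj a).obj n)}
    (hG : ∀ k, IsRelBasis (F.map (homOfLE (Nat.le_succ k))) (G k)) :
    IsRelBasis (c.ι.app 0) fun a n ↦
      {y | ∃ (k : ℕ) (g : _), g ∈ G k a n ∧ (WeightHom.app (c.ι.app (k + 1)) a).app n g = y} := by
  have hF (k b n) := (hG k).injective b n
  have hι := tower_ι_injective hc hF
  have key (k j : ℕ) (hj : j ≤ k) {a b n g} (hg : g ∈ G k a n) (f : (Fun.{w} a b).obj n)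
      (x : ((F.obj j).obj b).obj n) :
      act c.pt f ((WeightHom.app (c.ι.app (k + 1)) a).app n g) ≠
        (WeightHom.app (c.ι.app j) b).app n x := by
    intro h
    rw [← WeightHom.naturality, ← tower_ι_map (homOfLE hj), ← tower_ι_map (homOfLE
      (Nat.le_succ k))] at h
    exact (hG k).disjoint f _ hg (hι _ _ _ h)
  have key' (k j : ℕ) (hj : j < k) {a a' b n g g'} (hg : g ∈ G k a n) (f : (Fun.{w} a b).obj n)
      (f' : (Fun.{w} a' b).obj n) :
      act c.pt f ((WeightHom.app (c.ι.app (k + 1)) a).app n g) ≠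
        act c.pt f' ((WeightHom.app (c.ι.app (j + 1)) a').app n g') := by
    intro h
    exact key k (j + 1) hj hg f _ (h.trans (WeightHom.naturality (c.ι.app (j + 1)) f' g').symm)
  refine ⟨?_, hι 0, ?_, ?_, ?_⟩
  · rintro a n m φ _ _ ⟨k, g, hg, rfl⟩
    exact ⟨k, _, (hG k).map_mem φ hg, Weight.app_map _ φ g⟩
  · rintro a b n _ f x ⟨k, g, hg, rfl⟩
    exact key k 0 (Nat.zero_le k) hg f x
  · rintro a a' b n _ _ f f' ⟨k, g, hg, rfl⟩ ⟨k', g', hg', rfl⟩ h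
    obtain hk | rfl | hk := lt_trichotomy k k'
    · exact (key' k' k hk hg' f' f h.symm).elim
    · exact act_inj_app _ (hι (k + 1)) ((hG k).act_inj hg hg') h
    · exact (key' k k' hk hg f f' h).elim
  · intro b n y
    obtain ⟨k, x, rfl⟩ := tower_jointly_surjective hc y
    induction k with
    | zero => exact Or.inl ⟨x, rfl⟩
    | succ k ih =>
      obtain ⟨x, rfl⟩ | ⟨a, g, f, hg, rfl⟩ := (hG k).surj x
      · rw [tower_ι_map]
        exact ih x
      · exact Or.inr ⟨a, _, f, ⟨k, g, hg, rfl⟩, (WeightHom.naturality _ f g).symm⟩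

end Tower

open HomotopicalAlgebra in
lemma IsBasis.of_relativeCellComplex {α : Type u} {V : α → SSet.{w}} {U : ∀ p, (V p).Subcomplex}
    {a : α → A} {X Y : Weight A} {f : X ⟶ Y} {G} (hG : IsBasis X G)
    (c : RelativeCellComplex.{w} (fun (_ : ℕ) p ↦ cellMap (U p).ι (a p)) f) :
    ∃ H, IsBasis Y H := by
  choose H hH using fun k : ℕ ↦ CellData.exists_isRelBasis (c.attachCells k (not_isMax k))
  have h₁ := isRelBasis_tower c.isColimit hH
  -- The bottom of the complex is only isomorphic to `X`; relative to an isomorphism the empty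
  -- family is a basis.
  have h₂ : IsBasis (c.F.obj ⊥) _ := hG.comp (W := c.F.obj ⊥) (u := c.isoBot.inv)
    (H := fun _ _ ↦ ∅)
    { map_mem := fun _ _ _ h ↦ h.elim
      injective := fun b n ↦ (bijective_of_iso c.isoBot.symm b n).1
      disjoint := fun _ _ h ↦ h.elim
      act_inj := fun h ↦ h.elim
      surj := fun {b n} y ↦ Or.inl ((bijective_of_iso c.isoBot.symm b n).2 y) }
  exact ⟨_, h₂.comp h₁⟩

lemma IsFlexible.exists_isBasis {W : Weight A} (hW : IsFlexible W) : ∃ G, IsBasis W G := by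
  obtain ⟨E, hE, ⟨c⟩⟩ := hW
  have hE' := isBasis_of_isEmpty (isEmpty_of_isInitial hE)
  exact IsBasis.of_relativeCellComplex (α := ℕ × A) (V := fun p ↦ Δ[p.1]) (U := fun p ↦ ∂Δ[p.1])
    (a := fun p ↦ p.2) (f := hE.to W) hE' c

end SimpCat

namespace SimpCat

variable {A : Type w} [EnrichedCategory SSet.{w} A]

open HomotopicalAlgebra in
/-- The relative cell complex given by a sequence of cell attachments. -/
noncomputable def relativeCellComplexOfTower {α : Type u} {S T : α → Weight A} (i : ∀ p, S p ⟶ T p)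
    {X : ℕ → Weight A} (s : ∀ k, X k ⟶ X (k + 1)) (h : ∀ k, AttachCells.{w} i (s k))
    {c : Cocone (Functor.ofSequence s)} (hc : IsColimit c) :
    RelativeCellComplex.{w} (fun (_ : ℕ) ↦ i) (Y := c.pt) (X := X 0) (c.ι.app 0) where
  F := Functor.ofSequence s
  isoBot := Iso.refl (X 0)
  incl := c.ι
  isColimit := hc
  fac := Category.id_comp (c.ι.app 0)
  attachCells k _ := (h k).ofArrowIso
    (eqToIso (congrArg Arrow.mk (Functor.ofSequence_map_homOfLE_succ s k).symm))

end SimpCat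

/-! ### The skeletal filtration: weights with a basis are flexible. -/

namespace SimpCat

section Dimension

variable {X : SSet.{w}}

variable (X) in
/-- The simplices which come from simplices of dimension less than `k`. -/
def dimLT (k : ℕ) : X.Subcomplex where
  obj n := {x | ∃ d < k, ∃ (φ : op ⦋d⦌ ⟶ n) (y : X _⦋d⦌), X.map φ y = x}
  map {n m} ψ x := by
    rintro ⟨d, hd, φ, y, rfl⟩
    exact ⟨d, hd, φ ≫ ψ, y, X.map_comp_apply φ ψ y⟩

lemma map_injective_of_epi {n m : SimplexCategoryᵒᵖ} (φ : n ⟶ m) [Epi φ.unop] :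
    Function.Injective (X.map φ) := by
  have := isSplitEpi_of_epi φ.unop
  have e : φ ≫ (section_ φ.unop).op = 𝟙 n := Quiver.Hom.unop_inj (IsSplitEpi.id φ.unop)
  refine Function.LeftInverse.injective (g := X.map (section_ φ.unop).op) fun x ↦ ?_
  rw [← Functor.map_comp_apply, e, Functor.map_id_apply]

/-- The operator factors as an epimorphism followed by a monomorphism. The dimension drops strictly
unless the operator is a degeneracy, which is what puts the boundary of a `k`-cell into the lower
skeleton. -/
lemma exists_epi_factorization {k : ℕ} {n : SimplexCategoryᵒᵖ} (φ : op ⦋k⦌ ⟶ n) (y : X _⦋k⦌) :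
    ∃ d ≤ k, (¬ Epi φ.unop → d < k) ∧ ∃ (ψ : op ⦋d⦌ ⟶ n) (z : X _⦋d⦌), Epi ψ.unop ∧
      X.map ψ z = X.map φ y := by
  have h : (image φ.unop).len ≤ k := SimplexCategory.len_le_of_mono (image.ι φ.unop)
  refine ⟨(image φ.unop).len, h, fun h' ↦ lt_of_le_of_ne h fun h'' ↦ h' ?_,
    (factorThruImage φ.unop).op, X.map (image.ι φ.unop).op y,
    inferInstanceAs (Epi (factorThruImage φ.unop)), ?_⟩
  · have : IsIso (image.ι φ.unop) := (SimplexCategory.isIso_iff_of_mono _).2 h''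
    rw [← image.fac φ.unop]
    exact epi_comp _ _
  · rw [← Functor.map_comp_apply, ← op_comp, image.fac]
    rfl

lemma exists_epi_of_mem_dimLT {k : ℕ} {n : SimplexCategoryᵒᵖ} {x : X.obj n}
    (hx : x ∈ (dimLT X k).obj n) :
    ∃ d < k, ∃ (φ : op ⦋d⦌ ⟶ n) (y : X _⦋d⦌), Epi φ.unop ∧ X.map φ y = x := by
  obtain ⟨d, hd, φ, y, rfl⟩ := hx
  obtain ⟨m, hm, -, ψ, z, hψ, h⟩ := exists_epi_factorization φ y
  exact ⟨m, hm.trans_lt hd, ψ, z, hψ, h⟩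

/-- Applying a section of the degeneracy would show that `y` itself comes from a lower dimension. -/
lemma notMem_dimLT {k : ℕ} {n : SimplexCategoryᵒᵖ} (φ : op ⦋k⦌ ⟶ n) [Epi φ.unop]
    (y : X.nonDegenerate k) : X.map φ y.1 ∉ (dimLT X k).obj n := by
  rintro ⟨d, hd, ψ, z, h⟩
  have := isSplitEpi_of_epi φ.unop
  have e : φ ≫ (section_ φ.unop).op = 𝟙 _ := Quiver.Hom.unop_inj (IsSplitEpi.id φ.unop)
  refine y.2 ⟨d, hd, (ψ ≫ (section_ φ.unop).op).unop, z, ?_⟩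
  rw [Quiver.Hom.op_unop, Functor.map_comp_apply, h, ← Functor.map_comp_apply, e,
    Functor.map_id_apply]

lemma exists_nonDegenerate_of_mem_dimLT {k : ℕ} {n : SimplexCategoryᵒᵖ} {x : X.obj n}
    (hx : x ∈ (dimLT X k).obj n) :
    ∃ d < k, ∃ (φ : op ⦋d⦌ ⟶ n) (y : X.nonDegenerate d), Epi φ.unop ∧ X.map φ y.1 = x := by
  obtain ⟨n, rfl⟩ : ∃ m, n = op ⦋m⦌ := ⟨n.unop.len, rfl⟩
  obtain ⟨d, f, hf, y, rfl⟩ := X.exists_nonDegenerate x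
  refine ⟨d, ?_, f.op, y, hf, rfl⟩
  by_contra! h
  refine notMem_dimLT f.op y ?_
  obtain ⟨m, hm, φ, z, h'⟩ := hx
  exact ⟨m, hm.trans_le h, φ, z, h'⟩

end Dimension

variable {A : Type w} [EnrichedCategory SSet.{w} A]

/-- The weight given by levelwise simplicial subsets stable under the action. -/
def subWeight (W : Weight A) (S : ∀ b, (W.obj b : SSet.{w}).Subcomplex)
    (hS : ∀ {a b : A} {n : SimplexCategoryᵒᵖ} (f : (Fun.{w} a b).obj n) (x : (W.obj a).obj n),
      x ∈ (S a).obj n → act W f x ∈ (S b).obj n) : Weight A :=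
  mkWeight (fun b ↦ (S b : SSet.{w})) (fun f x ↦ ⟨act W f x.1, hS f x.1 x.2⟩)
    (fun f φ x ↦ Subtype.ext (act_map W f φ x.1))
    (fun x ↦ Subtype.ext (act_idn W x.1))
    (fun f g x ↦ Subtype.ext (act_comp W f g x.1))

section

variable {W : Weight A} {S T : ∀ b, (W.obj b : SSet.{w}).Subcomplex}
    (hS : ∀ {a b : A} {n : SimplexCategoryᵒᵖ} (f : (Fun.{w} a b).obj n) (x : (W.obj a).obj n),
      x ∈ (S a).obj n → act W f x ∈ (S b).obj n)
    (hT : ∀ {a b : A} {n : SimplexCategoryᵒᵖ} (f : (Fun.{w} a b).obj n) (x : (W.obj a).obj n),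
      x ∈ (T a).obj n → act W f x ∈ (T b).obj n)

lemma act_subWeight {a b : A} {n : SimplexCategoryᵒᵖ} (f : (Fun.{w} a b).obj n)
    (x : (S a : SSet.{w}).obj n) :
    act (subWeight W S hS) f x = (⟨act W f x.1, hS f x.1 x.2⟩ : (S b : SSet.{w}).obj n) :=
  act_mkWeight (fun b ↦ (S b : SSet.{w})) _ _ _ _ f x

/-- The inclusion of a subweight. -/
def subWeightι : subWeight W S hS ⟶ W where
  app b := (S b).ι
  naturality f x := congrArg Subtype.val (act_subWeight hS f x)

/-- The inclusion between two subweights. -/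
def subWeightHomOfLE (h : ∀ b, S b ≤ T b) : subWeight W S hS ⟶ subWeight W T hT where
  app b := SSet.Subcomplex.homOfLE (h b)
  naturality f x := by
    refine (congrArg _ (act_subWeight hS f x)).trans ?_
    exact (act_subWeight hT f (⟨x.1, h _ _ x.2⟩ : (T _ : SSet.{w}).obj _)).symm

end

/-- An initial object in the category of weights. -/
noncomputable def isInitialOfIsEmpty {E : Weight A} (h : ∀ a n, IsEmpty ((E.obj a).obj n)) :
    IsInitial E :=
  have : IsIso (initial.to E) := isIso_of_bijective _ fun a n ↦
    ⟨fun x ↦ ((isEmpty_of_isInitial (initialIsInitial (C := Weight A)) a n).false x).elim,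
      fun x ↦ ((h a n).false x).elim⟩
  initialIsInitial.ofIso (asIso (initial.to E))

/-- The simplicial subsets of the skeletal filtration of a weight. -/
def skeletonSub (W : Weight A) (k : ℕ) (b : A) : (W.obj b : SSet.{w}).Subcomplex where
  obj n := {y | ∃ (a : A) (x : (W.obj a).obj n) (f : (Fun.{w} a b).obj n),
    x ∈ (dimLT (W.obj a) k).obj n ∧ act W f x = y}
  map {n m} φ y := by
    rintro ⟨a, x, f, hx, rfl⟩
    exact ⟨a, _, _, (dimLT (W.obj a) k).map φ hx, (act_map W f φ x).symm⟩

lemma act_mem_skeletonSub (W : Weight A) (k : ℕ) {a b : A} {n : SimplexCategoryᵒᵖ}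
    (f : (Fun.{w} a b).obj n) (x : (W.obj a).obj n) (hx : x ∈ (skeletonSub W k a).obj n) :
    act W f x ∈ (skeletonSub W k b).obj n := by
  obtain ⟨a, x, g, hx, rfl⟩ := hx
  exact ⟨a, x, comp g f, hx, act_comp W g f x⟩

lemma mem_skeletonSub {W : Weight A} {k : ℕ} {a : A} {n : SimplexCategoryᵒᵖ}
    {x : (W.obj a).obj n} (hx : x ∈ (dimLT (W.obj a) k).obj n) :
    x ∈ (skeletonSub W k a).obj n := ⟨a, x, idn a n, hx, act_idn W x⟩

lemma skeletonSub_le (W : Weight A) (k : ℕ) (b : A) : skeletonSub W k b ≤ skeletonSub W (k + 1) b := by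
  rintro n _ ⟨a, x, f, ⟨d, hd, φ, y, h⟩, rfl⟩
  exact ⟨a, x, f, ⟨d, hd.trans (Nat.lt_succ_self k), φ, y, h⟩, rfl⟩

/-- The skeletal filtration of a weight. -/
abbrev skeleton (W : Weight A) (k : ℕ) : Weight A :=
  subWeight W (skeletonSub W k) (act_mem_skeletonSub W k)

/-- The inclusions of the skeletal filtration. -/
abbrev skeletonStep (W : Weight A) (k : ℕ) : skeleton W k ⟶ skeleton W (k + 1) :=
  subWeightHomOfLE _ _ (skeletonSub_le W k)

section

variable (W : Weight A)

/-- The weight, as a cocone over its skeletal filtration. -/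
def skeletonCocone : Cocone (Functor.ofSequence (skeletonStep W)) where
  pt := W
  ι := NatTrans.ofSequence (fun k ↦ subWeightι (act_mem_skeletonSub W k)) fun k ↦ by
    rw [Functor.ofSequence_map_homOfLE_succ]
    exact (Category.comp_id (skeletonStep W k ≫ _)).symm

/-- A weight is the colimit of its skeletal filtration. -/
noncomputable def isColimitSkeletonCocone : IsColimit (skeletonCocone W) :=
  isColimitOfEv _ fun a n ↦ Types.FilteredColimit.isColimitOf' _ _
    (fun x ↦ ⟨n.unop.len + 1, ⟨x, mem_skeletonSub ⟨n.unop.len, Nat.lt_succ_self _, 𝟙 n, x,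
      (W.obj a).map_id_apply n x⟩⟩, rfl⟩)
    (fun i _ _ h ↦ ⟨i, 𝟙 i, congrArg _ (Subtype.ext h)⟩)

end

section

variable {W : Weight A} {G} (hG : IsBasis W G)
include hG

/-- Writing `y` as a translate of a generator `g` and degenerating gives two decompositions of the
same simplex. Uniqueness identifies the degeneracies of `y` and `g`, and degeneracies are injective.
-/
lemma IsBasis.mem_of_map_mem {a : A} {n m : SimplexCategoryᵒᵖ} (φ : n ⟶ m) [Epi φ.unop]
    {y : (W.obj a).obj n} (hy : (W.obj a).map φ y ∈ G a m) : y ∈ G a n := by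
  obtain ⟨a', g, f, hg, rfl⟩ := hG.surj y
  have h := hG.act_inj (f := idn a m) (f' := (Fun.{w} a' a).map φ f) hy (hG.map_mem φ hg)
    (by rw [act_idn, act_map])
  have h₁ : a = a' := congrArg Sigma.fst h
  subst h₁
  have h₂ := congrArg Prod.fst (eq_of_heq (Sigma.ext_iff.1 h).2)
  rw [map_injective_of_epi φ h₂]
  exact hg

/-- The low-dimensional simplex is decomposed first, before it is degenerated, so that the resulting
generator is itself a degeneracy of a low-dimensional one. -/
lemma IsBasis.exists_of_mem_skeletonSub {k : ℕ} {b : A} {n : SimplexCategoryᵒᵖ}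
    {y : (W.obj b).obj n} (hy : y ∈ (skeletonSub W k b).obj n) :
    ∃ (a : A) (g : (W.obj a).obj n) (f : (Fun.{w} a b).obj n), g ∈ G a n ∧
      g ∈ (dimLT (W.obj a) k).obj n ∧ act W f g = y := by
  obtain ⟨a, x, f, hx, rfl⟩ := hy
  obtain ⟨d, hd, φ, z, hφ, rfl⟩ := exists_epi_of_mem_dimLT hx
  obtain ⟨a', g, f', hg, rfl⟩ := hG.surj z
  exact ⟨a', (W.obj a').map φ g, SimpCat.comp ((Fun.{w} a' a).map φ f') f, hG.map_mem φ hg,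
    ⟨d, hd, φ, g, rfl⟩, by rw [act_comp, act_map]⟩

omit hG in
variable (G) in
/-- The cells of the skeletal filtration of a weight with a basis: the nondegenerate generators. -/
abbrev SkeletonCell (k : ℕ) : Type w :=
  {p : Σ a : A, (W.obj a) _⦋k⦌ // p.2 ∈ G p.1 (op ⦋k⦌) ∧ p.2 ∈ (W.obj p.1).nonDegenerate k}

omit hG in
lemma epi_of_notMem_boundary {k : ℕ} {n : SimplexCategoryᵒᵖ} {s : Δ[k].obj n}
    (hs : s ∉ (∂Δ[k] : (Δ[k] : SSet.{w}).Subcomplex).obj n) :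
    Epi (SSet.stdSimplex.objEquiv s).op.unop :=
  SimplexCategory.epi_iff_surjective.2 (not_not.1 hs)

omit hG in
variable (G) in
/-- The attaching maps of the skeletal filtration. -/
def skeletonAttaching {k : ℕ} (i : SkeletonCell G k) :
    (∂Δ[k] : SSet.{w}) ⟶ (skeleton W k).obj i.1.1 where
  app n := ↾fun s ↦ (⟨(SSet.yonedaEquiv.symm i.1.2).app n s.1, by
    obtain ⟨d, -, hd, ψ, z, -, h⟩ :=
      exists_epi_factorization (SSet.stdSimplex.objEquiv s.1).op i.1.2
    refine mem_skeletonSub ⟨d, hd fun h' ↦ s.2 ?_, ψ, z, h⟩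
    exact SimplexCategory.epi_iff_surjective.1 h'⟩ :
      (skeletonSub W k i.1.1 : SSet.{w}).obj n)
  naturality n m φ := by
    ext s
    have := ConcreteCategory.congr_hom ((SSet.yonedaEquiv.symm i.1.2).naturality φ) s.1
    exact Subtype.ext this

omit hG in
variable (G) in
/-- The characteristic maps of the skeletal filtration. -/
def skeletonChar {k : ℕ} (i : SkeletonCell G k) :
    (Δ[k] : SSet.{w}) ⟶ (skeleton W (k + 1)).obj i.1.1 where
  app n := ↾fun s ↦ (⟨(SSet.yonedaEquiv.symm i.1.2).app n s,
    mem_skeletonSub ⟨k, Nat.lt_succ_self k, (SSet.stdSimplex.objEquiv s).op, i.1.2, rfl⟩⟩ :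
      (skeletonSub W (k + 1) i.1.1 : SSet.{w}).obj n)
  naturality n m φ := by
    ext s
    have := ConcreteCategory.congr_hom ((SSet.yonedaEquiv.symm i.1.2).naturality φ) s
    exact Subtype.ext this

omit hG in
variable (G) in
/-- The cells attached to the `k`-th step of the skeletal filtration. -/
abbrev skeletonData (k : ℕ) : CellData (skeleton W k) :=
  ⟨SkeletonCell G k, fun _ ↦ Δ[k], fun _ ↦ ∂Δ[k], fun i ↦ i.1.1, skeletonAttaching G⟩

omit hG in
variable (G) in
/-- The comparison between cell attachment and the skeletal filtration. -/
noncomputable def skeletonDesc (k : ℕ) : (skeletonData (W := W) G k).attach ⟶ skeleton W (k + 1) :=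
  (skeletonData G k).desc (skeletonStep W k) (skeletonChar G) fun _ ↦ rfl

omit hG in
lemma skeletonDesc_inl {k : ℕ} {b : A} {n : SimplexCategoryᵒᵖ}
    (x : ((skeleton W k).obj b).obj n) :
    ((subWeightι (act_mem_skeletonSub W (k + 1))).app b).app n
      (((skeletonDesc G k).app b).app n (Sum.inl x : (skeletonData G k).Simplex b n)) =
      ((subWeightι (act_mem_skeletonSub W k)).app b).app n x := rfl

omit hG in
lemma skeletonDesc_inr {k : ℕ} {b : A} {n : SimplexCategoryᵒᵖ} (i : SkeletonCell (W := W) G k)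
    (s : {s : Δ[k].obj n // s ∉ (∂Δ[k] : (Δ[k] : SSet.{w}).Subcomplex).obj n})
    (f : (Fun.{w} i.1.1 b).obj n) :
    ((subWeightι (act_mem_skeletonSub W (k + 1))).app b).app n
      (((skeletonDesc G k).app b).app n (Sum.inr ⟨i, s, f⟩ : (skeletonData G k).Simplex b n)) =
      act W f ((W.obj i.1.1).map (SSet.stdSimplex.objEquiv s.1).op i.1.2) :=
  congrArg Subtype.val (act_subWeight (act_mem_skeletonSub W (k + 1)) f _)

/-- A simplex of the `(k + 1)`-st stage is a translate of a unique generator, which is a degeneracy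
of a unique nondegenerate simplex by Eilenberg–Zilber. If that simplex has dimension `k`, it is
again a generator (`IsBasis.mem_of_map_mem`), hence a cell; otherwise the simplex lies in the
previous stage. -/
lemma skeletonDesc_bijective (k : ℕ) (b : A) (n : SimplexCategoryᵒᵖ) :
    Function.Bijective (((skeletonDesc (W := W) G k).app b).app n) := by
  -- Old and new simplices stay apart: by uniqueness of generators, a degeneracy of a nondegenerate
  -- `k`-simplex would come from a dimension below `k`.
  have disj (x : ((skeleton W k).obj b).obj n) (i : SkeletonCell (W := W) G k) (s) (f) :
      ((skeletonDesc G k).app b).app n (Sum.inl x : (skeletonData G k).Simplex b n) ≠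
        ((skeletonDesc G k).app b).app n (Sum.inr ⟨i, s, f⟩ : (skeletonData G k).Simplex b n) := by
    intro h
    replace h := congrArg (((subWeightι (act_mem_skeletonSub W (k + 1))).app b).app n) h
    rw [skeletonDesc_inl, skeletonDesc_inr] at h
    have := epi_of_notMem_boundary s.2
    obtain ⟨a, g, f', hg, hg', h'⟩ := hG.exists_of_mem_skeletonSub x.2
    have h'' := hG.act_inj hg (hG.map_mem _ i.2.1) (h'.trans h)
    obtain ⟨⟨a', y⟩, hy, hy'⟩ := i
    have h₁ : a = a' := congrArg Sigma.fst h''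
    subst h₁
    have h₂ := congrArg Prod.fst (eq_of_heq (Sigma.ext_iff.1 h'').2)
    dsimp only at h₂
    rw [h₂] at hg'
    exact notMem_dimLT _ ⟨y, hy'⟩ hg'
  constructor
  · rintro (x | ⟨i, s, f⟩) (x' | ⟨i', s', f'⟩) h
    · replace h := congrArg (((subWeightι (act_mem_skeletonSub W (k + 1))).app b).app n) h
      rw [skeletonDesc_inl, skeletonDesc_inl] at h
      exact congrArg Sum.inl (Subtype.ext h)
    · exact (disj _ _ _ _ h).elim
    · exact (disj _ _ _ _ h.symm).elim
    · replace h := congrArg (((subWeightι (act_mem_skeletonSub W (k + 1))).app b).app n) h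
      rw [skeletonDesc_inr, skeletonDesc_inr] at h
      have := epi_of_notMem_boundary s.2
      have := epi_of_notMem_boundary s'.2
      have h' := hG.act_inj (hG.map_mem _ i.2.1) (hG.map_mem _ i'.2.1) h
      obtain ⟨⟨a, y⟩, hy, hy'⟩ := i
      obtain ⟨⟨a', y'⟩, hz, hz'⟩ := i'
      have h₁ : a = a' := congrArg Sigma.fst h'
      subst h₁
      have h₂ := eq_of_heq (Sigma.ext_iff.1 h').2
      have h₃ := congrArg Prod.fst h₂
      have h₄ : f = f' := congrArg Prod.snd h₂
      obtain ⟨n, rfl⟩ : ∃ m, n = op ⦋m⦌ := ⟨n.unop.len, rfl⟩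
      dsimp only at h₃
      have : Epi (SSet.stdSimplex.objEquiv s.1) := epi_of_notMem_boundary s.2
      -- Uniqueness of the nondegenerate simplex identifies the cells, and uniqueness of the
      -- degeneracy identifies the simplices inside the cell.
      have h₅ := SSet.unique_nonDegenerate_simplex _ _ (SSet.stdSimplex.objEquiv s.1)
        ⟨y, hy'⟩ rfl (SSet.stdSimplex.objEquiv s'.1) ⟨y', hz'⟩ h₃
      have h₆ := SSet.unique_nonDegenerate_map _ _ (SSet.stdSimplex.objEquiv s.1)
        ⟨y, hy'⟩ rfl (SSet.stdSimplex.objEquiv s'.1) ⟨y', hz'⟩ h₃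
      obtain rfl : y = y' := congrArg Subtype.val h₅
      obtain rfl : s = s' := Subtype.ext (SSet.stdSimplex.objEquiv.injective h₆)
      rw [h₄]
  · intro y
    obtain ⟨a, g, f, hg, hg', h⟩ := hG.exists_of_mem_skeletonSub y.2
    obtain ⟨d, hd, φ, z, hφ, rfl⟩ := exists_nonDegenerate_of_mem_dimLT hg'
    obtain hd | rfl := Nat.lt_succ_iff_lt_or_eq.1 hd
    · exact ⟨(Sum.inl ⟨y.1, a, _, f, ⟨d, hd, φ, z.1, rfl⟩, h⟩ : (skeletonData G k).Simplex b n),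
        rfl⟩
    · refine ⟨(Sum.inr ⟨⟨⟨a, z.1⟩, hG.mem_of_map_mem φ hg, z.2⟩,
        ⟨SSet.stdSimplex.objEquiv.symm φ.unop, fun h ↦ h ?_⟩, f⟩ :
          (skeletonData G d).Simplex b n), ?_⟩
      · exact SimplexCategory.epi_iff_surjective.1 hφ
      · refine Subtype.ext ((skeletonDesc_inr _ _ _).trans ?_)
        rw [← h]
        rfl

open HomotopicalAlgebra in
/-- Weights with a basis are flexible. -/
lemma IsBasis.isFlexible : IsFlexible W := by
  have hE : IsInitial (skeleton W 0) := isInitialOfIsEmpty fun a n ↦ ⟨fun x ↦ by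
    obtain ⟨_, _, _, ⟨d, hd, _⟩, _⟩ := x.2
    exact (Nat.not_lt_zero d hd).elim⟩
  have h (k : ℕ) : AttachCells.{w} (fun p : ℕ × A ↦ projectiveCell p) (skeletonStep W k) := by
    have : IsIso (skeletonDesc (W := W) G k) := isIso_of_bijective _ (skeletonDesc_bijective hG k)
    have c := CellData.attachCells (α := ℕ × A) (V := fun p ↦ Δ[p.1]) (fun p ↦ ∂Δ[p.1])
      (fun p ↦ p.2) (fun i : SkeletonCell (W := W) G k ↦ (k, i.1.1)) (skeletonAttaching G)
    exact c.ofArrowIso (Arrow.isoMk (Iso.refl _) (asIso (skeletonDesc G k))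
      (Category.id_comp (skeletonStep W k)))
  refine ⟨_, hE, ⟨?_⟩⟩
  rw [hE.hom_ext (hE.to W) ((skeletonCocone W).ι.app 0)]
  exact relativeCellComplexOfTower _ _ h (isColimitSkeletonCocone W)

end

end SimpCat

/-! ### Levelwise Kan replacement by a projective anodyne extension. -/

namespace SimpCat

variable {A : Type w} [EnrichedCategory SSet.{w} A]

/-- Evaluation of weights. -/
@[simps obj]
def evSSet (a : A) : Weight A ⥤ SSet.{w} where
  obj W := W.obj a
  map f := f.app a

lemma exists_hom_of_tower {F : ℕ ⥤ Weight A} {c : Cocone F} (hc : IsColimit c) {a : A}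
    {S : SSet.{w}} [IsFinitelyPresentable.{w} S] (f : S ⟶ c.pt.obj a) :
    ∃ (k : ℕ) (g : S ⟶ (F.obj k).obj a), g ≫ WeightHom.app (c.ι.app k) a = f := by
  have hc' : IsColimit ((evSSet a).mapCocone c) := evaluationJointlyReflectsColimits _ fun n ↦
    isColimitOfPreserves (ev a n) hc
  have := Cardinal.fact_isRegular_aleph0.{w}
  have : IsCardinalFiltered ℕ Cardinal.aleph0.{w} := by
    rw [isCardinalFiltered_aleph0_iff]
    infer_instance
  have h : IsCardinalPresentable S Cardinal.aleph0.{w} := ‹IsFinitelyPresentable.{w} S›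
  exact IsCardinalPresentable.exists_hom_of_isColimit Cardinal.aleph0.{w} hc' f

/-- Horns are finitely presentable, so a horn in the colimit already lives at some stage and is
filled at the next one. -/
lemma isLevelwiseKan_of_tower {F : ℕ ⥤ Weight A} {c : Cocone F} (hc : IsColimit c)
    (h : ∀ (k : ℕ) (a : A) (n : ℕ) (i : Fin (n + 2)) (f : (Λ[n + 1, i] : SSet) ⟶ (F.obj k).obj a),
      ∃ g : Δ[n + 1] ⟶ (F.obj (k + 1)).obj a,
        Λ[n + 1, i].ι ≫ g = f ≫ (F.map (homOfLE (Nat.le_add_right k 1))).app a) :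
    IsLevelwiseKan c.pt := fun a ↦ kanComplex_of_hornFilling fun n i f ↦ by
  obtain ⟨k, f, rfl⟩ := exists_hom_of_tower hc f
  obtain ⟨g, hg⟩ := h k a n i f
  refine ⟨g ≫ WeightHom.app (c.ι.app (k + 1)) a, ?_⟩
  rw [← Category.assoc, hg, Category.assoc, ← Weight.comp_app]
  exact congrArg (fun p : F.obj k ⟶ c.pt ↦ f ≫ p.app a) (c.w _)

/-- All the horns in a weight. -/
abbrev hornData (W : Weight A) : CellData W where
  ι := Σ p : (Σ n : ℕ, Fin (n + 2)) × A, (Λ[p.1.1 + 1, p.1.2] : SSet.{w}) ⟶ W.obj p.2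
  V i := Δ[i.1.1.1 + 1]
  U i := Λ[i.1.1.1 + 1, i.1.1.2]
  a i := i.1.2
  g i := i.2

/-- The sequence obtained by repeatedly attaching horns to a weight. -/
noncomputable def hornTower (W : Weight A) (k : ℕ) : Weight A :=
  Nat.rec W (fun _ X ↦ (hornData X).attach) k

/-- The inclusions of the sequence obtained by repeatedly attaching horns. -/
noncomputable def hornTowerStep (W : Weight A) (k : ℕ) : hornTower W k ⟶ hornTower W (k + 1) :=
  (hornData (hornTower W k)).inclusion

/-- Flexibility of the replacement goes through bases: the horn extension inherits a basis, and the
skeletal filtration then presents it as one countable complex of boundary cells. -/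
lemma exists_projectiveAnodyne (W : Weight A) : ∃ (W' : Weight A) (u : W ⟶ W'),
    IsLevelwiseKan W' ∧ IsProjectiveAnodyne u ∧ (IsFlexible W → IsFlexible W') := by
  let c := colimCocone (Functor.ofSequence (hornTowerStep W))
  have hc : IsColimit c := isColimitColimCocone _
  have hu : IsProjectiveAnodyne (V := W) (W := c.pt) (c.ι.app 0) :=
    ⟨relativeCellComplexOfTower (X := hornTower W) _ (hornTowerStep W) (fun k ↦
      CellData.attachCells (α := (Σ n : ℕ, Fin (n + 2)) × A) (V := fun p ↦ Δ[p.1.1 + 1])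
        (fun p ↦ Λ[p.1.1 + 1, p.1.2]) (fun p ↦ p.2) _ _) hc⟩
  refine ⟨c.pt, c.ι.app 0, isLevelwiseKan_of_tower hc fun k a n i f ↦ ?_, hu, fun hW ↦ ?_⟩
  · let j : (hornData (hornTower W k)).ι := ⟨(⟨n, i⟩, a), f⟩
    refine ⟨cellUnit _ _ ≫ ((hornData (hornTower W k)).cell j).app a, ?_⟩
    rw [Functor.ofSequence_map_homOfLE_succ]
    have := congrArg (fun p ↦ cellUnit _ _ ≫ WeightHom.app p a)
      ((hornData (hornTower W k)).cellMap_cell j)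
    simp only [Weight.comp_app] at this
    rw [← Category.assoc, cellUnit_naturality, ← Category.assoc, cellUnit_desc,
      Category.assoc] at this
    exact this
  · obtain ⟨G, hG⟩ := hW.exists_isBasis
    obtain ⟨r⟩ := hu
    obtain ⟨H, hH⟩ := IsBasis.of_relativeCellComplex (α := (Σ n : ℕ, Fin (n + 2)) × A)
      (V := fun p ↦ Δ[p.1.1 + 1]) (U := fun p ↦ Λ[p.1.1 + 1, p.1.2]) (a := fun p ↦ p.2) hG r
    exact hH.isFlexible

end SimpCat

/-! ### A simplicially functorial levelwise Kan replacement. -/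

namespace SimpCat

variable {A : Type w} [EnrichedCategory SSet.{w} A]

/-- The indices of horns in weights. -/
abbrev HornIndex (A : Type w) : Type w := (Σ n : ℕ, Fin (n + 2)) × A

/-- The horn of an index. -/
abbrev HornIndex.horn (i : HornIndex A) : (Δ[i.1.1 + 1] : SSet.{w}).Subcomplex :=
  Λ[i.1.1 + 1, i.1.2]

/-- Cells which attach fillers to the horns in a weight, simplicially functorially in the weight. -/
abbrev kanData (W : Weight A) : CellData W where
  ι := HornIndex A
  V i := Δ[i.1.1 + 1] ⊗ Fun.{w} (i.horn : SSet.{w}) (W.obj i.2)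
  U i := i.horn.preimage (CartesianMonoidalCategory.fst _ _)
  a i := i.2
  g i :=
    { app n := ↾fun s ↦ evalS (X := (i.horn : SSet.{w})) (Y := W.obj i.2) s.1.2 (𝟙 n) ⟨s.1.1, s.2⟩
      naturality n m φ := by
        ext s
        change evalS ((Fun.{w} (i.horn : SSet.{w}) (W.obj i.2)).map φ s.1.2) (𝟙 m)
            ((i.horn : SSet.{w}).map φ ⟨s.1.1, s.2⟩) =
          (W.obj i.2).map φ (evalS (X := (i.horn : SSet.{w})) s.1.2 (𝟙 n) ⟨s.1.1, s.2⟩)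
        refine Eq.trans ?_ (map_evalS (X := (i.horn : SSet.{w})) s.1.2 (𝟙 n) φ _).symm
        exact congrArg (fun ψ ↦ evalS (X := (i.horn : SSet.{w})) (Y := W.obj i.2) s.1.2 ψ _)
          ((Category.comp_id φ).trans (Category.id_comp φ).symm) }

/-- The weight obtained by attaching fillers to horns. -/
noncomputable abbrev kanStep (W : Weight A) : Weight A := (kanData W).attach

/-- Each cell is a horn inclusion times a simplicial set of parameters, hence anodyne. Only this
lifting property is needed, not a decomposition into projective horns. -/
lemma llp_kanData_inclusion (W : Weight A) : (kanFib A).llp (kanData W).inclusion := by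
  refine (kanData W).llp_inclusion fun i G H q hq ↦ ?_
  have : HasLiftingProperty ((kanData W).U i).ι (q.app ((kanData W).a i)) := by
    let e : (((kanData W).U i : SSet.{w})) ≅
        (i.horn : SSet.{w}) ⊗ Fun.{w} (i.horn : SSet.{w}) (W.obj i.2) :=
      { hom := { app n := ↾fun s ↦ (⟨s.1.1, s.2⟩, s.1.2) }
        inv := { app n := ↾fun s ↦ ⟨(s.1.1, s.2), s.1.2⟩ } }
    have h : SSet.anodyneExtensions ((kanData W).U i).ι := by
      refine (MorphismProperty.arrow_mk_iso_iff SSet.anodyneExtensions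
        (Arrow.isoMk (f := Arrow.mk ((kanData W).U i).ι) (g := Arrow.mk (i.horn.ι ▷ Fun.{w}
          (i.horn : SSet.{w}) (W.obj i.2))) e (Iso.refl _) rfl)).2
        (SSet.anodyneExtensions.whiskerRight (SSet.anodyneExtensions.horn_ι i.1.2) _)
    exact h _ (hq i.2)
  exact hasLiftingProperty_cellMap _ _ _

section Functoriality

variable {V W : Weight A} {n : SimplexCategoryᵒᵖ} (h : (Fun.{w} V W).obj n)

/-- The action of `h` on maps from a horn. -/
def hornAct (i : HornIndex A) {m : SimplexCategoryᵒᵖ} (φ : n ⟶ m)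
    (s : ((kanData V).V i).obj m) : ((kanData W).V i).obj m :=
  pair (X := Δ[i.1.1 + 1]) (Y := Fun.{w} (i.horn : SSet.{w}) (W.obj i.2)) s.1
    (comp (X := (i.horn : SSet.{w})) (Y := V.obj i.2) (Z := W.obj i.2) s.2
      ((Fun.{w} (V.obj i.2) (W.obj i.2)).map φ (SFunctor.component h i.2)))

/-- The action of `h` on the simplices of `kanStep V`. -/
def kanStepFun {b : A} {m : SimplexCategoryᵒᵖ} (φ : n ⟶ m) :
    (kanData V).Simplex b m → (kanData W).Simplex b m :=
  Sum.map (natEval h φ) fun p ↦ ⟨p.1, ⟨hornAct h p.1 φ p.2.1.1, p.2.1.2⟩, p.2.2⟩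

/-- The attaching map is evaluation of the parameter on the horn, and evaluation commutes with
postcomposition by `h`. This is why the internal hom has to replace the bare set of horns. -/
lemma kanStepFun_cellIn {b : A} {m : SimplexCategoryᵒᵖ} (φ : n ⟶ m) (i : HornIndex A)
    (s : ((kanData V).V i).obj m) (f : (Fun.{w} i.2 b).obj m) :
    kanStepFun h φ (CellData.cellIn (D := kanData V) i s f) =
      CellData.cellIn (D := kanData W) i (hornAct h i φ s) f := by
  by_cases hs : s ∈ ((kanData V).U i).obj m
  · have hs' : hornAct h i φ s ∈ ((kanData W).U i).obj m := hs
    rw [CellData.cellIn_of_mem _ hs, CellData.cellIn_of_mem _ hs']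
    refine congrArg Sum.inl ((natEval_act h φ f _).trans (congrArg (act W f) ?_))
    change _ = evalS (SFunctor.component h i.2) (φ ≫ 𝟙 m) _
    rw [Category.comp_id]
    rfl
  · have hs' : hornAct h i φ s ∉ ((kanData W).U i).obj m := hs
    rw [CellData.cellIn_of_notMem _ hs, CellData.cellIn_of_notMem _ hs']
    rfl

lemma kanStepFun_map {b : A} {m k : SimplexCategoryᵒᵖ} (ψ : m ⟶ k) (φ : n ⟶ m)
    (x : (kanData V).Simplex b m) :
    kanStepFun h (φ ≫ ψ) ((kanData V).simplexMap ψ x) =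
      (kanData W).simplexMap ψ (kanStepFun h φ x) := by
  refine (kanData V).simplex_cases (fun x ↦ ?_) (fun i s f ↦ ?_) x
  · exact congrArg Sum.inl (map_natEval h φ ψ x).symm
  · rw [CellData.simplexMap_cellIn, kanStepFun_cellIn, kanStepFun_cellIn,
      CellData.simplexMap_cellIn]
    refine congrArg (fun s ↦ CellData.cellIn (D := kanData W) i s _) (Prod.ext rfl ?_)
    refine Eq.trans ?_ (SimpCat.map_comp ψ _ _).symm
    exact congrArg (comp _) ((Fun.{w} (V.obj i.2) (W.obj i.2)).map_comp_apply φ ψ _)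

lemma kanStepFun_act {b c : A} {m : SimplexCategoryᵒᵖ} (φ : n ⟶ m) (e : (Fun.{w} b c).obj m)
    (x : (kanData V).Simplex b m) :
    kanStepFun h φ ((kanData V).simplexAct e x) =
      (kanData W).simplexAct e (kanStepFun h φ x) := by
  refine (kanData V).simplex_cases (fun x ↦ ?_) (fun i s f ↦ ?_) x
  · exact congrArg Sum.inl (natEval_act h φ e x)
  · rw [CellData.simplexAct_cellIn, kanStepFun_cellIn, kanStepFun_cellIn,
      CellData.simplexAct_cellIn]

/-- Simplicial functoriality of `kanStep`. -/
noncomputable def kanStepMap : (Fun.{w} (kanStep V) (kanStep W)).obj n :=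
  mkNat _ _ n (fun _ _ φ x ↦ kanStepFun h φ x) (fun _ {_ _} ψ φ x ↦ kanStepFun_map h ψ φ x)
    (fun φ f x ↦ (congrArg (kanStepFun h φ) ((kanData V).act_attach f x)).trans
      ((kanStepFun_act h φ f x).trans ((kanData W).act_attach f _).symm))

lemma kanStepMap_map {m : SimplexCategoryᵒᵖ} (φ : n ⟶ m) :
    kanStepMap ((Fun.{w} V W).map φ h) = (Fun.{w} (kanStep V) (kanStep W)).map φ (kanStepMap h) := by
  refine nat_ext fun b k ψ x ↦ (kanData V).simplex_cases (fun x ↦ rfl) (fun i s f ↦ ?_) x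
  refine (kanStepFun_cellIn _ ψ i s f).trans (Eq.trans ?_ (kanStepFun_cellIn h (φ ≫ ψ) i s f).symm)
  refine congrArg (fun s ↦ CellData.cellIn (D := kanData W) i s _) (Prod.ext rfl ?_)
  exact congrArg (comp _)
    ((Fun.{w} (V.obj i.2) (W.obj i.2)).map_comp_apply φ ψ (SFunctor.component h i.2)).symm

lemma kanStepMap_idn (n : SimplexCategoryᵒᵖ) : kanStepMap (idn V n) = idn (kanStep V) n := by
  refine nat_ext fun b k ψ x ↦ (kanData V).simplex_cases (fun x ↦ rfl) (fun i s f ↦ ?_) x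
  refine (kanStepFun_cellIn _ ψ i s f).trans ?_
  refine congrArg (fun s ↦ CellData.cellIn (D := kanData V) i s _) (Prod.ext rfl ?_)
  refine (congrArg (comp s.2) (SimpCat.map_idn (V.obj i.2) ψ)).trans (comp_idn _)

lemma kanStepMap_comp {U : Weight A} (k : (Fun.{w} U V).obj n) :
    kanStepMap (comp k h) = comp (kanStepMap k) (kanStepMap h) := by
  refine nat_ext fun b l ψ x ↦ (kanData U).simplex_cases (fun x ↦ rfl) (fun i s f ↦ ?_) x
  refine (kanStepFun_cellIn _ ψ i s f).trans ?_
  refine Eq.trans ?_ ((congrArg (kanStepFun h ψ) (kanStepFun_cellIn k ψ i s f)).trans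
    (kanStepFun_cellIn h ψ i _ f)).symm
  refine congrArg (fun s ↦ CellData.cellIn (D := kanData W) i s _) (Prod.ext rfl ?_)
  exact (congrArg (comp s.2) (SimpCat.map_comp ψ _ _)).trans (comp_assoc _ _ _).symm

end Functoriality

section Tower

/-- The sequence obtained by repeatedly attaching fillers to the horns of a weight. -/
noncomputable def kanTower (W : Weight A) (k : ℕ) : Weight A := Nat.rec W (fun _ X ↦ kanStep X) k

/-- The inclusions of `kanTower`. -/
noncomputable def kanTowerStep (W : Weight A) (k : ℕ) : kanTower W k ⟶ kanTower W (k + 1) :=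
  (kanData (kanTower W k)).inclusion

/-- Simplicial functoriality of `kanTower`. -/
noncomputable def kanTowerMap {V W : Weight A} {n : SimplexCategoryᵒᵖ} (h : (Fun.{w} V W).obj n)
    (k : ℕ) : (Fun.{w} (kanTower V k) (kanTower W k)).obj n :=
  Nat.rec h (fun k (h : (Fun.{w} (kanTower V k) (kanTower W k)).obj n) ↦ kanStepMap h) k

lemma kanTowerMap_succ {V W : Weight A} {n : SimplexCategoryᵒᵖ} (h : (Fun.{w} V W).obj n) (k : ℕ) :
    kanTowerMap h (k + 1) = kanStepMap (kanTowerMap h k) := rfl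

lemma kanTowerMap_map {V W : Weight A} {n m : SimplexCategoryᵒᵖ} (h : (Fun.{w} V W).obj n)
    (φ : n ⟶ m) (k : ℕ) : kanTowerMap ((Fun.{w} V W).map φ h) k =
      (Fun.{w} (kanTower V k) (kanTower W k)).map φ (kanTowerMap h k) := by
  induction k with
  | zero => rfl
  | succ k ih =>
    rw [kanTowerMap_succ, ih, kanStepMap_map]
    rfl

lemma kanTowerMap_idn (V : Weight A) (n : SimplexCategoryᵒᵖ) (k : ℕ) :
    kanTowerMap (idn V n) k = idn (kanTower V k) n := by
  induction k with
  | zero => rfl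
  | succ k ih =>
    rw [kanTowerMap_succ, ih, kanStepMap_idn]
    rfl

lemma kanTowerMap_comp {U V W : Weight A} {n : SimplexCategoryᵒᵖ} (h : (Fun.{w} U V).obj n)
    (h' : (Fun.{w} V W).obj n) (k : ℕ) :
    kanTowerMap (comp h h') k = comp (kanTowerMap h k) (kanTowerMap h' k) := by
  induction k with
  | zero => rfl
  | succ k ih =>
    rw [kanTowerMap_succ, ih, kanStepMap_comp]
    rfl

lemma natEval_kanTowerMap_step {V W : Weight A} {n m : SimplexCategoryᵒᵖ}
    (h : (Fun.{w} V W).obj n) (φ : n ⟶ m) (k : ℕ) {b : A} (x : ((kanTower V k).obj b).obj m) :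
    natEval (kanTowerMap h (k + 1)) φ (((kanTowerStep V k).app b).app m x) =
      ((kanTowerStep W k).app b).app m (natEval (kanTowerMap h k) φ x) := rfl

/-- The cocone defining the simplicially functorial levelwise Kan replacement. -/
noncomputable def kanCocone (W : Weight A) : Cocone (Functor.ofSequence (kanTowerStep W)) :=
  colimCocone _

/-- The defining cocone is a colimit. -/
noncomputable def isColimitKanCocone (W : Weight A) : IsColimit (kanCocone W) :=
  isColimitColimCocone _

/-- A simplicially functorial levelwise Kan replacement. -/
noncomputable def kanRepl (W : Weight A) : Weight A := (kanCocone W).pt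

/-- The inclusions of the defining sequence. -/
noncomputable def kanι (W : Weight A) (k : ℕ) : kanTower W k ⟶ kanRepl W := (kanCocone W).ι.app k

/-- The unit of the levelwise Kan replacement. -/
noncomputable def kanUnit (W : Weight A) : W ⟶ kanRepl W := kanι W 0

lemma kanι_surjective {W : Weight A} {b : A} {n : SimplexCategoryᵒᵖ}
    (y : ((kanRepl W).obj b).obj n) :
    ∃ (k : ℕ) (x : ((kanTower W k).obj b).obj n), ((kanι W k).app b).app n x = y :=
  tower_jointly_surjective (isColimitKanCocone W) y

lemma kanTowerStep_kanι (W : Weight A) (k : ℕ) : kanTowerStep W k ≫ kanι W (k + 1) = kanι W k := by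
  have := (kanCocone W).w (homOfLE (Nat.le_add_right k 1))
  rw [Functor.ofSequence_map_homOfLE_succ] at this
  exact this

section

variable {V W : Weight A} {n : SimplexCategoryᵒᵖ} (h : (Fun.{w} V W).obj n)

/-- The functoriality of the levelwise Kan replacement, on simplices. -/
noncomputable def kanReplFun {b : A} {m : SimplexCategoryᵒᵖ} (φ : n ⟶ m) :
    ((kanRepl V).obj b).obj m ⟶ ((kanRepl W).obj b).obj m :=
  (isColimitOfPreserves (ev b m) (isColimitKanCocone V)).desc
    (Cocone.mk (((kanRepl W).obj b).obj m) (NatTrans.ofSequence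
      (F := Functor.ofSequence (kanTowerStep V) ⋙ ev b m)
      (G := (Functor.const ℕ).obj (((kanRepl W).obj b).obj m))
      (fun k ↦ ↾fun x ↦ ((kanι W k).app b).app m (natEval (kanTowerMap h k) φ x)) (fun k ↦ by
        refine ConcreteCategory.hom_ext _ _ fun x ↦ ?_
        change ((kanι W (k + 1)).app b).app m (natEval (kanTowerMap h (k + 1)) φ
          ((((Functor.ofSequence (kanTowerStep V)).map
            (homOfLE (Nat.le_add_right k 1))).app b).app m x)) =
          ((kanι W k).app b).app m (natEval (kanTowerMap h k) φ x)
        rw [Functor.ofSequence_map_homOfLE_succ]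
        refine (congrArg (((kanι W (k + 1)).app b).app m)
          (natEval_kanTowerMap_step h φ k x)).trans ?_
        exact congrArg (fun p : kanTower W k ⟶ kanRepl W ↦ (p.app b).app m
          (natEval (kanTowerMap h k) φ x)) (kanTowerStep_kanι W k))))

lemma kanReplFun_kanι {b : A} {m : SimplexCategoryᵒᵖ} (φ : n ⟶ m) (k : ℕ)
    (x : ((kanTower V k).obj b).obj m) :
    kanReplFun h φ (((kanι V k).app b).app m x) =
      ((kanι W k).app b).app m (natEval (kanTowerMap h k) φ x) :=
  ConcreteCategory.congr_hom ((isColimitOfPreserves (ev b m) (isColimitKanCocone V)).fac _ k) x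

/-- The simplicial functoriality of the levelwise Kan replacement. -/
noncomputable def kanReplMap : (Fun.{w} (kanRepl V) (kanRepl W)).obj n :=
  mkNat _ _ n (fun _ _ φ x ↦ kanReplFun h φ x)
    (fun b {m l} ψ φ x ↦ by
      obtain ⟨k, x, rfl⟩ := kanι_surjective x
      rw [← Weight.app_map, kanReplFun_kanι, kanReplFun_kanι, ← Weight.app_map, map_natEval])
    (fun {a b m} φ f x ↦ by
      obtain ⟨k, x, rfl⟩ := kanι_surjective x
      rw [← WeightHom.naturality, kanReplFun_kanι, kanReplFun_kanι, ← WeightHom.naturality,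
        natEval_act])

lemma natEval_kanReplMap_kanι {b : A} {m : SimplexCategoryᵒᵖ} (φ : n ⟶ m) (k : ℕ)
    (x : ((kanTower V k).obj b).obj m) :
    natEval (kanReplMap h) φ (((kanι V k).app b).app m x) =
      ((kanι W k).app b).app m (natEval (kanTowerMap h k) φ x) := kanReplFun_kanι h φ k x

lemma natEval_kanReplMap_kanUnit {b : A} {m : SimplexCategoryᵒᵖ} (φ : n ⟶ m)
    (x : (V.obj b).obj m) :
    natEval (kanReplMap h) φ (((kanUnit V).app b).app m x) =
      ((kanUnit W).app b).app m (natEval h φ x) := kanReplFun_kanι h φ 0 x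

lemma kanReplMap_map {m : SimplexCategoryᵒᵖ} (φ : n ⟶ m) :
    kanReplMap ((Fun.{w} V W).map φ h) = (Fun.{w} (kanRepl V) (kanRepl W)).map φ (kanReplMap h) := by
  refine nat_ext fun b l ψ x ↦ ?_
  obtain ⟨k, x, rfl⟩ := kanι_surjective x
  rw [natEval_map, natEval_kanReplMap_kanι, natEval_kanReplMap_kanι, kanTowerMap_map, natEval_map]

lemma kanReplMap_idn (n : SimplexCategoryᵒᵖ) : kanReplMap (idn V n) = idn (kanRepl V) n := by
  refine nat_ext fun b l ψ x ↦ ?_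
  obtain ⟨k, x, rfl⟩ := kanι_surjective x
  rw [natEval_kanReplMap_kanι, kanTowerMap_idn, natEval_idn, natEval_idn]

lemma kanReplMap_comp {U : Weight A} (h' : (Fun.{w} U V).obj n) :
    kanReplMap (comp h' h) = comp (kanReplMap h') (kanReplMap h) := by
  refine nat_ext fun b l ψ x ↦ ?_
  obtain ⟨k, x, rfl⟩ := kanι_surjective x
  rw [natEval_comp, natEval_kanReplMap_kanι, natEval_kanReplMap_kanι, natEval_kanReplMap_kanι,
    kanTowerMap_comp, natEval_comp]

end

lemma isLevelwiseKan_kanRepl (W : Weight A) : IsLevelwiseKan (kanRepl W) := by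
  refine isLevelwiseKan_of_tower (isColimitKanCocone W) fun k a n i f ↦ ?_
  let X := kanTower W k
  let j : HornIndex A := (⟨n, i⟩, a)
  -- A horn `f` is a vertex of the simplicial set of parameters; `p` is the corresponding copy of
  -- the simplex in the cell.
  let p : Δ[n + 1] ⟶ (kanData X).V j :=
    { app m := ↾fun s ↦ pair (X := Δ[n + 1]) (Y := Fun.{w} (Λ[n + 1, i] : SSet.{w}) (X.obj a)) s
        (mkHom (Λ[n + 1, i] : SSet.{w}) (X.obj a) m (fun l _ x ↦ f.app l x) (fun ψ _ x ↦
          ConcreteCategory.congr_hom (f.naturality ψ) x)) }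
  refine ⟨p ≫ cellUnit _ _ ≫ ((kanData X).cell j).app a, ?_⟩
  rw [Functor.ofSequence_map_homOfLE_succ]
  refine NatTrans.ext (funext fun m ↦ ConcreteCategory.hom_ext _ _ fun s ↦ ?_)
  have hs : p.app m s.1 ∈ ((kanData X).U j).obj m := s.2
  refine ((kanData X).cellIn_of_mem hs (idn a m)).trans ?_
  exact congrArg Sum.inl (act_idn X _)

lemma llp_kanUnit (W : Weight A) : (kanFib A).llp (kanUnit W) := by
  refine MorphismProperty.transfiniteCompositionsOfShape_le _ ℕ _ ⟨?_⟩
  exact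
    { F := Functor.ofSequence (kanTowerStep W)
      isoBot := Iso.refl (kanTower W 0)
      incl := (kanCocone W).ι
      isColimit := isColimitKanCocone W
      fac := Category.id_comp (kanι W 0)
      map_mem := fun k _ ↦ by
        have := llp_kanData_inclusion (kanTower W k)
        refine (MorphismProperty.arrow_mk_iso_iff (kanFib A).llp (eqToIso
          (congrArg Arrow.mk (Functor.ofSequence_map_homOfLE_succ (kanTowerStep W) k)))).2 this }

/-- The parametrised cells are not boundary cells, but each attachment has a relative basis, and a
basis suffices. -/
lemma IsFlexible.kanRepl {W : Weight A} (hW : IsFlexible W) : IsFlexible (kanRepl W) := by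
  obtain ⟨G, hG⟩ := hW.exists_isBasis
  have h (k : ℕ) : IsRelBasis ((Functor.ofSequence (kanTowerStep W)).map
      (homOfLE (Nat.le_add_right k 1))) fun _ _ ↦ {y | (kanData (kanTower W k)).IsGenerator y} := by
    rw [Functor.ofSequence_map_homOfLE_succ]
    exact (kanData (kanTower W k)).isRelBasis
  have h' := isRelBasis_tower (isColimitKanCocone W) h
  exact (hG.comp h').isFlexible

end Tower

end SimpCat

/-! ### Transfer of a functorial choice of homotopy limits to the core. -/

namespace SimpCat

lemma constSimplex_one {X : SSet.{w}} (v : X _⦋0⦌) : constSimplex v (op ⦋1⦌) = X.σ 0 v :=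
  congrArg (fun f : ⦋1⦌ ⟶ ⦋0⦌ ↦ X.map f.op v) (SimplexCategory.isTerminalZero.hom_ext _ _)

lemma isInvertible_coherentIso (e : SSet.coherentIso.{w} _⦋1⦌) : IsInvertible e := by
  have := mem_groupoidCore_coherentIso e (𝟙 _)
  rwa [Functor.map_id_apply] at this

section Degeneracies

variable {X : SSet.{w}} (e : X _⦋1⦌)

lemma δ_zero_σ_zero : X.δ 0 (X.σ 0 e) = e := δ_σ_self 0 e

lemma δ_one_σ_zero : X.δ 1 (X.σ 0 e) = e := δ_σ_succ 0 e

lemma δ_two_σ_zero : X.δ 2 (X.σ 0 e) = X.σ 0 (X.δ 1 e) := δ_σ_of_gt 1 0 (by decide) e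

lemma δ_zero_σ_one : X.δ 0 (X.σ 1 e) = X.σ 0 (X.δ 0 e) :=
  SSet.δ_comp_σ_of_le_apply (i := 0) (j := 0) le_rfl e

lemma δ_one_σ_one : X.δ 1 (X.σ 1 e) = e := δ_σ_self 1 e

lemma δ_two_σ_one : X.δ 2 (X.σ 1 e) = e := δ_σ_succ 1 e

end Degeneracies

/-- Equivalences of quasi-categories reflect invertible edges. -/
lemma IsEquivalence.isInvertible {X Y : SSet.{w}} [SSet.Quasicategory X] {f : X ⟶ Y}
    (hf : IsEquivalence f) {e : X _⦋1⦌} (he : IsInvertible (f.app _ e)) : IsInvertible e := by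
  obtain ⟨g, h, -, h₀, h₁, -, -⟩ := hf
  let i : SSet.coherentIso.{w} _⦋1⦌ := SSet.coherentIso.hom.edge
  have hδ (j : Fin 3) (x : X _⦋2⦌) (s : SSet.coherentIso.{w} _⦋2⦌) :
      X.δ j (happ h x s) = happ h (X.δ j x) (SSet.coherentIso.δ j s) :=
    (ConcreteCategory.congr_hom (h.naturality (SimplexCategory.δ j).op)
      (pair (X := X) (Y := SSet.coherentIso.{w}) x s)).symm
  have hi : SSet.coherentIso.δ 1 i = SSet.coherentIso.x₀ := SSet.coherentIso.hom.src_eq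
  have hi' : SSet.coherentIso.δ 0 i = SSet.coherentIso.x₁ := SSet.coherentIso.hom.tgt_eq
  have hdeg (v : X _⦋0⦌) : IsInvertible (happ h (X.σ 0 v) i) :=
    ((isInvertible_degenerate v).pair (isInvertible_coherentIso i)).map h
  -- The homotopy from the identity to `f ≫ g`, applied to `e`, is a square with opposite sides `e`
  -- and its image under `f ≫ g`; the other two sides are invertible. Two-out-of-three is applied in
  -- its two triangles, first for the diagonal and then for `e`.
  have hdiag : IsInvertible (happ h e i) := by
    have key := IsInvertible.two_of_three₁
      (t := happ h (X.σ 0 e) (SSet.coherentIso.σ 1 i)) (by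
        rw [hδ, δ_zero_σ_zero, δ_zero_σ_one, hi', ← constSimplex_one, ← atVertex_app, h₁]
        exact he.map g) (by
        rw [hδ, δ_two_σ_zero, δ_two_σ_one]
        exact hdeg _)
    rwa [hδ, δ_one_σ_zero, δ_one_σ_one] at key
  have key := IsInvertible.two_of_three₂
    (t := happ h (X.σ 1 e) (SSet.coherentIso.σ 0 i)) (by
      rw [hδ, δ_zero_σ_zero, δ_zero_σ_one]
      exact hdeg _) (by
      rw [hδ, δ_one_σ_one, δ_one_σ_zero]
      exact hdiag)
  rw [hδ, δ_two_σ_one, δ_two_σ_zero, hi, ← constSimplex_one, ← atVertex_app, h₀] at key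
  exact key

section EnrichedFunctor

variable {C : Type u} [EnrichedCategory SSet.{w} C] {D : Type v} [EnrichedCategory SSet.{w} D]

/-- The action of a simplicial functor on `n`-simplices. -/
abbrev mapSimplex (P : EnrichedFunctor SSet.{w} C D) {X Y : C} {n : SimplexCategoryᵒᵖ}
    (f : (Fun.{w} X Y).obj n) : (Fun.{w} (P.obj X) (P.obj Y)).obj n :=
  (P.map X Y).app n f

lemma mapSimplex_map (P : EnrichedFunctor SSet.{w} C D) {X Y : C} {n m : SimplexCategoryᵒᵖ}
    (φ : n ⟶ m) (f : (Fun.{w} X Y).obj n) :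
    mapSimplex P ((Fun.{w} X Y).map φ f) =
      (Fun.{w} (P.obj X) (P.obj Y)).map φ (mapSimplex P f) :=
  ConcreteCategory.congr_hom ((P.map X Y).naturality φ) f

lemma mapSimplex_idn (P : EnrichedFunctor SSet.{w} C D) (X : C) (n : SimplexCategoryᵒᵖ) :
    mapSimplex P (idn X n) = idn (P.obj X) n :=
  ConcreteCategory.congr_hom (NatTrans.congr_app (P.map_id X) n) PUnit.unit

lemma mapSimplex_comp (P : EnrichedFunctor SSet.{w} C D) {X Y Z : C} {n : SimplexCategoryᵒᵖ}
    (f : (Fun.{w} X Y).obj n) (g : (Fun.{w} Y Z).obj n) :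
    mapSimplex P (comp f g) = comp (mapSimplex P f) (mapSimplex P g) :=
  ConcreteCategory.congr_hom (NatTrans.congr_app (P.map_comp X Y Z) n)
    (pair (X := Fun X Y) (Y := Fun Y Z) f g)

/-- A simplicial functor landing in groupoid cores factors through the `(∞,1)`-core. -/
def liftCore (P : EnrichedFunctor SSet.{w} C D)
    (hP : ∀ (X Y : C) (n : SimplexCategoryᵒᵖ) (f : (Fun.{w} X Y).obj n),
      mapSimplex P f ∈ (groupoidCore (Fun.{w} (P.obj X) (P.obj Y))).obj n) :
    EnrichedFunctor SSet.{w} C (Core D) :=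
  mkEnrichedFunctor C (Core D) (fun X ↦ Core.mk (P.obj X))
    (fun f ↦ ⟨mapSimplex P f, hP _ _ _ f⟩)
    (fun φ f ↦ Subtype.ext (mapSimplex_map P φ f))
    (fun X n ↦ Subtype.ext (mapSimplex_idn P X n))
    (fun f g ↦ Subtype.ext (mapSimplex_comp P f g))

end EnrichedFunctor

section FunctorialChoice

variable {K : Type u} [EnrichedCategory SSet.{w} K] {A : Type w} [EnrichedCategory SSet.{w} A]

/-- A transformation of diagrams in the core, seen as a transformation of diagrams in `K`. -/
def baseMap {F G : SFunctor A (Core K)} {n : SimplexCategoryᵒᵖ} (κ : (Fun.{w} F G).obj n) :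
    (Fun.{w} F.toBase G.toBase).obj n :=
  show (SFunctor.natSSet F.toBase G.toBase).obj n from
    ⟨fun a ↦ (SFunctor.component κ a).1, fun _ _ _ φ f ↦
      congrArg Subtype.val ((show (SFunctor.natSSet F G).obj n from κ).2 φ f)⟩

/-- Levelwise Kan replacement as an operation on flexible weights. -/
noncomputable def flexKanRepl (W : Flex A) : Flex A := ⟨kanRepl W.weight, W.flexible.kanRepl⟩

variable (A K) in
/-- Levelwise Kan replacement of weights and inclusion of diagrams in the core. -/
noncomputable def replBase :
    EnrichedFunctor SSet.{w} ((Flex A)ᵒᵖ × SFunctor A (Core K)) ((Flex A)ᵒᵖ × SFunctor A K) :=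
  mkEnrichedFunctor _ _ (fun p ↦ (op (flexKanRepl p.1.unop), p.2.toBase))
    (fun {p q _} f ↦ pair (X := Fun.{w} (kanRepl q.1.unop.weight) (kanRepl p.1.unop.weight))
      (Y := Fun.{w} p.2.toBase q.2.toBase)
      (kanReplMap (V := q.1.unop.weight) (W := p.1.unop.weight) f.1) (baseMap (F := p.2) (G := q.2) f.2))
    (fun φ _ ↦ Prod.ext (kanReplMap_map _ φ) rfl)
    (fun _ n ↦ Prod.ext (kanReplMap_idn n) rfl)
    (fun _ _ ↦ Prod.ext (kanReplMap_comp _ _) rfl)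

/-- The map of weights `Fun X (F -) ⟶ Fun X (G -)` induced by a transformation `F ⟶ G`. -/
def funAlongMap {C : Type u} [EnrichedCategory SSet.{w} C] (X : C) {F G : SFunctor A C}
    {n : SimplexCategoryᵒᵖ} (κ : (Fun.{w} F G).obj n) :
    (Fun.{w} (funAlong X F) (funAlong X G)).obj n :=
  mkNat (funAlong X F) (funAlong X G) n
    (fun a _ φ (x : (Fun.{w} X (F.obj a)).obj _) ↦
      comp x ((Fun.{w} (F.obj a) (G.obj a)).map φ (SFunctor.component κ a)))
    (fun a _ _ ψ φ x ↦ by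
      refine Eq.trans ?_ (SimpCat.map_comp ψ _ _).symm
      rw [Functor.map_comp_apply]
      rfl)
    (fun {a b _} φ f x ↦ by
      refine Eq.trans ?_ (act_funAlong X G f _).symm
      refine (congrArg (fun y ↦ comp y ((Fun.{w} (F.obj b) (G.obj b)).map φ
        (SFunctor.component κ b))) (act_funAlong X F f x)).trans ?_
      refine (comp_assoc _ _ _).trans (Eq.trans (congrArg (comp x) ?_) (comp_assoc _ _ _).symm)
      exact ((show (SFunctor.natSSet F G).obj n from κ).2 φ f).symm)

/-- Comparison maps are equivalences and so reflect invertible edges. By naturality of the cones,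
the image of an edge under the comparison map comes from cones in the core, which form a Kan complex
because the replaced weight is cofibrant. -/
lemma mem_groupoidCore_lim [QCatEnriched.{w} K] (H : FlexibleHolimChoice A K)
    (p q : (Flex A)ᵒᵖ × SFunctor A (Core K)) (n : SimplexCategoryᵒᵖ) (f : (Fun.{w} p q).obj n) :
    mapSimplex ((replBase K A).comp SSet.{w} H.lim) f ∈
      (groupoidCore (Fun.{w} (((replBase K A).comp SSet.{w} H.lim).obj p)
        (((replBase K A).comp SSet.{w} H.lim).obj q))).obj n := by
  intro φ
  rw [← mapSimplex_map]
  generalize (Fun.{w} p q).map φ f = f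
  let X : Core K := Core.mk (((replBase K A).comp SSet.{w} H.lim).obj p)
  have hX := isLevelwiseKan_funAlong X q.2
  have : SSet.KanComplex (Fun.{w} (kanRepl q.1.unop.weight) (funAlong X q.2)) :=
    (flexKanRepl q.1.unop).flexible.isCofibrant.kanComplex_fun hX
  have := QCatEnriched.quasicategory (C := K) X.obj
    (H.lim.obj (op (flexKanRepl q.1.unop), q.2.toBase))
  refine (H.isHomotopyLimit (flexKanRepl q.1.unop) q.2.toBase X.obj).isInvertible ?_
  let c : Cone (kanRepl p.1.unop.weight) p.2 X := coneLift (isLevelwiseKan_kanRepl _)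
    (H.cone (flexKanRepl p.1.unop) p.2.toBase)
  -- This is the right-hand side of `cone_natural`, formed with the lifted cone and the diagrams in
  -- the core.
  let k : (Fun.{w} (kanRepl q.1.unop.weight) (funAlong X q.2)) _⦋1⦌ :=
    comp (kanReplMap (V := q.1.unop.weight) (W := p.1.unop.weight) f.1)
      ((preFun c _).app _ (funAlongMap X (F := p.2) (G := q.2) f.2))
  have hk := (isInvertible_of_kanComplex k).map
    (postFun (kanRepl q.1.unop.weight) (funAlongInclusion X q.2))
  refine Eq.mpr (congrArg IsInvertible ?_) hk
  refine nat_ext (V := kanRepl q.1.unop.weight) (W := funAlong X.obj q.2.toBase)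
    fun a m ψ x ↦ ?_
  exact H.cone_natural (V := flexKanRepl q.1.unop) (W := flexKanRepl p.1.unop)
    (F := p.2.toBase) (G := q.2.toBase) (kanReplMap f.1) (baseMap (F := p.2) (G := q.2) f.2) ψ a x

/-- A functorial choice of flexible weighted homotopy limits in `K` induces one in the core. -/
noncomputable def FlexibleHolimChoice.core [QCatEnriched.{w} K] (H : FlexibleHolimChoice A K) :
    FlexibleHolimChoice A (Core K) where
  lim := liftCore ((replBase K A).comp SSet.{w} H.lim) (mem_groupoidCore_lim H)
  cone W F := kanUnit W.weight ≫ coneLift (isLevelwiseKan_kanRepl _)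
    (H.cone (flexKanRepl W) F.toBase)
  cone_natural {V W F G n m} α κ φ a x := by
    refine Subtype.ext ?_
    refine (H.cone_natural (V := flexKanRepl V) (W := flexKanRepl W) (F := F.toBase)
      (G := G.toBase) (kanReplMap α) (baseMap κ) φ a (((kanUnit V.weight).app a).app m x)).trans ?_
    exact congrArg (fun y ↦ comp ((H.cone (flexKanRepl W) F.toBase).leg y)
      ((Fun.{w} (F.obj a).obj (G.obj a).obj).map φ (SFunctor.component (baseMap κ) a)))
      (natEval_kanReplMap_kanUnit α φ x)
  isHomotopyLimit W F := isHomotopyLimit_core (isLevelwiseKan_kanRepl _)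
    (flexKanRepl W).flexible.isCofibrant (llp_kanUnit _) (H.isHomotopyLimit _ _)

end FunctorialChoice

end SimpCat

namespace SimpCat

/-! ### Strict weighted limits and their construction from cells. -/

section StrictLimits

variable {K : Type u} [EnrichedCategory SSet.{w} K] {A : Type w} [EnrichedCategory SSet.{w} A]

/-- Simplices of a simplicial set of maps of weights, as maps of weights into a cotensor. -/
def simplexEquiv (V G : Weight A) (n : SimplexCategoryᵒᵖ) :
    (Fun.{w} V G).obj n ≃ (V ⟶ cot (SSet.stdSimplex.obj n.unop) G) :=
  (SSet.yonedaEquiv (n := n.unop)).symm.trans ⟨toCot, ofCot, ofCot_toCot, toCot_ofCot⟩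

lemma simplexEquiv_preFun {V W : Weight A} (u : V ⟶ W) (G : Weight A) {n : SimplexCategoryᵒᵖ}
    (x : (Fun.{w} W G).obj n) :
    simplexEquiv V G n ((preFun u G).app n x) = u ≫ simplexEquiv W G n x :=
  (congrArg toCot (SSet.yonedaEquiv.injective (by
    rw [Equiv.apply_symm_apply, SSet.yonedaEquiv_comp, Equiv.apply_symm_apply]))).trans
    (toCot_comp u (SSet.yonedaEquiv.symm x))

/-- An `n`-simplex is a map into the cotensor with `Δ[n]`, so joint epimorphy for ordinary maps of
weights extends to simplices of all dimensions. -/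
lemma preFun_jointly_injective {ι : Type v} {V : ι → Weight A} {W : Weight A} (u : ∀ i, V i ⟶ W)
    (hu : ∀ (G : Weight A) (f g : W ⟶ G), (∀ i, u i ≫ f = u i ≫ g) → f = g) {G : Weight A}
    {n : SimplexCategoryᵒᵖ} {x y : (Fun.{w} W G).obj n}
    (h : ∀ i, (preFun (u i) G).app n x = (preFun (u i) G).app n y) : x = y := by
  refine (simplexEquiv W G n).injective (hu _ _ _ fun i ↦ ?_)
  rw [← simplexEquiv_preFun, ← simplexEquiv_preFun, h]

lemma post_idn {X Y : K} {n : SimplexCategoryᵒᵖ} (f : (Fun.{w} X Y).obj n) :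
    post f (idn Y _) = f :=
  (congrArg (comp f) (map_idn Y _)).trans (comp_idn f)

lemma idn_post {X Y : K} (f : Arr.{w} X Y) : post (idn X _) f = f := by
  refine (idn_comp _).trans ?_
  refine (congrArg (fun φ : ⦋0⦌ ⟶ ⦋0⦌ ↦ (Fun.{w} X Y).map φ.op f)
    (SimplexCategory.isTerminalZero.hom_ext _ (𝟙 _))).trans ?_
  exact (Fun.{w} X Y).map_id_apply _ _

/-- The map `Fun L (F -) ⟶ Fun L' (F -)` induced by an arrow `L' ⟶ L`. -/
def precomp {L' L : K} (r : Arr.{w} L' L) (F : SFunctor A K) : funAlong L F ⟶ funAlong L' F where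
  app a :=
    { app n := ↾fun f ↦ preArr (B := F.obj a) r f
      naturality n m φ := by
        refine ConcreteCategory.hom_ext _ _ fun f ↦ ?_
        refine Eq.trans ?_ (map_comp (X := L') (Z := F.obj a) φ _ f).symm
        rw [map_constSimplex]
        rfl }
  naturality {a b _} f x :=
    (congrArg (preArr (B := F.obj b) r) (act_funAlong L F f x)).trans
      ((comp_assoc _ _ _).symm.trans (act_funAlong L' F f _).symm)

lemma precomp_comp {L'' L' L : K} (r : Arr.{w} L'' L') (s : Arr.{w} L' L) (F : SFunctor A K) :
    precomp (comp r s) F = precomp s F ≫ precomp r F :=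
  Weight.hom_ext fun a ↦ NatTrans.ext (funext fun _ ↦ ConcreteCategory.hom_ext _ _ fun f ↦
    (congrArg (fun t ↦ comp (Z := F.obj a) t f) (map_comp _ r s)).trans (comp_assoc _ _ _))

lemma comparison_precomp {W : Weight A} {F : SFunctor A K} {L' L : K} (c : Cone W F L)
    (r : Arr.{w} L' L) (X : K) {n : SimplexCategoryᵒᵖ} (f : (Fun.{w} X L').obj n) :
    (Cone.comparison (W := W) (c ≫ precomp r F) X).app n f = (c.comparison X).app n (post f r) := by
  refine nat_ext fun a m φ x ↦ ?_
  change comp ((Fun.{w} X L').map φ f) (comp (constSimplex r m) (c.leg x)) =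
    comp ((Fun.{w} X L).map φ (comp f (constSimplex r n))) (c.leg x)
  rw [map_comp, map_constSimplex, comp_assoc]

lemma comparison_precompose {V W : Weight A} {F : SFunctor A K} {L : K} (u : V ⟶ W)
    (c : Cone W F L) (X : K) {n : SimplexCategoryᵒᵖ} (f : (Fun.{w} X L).obj n) :
    (Cone.comparison (W := V) (u ≫ c) X).app n f =
      (preFun u (funAlong X F)).app n ((c.comparison X).app n f) := rfl

/-- Weighted limits in the strict simplicially enriched sense. -/
structure StrictLimit (W : Weight A) (F : SFunctor A K) where
  pt : K
  cone : Cone W F pt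
  bijective (X : K) (n : SimplexCategoryᵒᵖ) : Function.Bijective ((cone.comparison X).app n)

namespace StrictLimit

variable {V W : Weight A} {F : SFunctor A K}

/-- The arrow `r` between strict limits is induced by the map of weights `u`. -/
def IsRestriction (u : V ⟶ W) (S : StrictLimit V F) (T : StrictLimit W F)
    (r : Arr.{w} T.pt S.pt) : Prop :=
  S.cone ≫ precomp r F = u ≫ T.cone

lemma exists_restriction (u : V ⟶ W) (S : StrictLimit V F) (T : StrictLimit W F) :
    ∃ r, IsRestriction u S T r := by
  -- The arrow classifies the universal cone of `T` restricted along `u`, that is, the image of the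
  -- identity.
  obtain ⟨r, hr⟩ := (S.bijective T.pt (op ⦋0⦌)).2
    ((preFun u (funAlong T.pt F)).app _ ((T.cone.comparison T.pt).app _ (idn T.pt _)))
  refine ⟨r, Weight.hom_ext fun a ↦ NatTrans.ext (funext fun n ↦
    ConcreteCategory.hom_ext _ _ fun x ↦ ?_)⟩
  refine (congrArg (fun h ↦ natEval h (n.unop.const ⦋0⦌ 0).op x) hr).trans ?_
  refine (congrArg (fun h ↦ comp h (T.cone.leg ((u.app a).app n x))) (map_idn T.pt _)).trans ?_
  exact idn_comp _

lemma IsRestriction.comparison_post {u : V ⟶ W} {S : StrictLimit V F} {T : StrictLimit W F}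
    {r : Arr.{w} T.pt S.pt} (hr : IsRestriction u S T r) (X : K) {n : SimplexCategoryᵒᵖ}
    (f : (Fun.{w} X T.pt).obj n) :
    (S.cone.comparison X).app n (post f r) =
      (preFun u (funAlong X F)).app n ((T.cone.comparison X).app n f) := by
  rw [← comparison_precomp, ← comparison_precompose]
  exact congrArg (fun c : Cone V F T.pt ↦ (c.comparison X).app n f) hr

lemma arr_ext (S : StrictLimit V F) {L : K} {r s : Arr.{w} L S.pt}
    (h : S.cone ≫ precomp r F = S.cone ≫ precomp s F) : r = s := by
  refine (idn_post r).symm.trans (Eq.trans ((S.bijective L (op ⦋0⦌)).1 ?_) (idn_post s))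
  rw [← comparison_precomp, ← comparison_precomp]
  exact congrArg (fun c : Cone V F L ↦ (c.comparison L).app _ (idn L _)) h

/-- Strict limits weighted by a weight covered by weights whose strict limits are given. -/
def ofCover {ι : Type v} {V : ι → Weight A} (u : ∀ i, V i ⟶ W)
    (hu : ∀ (G : Weight A) (f g : W ⟶ G), (∀ i, u i ≫ f = u i ≫ g) → f = g)
    (S : ∀ i, StrictLimit (V i) F) (L : K) (π : ∀ i, Arr.{w} L (S i).pt) (c : Cone W F L)
    (hc : ∀ i, u i ≫ c = (S i).cone ≫ precomp (π i) F)
    (hL : ∀ (X : K) (n : SimplexCategoryᵒᵖ) (z : (Fun.{w} W (funAlong X F)).obj n)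
      (y : ∀ i, (Fun.{w} X (S i).pt).obj n),
      (∀ i, ((S i).cone.comparison X).app n (y i) = (preFun (u i) (funAlong X F)).app n z) →
      ∃! f : (Fun.{w} X L).obj n, ∀ i, post f (π i) = y i) :
    StrictLimit W F where
  pt := L
  cone := c
  bijective X n := by
    have key (f : (Fun.{w} X L).obj n) (i : ι) :
        ((S i).cone.comparison X).app n (post f (π i)) =
          (preFun (u i) (funAlong X F)).app n ((c.comparison X).app n f) := by
      rw [← comparison_precomp, ← comparison_precompose, hc]
    refine ⟨fun f g hfg ↦ ?_, fun z ↦ ?_⟩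
    · refine (hL X n _ _ (key f)).unique (fun i ↦ rfl) fun i ↦ ((S i).bijective X n).1 ?_
      rw [key, key, hfg]
    · choose y hy using fun i ↦ ((S i).bijective X n).2 ((preFun (u i) (funAlong X F)).app n z)
      obtain ⟨f, hf, -⟩ := hL X n z y hy
      refine ⟨f, preFun_jointly_injective u hu fun i ↦ ?_⟩
      rw [← key, hf, hy]

/-- The restriction of a map `U × Fun a - ⟶ G` along the identity of `a`, on simplices. -/
def cellRestrict {U : SSet.{w}} {a : A} {G : Weight A} {n : SimplexCategoryᵒᵖ}
    (x : (Fun.{w} (cellWeight U a) G).obj n) : (Fun.{w} U (G.obj a)).obj n :=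
  mkHom U (G.obj a) n (fun _ φ s ↦ natEval x φ ((cellUnit U a).app _ s)) (fun ψ φ s ↦ by
    rw [map_natEval]
    exact congrArg (natEval x (φ ≫ ψ)) (ConcreteCategory.congr_hom ((cellUnit U a).naturality ψ) s))

lemma cellRestrict_injective {U : SSet.{w}} {a : A} {G : Weight A} {n : SimplexCategoryᵒᵖ} :
    Function.Injective
      (cellRestrict : (Fun.{w} (cellWeight U a) G).obj n → (Fun.{w} U (G.obj a)).obj n) := by
  intro x y h
  refine nat_ext fun b m φ p ↦ ?_
  have hp : p = act (cellWeight U a) p.2 ((cellUnit U a).app m p.1) := by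
    rw [act_cellWeight]
    exact Prod.ext rfl (idn_comp _).symm
  rw [hp, natEval_act, natEval_act]
  exact congrArg (fun z ↦ act G p.2 (evalS (X := U) (Y := G.obj a) z φ p.1)) h

/-- Cotensors as strict limits. -/
def cotensor {U : SSet.{w}} {a : A} {D : K} (ε : U ⟶ Fun.{w} D (F.obj a)) (hε : IsCotensor ε) :
    StrictLimit (cellWeight U a) F where
  pt := D
  cone := cellDesc (G := funAlong D F) ε
  bijective X n := by
    have key (f : (Fun.{w} X D).obj n) : cellRestrict (G := funAlong X F)
        ((Cone.comparison (F := F) (L := D) (cellDesc (G := funAlong D F) ε) X).app n f) =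
          cotensorComparison ε X n f :=
      hom_ext fun m φ s ↦ congrArg (comp _) (act_idn (funAlong D F) _)
    refine ⟨fun f g h ↦ (hε X n).1 ?_, fun z ↦ ?_⟩
    · rw [← key, ← key, h]
    · obtain ⟨f, hf⟩ := (hε X n).2 (cellRestrict (G := funAlong X F) z)
      exact ⟨f, cellRestrict_injective ((key f).trans hf)⟩

/-- Products of strict limits. -/
noncomputable def product {ι : Type w} {V : ι → Weight A} {c : Cofan V} (hc : IsColimit c)
    (S : ∀ i, StrictLimit (V i) F) {P : K} {π : ∀ i, Arr.{w} P (S i).pt}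
    (hP : IsEnrichedProduct (fun i ↦ (S i).pt) P π) : StrictLimit c.pt F :=
  ofCover (fun i ↦ c.inj i) (fun _ _ _ h ↦ Cofan.IsColimit.hom_ext hc _ _ h) S P π
    (Cofan.IsColimit.desc hc fun i ↦ (S i).cone ≫ precomp (π i) F)
    (fun i ↦ Cofan.IsColimit.fac hc _ i)
    (fun X n _ y _ ↦ by
      obtain ⟨f, hf⟩ := (hP X n).2 y
      exact ⟨f, congrFun hf, fun g hg ↦ (hP X n).1 ((funext hg).trans hf.symm)⟩)

lemma inj_product {ι : Type w} {V : ι → Weight A} {c : Cofan V} (hc : IsColimit c)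
    (S : ∀ i, StrictLimit (V i) F) {P : K} {π : ∀ i, Arr.{w} P (S i).pt}
    (hP : IsEnrichedProduct (fun i ↦ (S i).pt) P π) (i : ι) :
    c.inj i ≫ (product hc S hP).cone = (S i).cone ≫ precomp (π i) F :=
  Cofan.IsColimit.fac hc _ i

/-- Terminal objects as strict limits. -/
def terminal (hW : IsInitial W) {T : K} (hT : IsEnrichedTerminal.{w} T) : StrictLimit W F :=
  -- An initial weight is covered by the empty family.
  ofCover (ι := PEmpty.{w + 1}) (V := fun _ ↦ W) (fun i ↦ i.elim) (fun _ _ _ _ ↦ hW.hom_ext _ _)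
    (fun i ↦ i.elim) T (fun i ↦ i.elim) (hW.to _) (fun i ↦ i.elim) (fun X n _ _ _ ↦ by
      obtain ⟨h⟩ := hT X n
      exact ⟨default, fun i ↦ i.elim, fun f _ ↦ Subsingleton.elim _ _⟩)

section Pushout

variable {Z X₁ Y X₂ : Weight A} {g₁ : Z ⟶ X₁} {m : Z ⟶ Y} {f : X₁ ⟶ X₂} {g₂ : Y ⟶ X₂}
  (h : IsPushout g₁ m f g₂) {R : StrictLimit Z F} {S : StrictLimit X₁ F} {T : StrictLimit Y F}
  {t : Arr.{w} S.pt R.pt} {r : Arr.{w} T.pt R.pt} (ht : IsRestriction g₁ R S t)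
  (hr : IsRestriction m R T r) {P : K} {g : Arr.{w} P T.pt} {q : Arr.{w} P S.pt}
  (hP : IsEnrichedPullback g q r t)

include ht hr hP in
lemma pullback_comm : g₁ ≫ S.cone ≫ precomp q F = m ≫ T.cone ≫ precomp g F := by
  rw [← Category.assoc, ← ht, ← Category.assoc, ← hr, Category.assoc, Category.assoc,
    ← precomp_comp, ← precomp_comp, hP.comm]

/-- Pullbacks of strict limits. -/
noncomputable def pullback : StrictLimit X₂ F :=
  ofCover (ι := Bool) (V := Bool.rec X₁ Y) (Bool.rec f g₂)
    (fun _ _ _ h' ↦ h.hom_ext (h' false) (h' true)) (Bool.rec S T) P (Bool.rec q g)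
    (h.desc (S.cone ≫ precomp q F) (T.cone ≫ precomp g F) (pullback_comm ht hr hP))
    (by rintro (_ | _); exacts [h.inl_desc _ _ _, h.inr_desc _ _ _])
    (fun X n z y hy ↦ by
      -- Both sides classify the restriction of `z` along the diagonal of the pushout square.
      have h₁ : post (y true) r = post (y false) t := by
        refine (R.bijective X n).1 ?_
        rw [hr.comparison_post, ht.comparison_post]
        refine (congrArg _ (hy true)).trans (Eq.trans ?_ (congrArg _ (hy false)).symm)
        exact congrArg (fun u ↦ (preFun u (funAlong X F)).app n z) h.w.symm
      obtain ⟨x, hx, hx'⟩ := hP.universal X n _ _ h₁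
      exact ⟨x, Bool.rec hx.2 hx.1, fun x' h' ↦ hx' x' ⟨h' true, h' false⟩⟩)

lemma isRestriction_pullback : IsRestriction f S (pullback h ht hr hP) q :=
  (h.inl_desc _ _ _).symm

end Pushout

section Tower

variable {W : ℕ ⥤ Weight A} {c : Cocone W} (hc : IsColimit c) (S : ∀ k, StrictLimit (W.obj k) F)
  {p : ∀ k, Arr.{w} (S (k + 1)).pt (S k).pt}
  (hp : ∀ k, IsRestriction (W.map (homOfLE (Nat.le_add_right k 1))) (S k) (S (k + 1)) (p k))
  {L : K} {π : ∀ k, Arr.{w} L (S k).pt} (hL : IsEnrichedTowerLimit (fun k ↦ (S k).pt) p L π)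

/-- Limits of towers of strict limits. -/
noncomputable def tower : StrictLimit c.pt F :=
  ofCover (fun k ↦ c.ι.app k) (fun _ _ _ h ↦ hc.hom_ext h) S L π
    (hc.desc (Cocone.mk (funAlong L F) (NatTrans.ofSequence
      (G := (Functor.const ℕ).obj (funAlong L F)) (fun k ↦ (S k).cone ≫ precomp (π k) F)
      (fun k ↦ by
        refine Eq.trans ?_ (Category.comp_id _).symm
        rw [← Category.assoc, ← hp k, Category.assoc, ← precomp_comp, hL.comm]))))
    (fun k ↦ hc.fac _ k)
    (fun X n z y hy ↦ hL.universal X n y fun k ↦ by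
      refine ((S k).bijective X n).1 ?_
      rw [(hp k).comparison_post, hy, hy]
      exact congrArg (fun u ↦ (preFun u (funAlong X F)).app n z) (c.w _))

end Tower

end StrictLimit

end StrictLimits

end SimpCat

/-! ### Flexible weighted limits in an `∞`-cosmos, and their functoriality. -/

namespace SimpCat

variable {K : Type u} [EnrichedCategory SSet.{w} K] {A : Type w} [EnrichedCategory SSet.{w} A]

lemma IsEnrichedTerminal.subsingleton {T : K} (hT : IsEnrichedTerminal.{w} T) (X : K)
    (n : SimplexCategoryᵒᵖ) : Subsingleton ((Fun.{w} X T).obj n) := by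
  obtain ⟨h⟩ := hT X n
  infer_instance

/-- The cotensor of a terminal object. -/
def terminalCotensor (U : SSet.{w}) (T : K) : U ⟶ Fun.{w} T T where
  app n := ↾fun _ ↦ idn T n
  naturality n m φ := by
    ext x
    exact (map_idn T φ).symm

lemma isCotensor_terminalCotensor (U : SSet.{w}) {T : K} (hT : IsEnrichedTerminal.{w} T) :
    IsCotensor (terminalCotensor U T) := fun X n ↦ by
  refine ⟨fun f g _ ↦ (hT.subsingleton X n).elim f g, fun z ↦ ?_⟩
  obtain ⟨h⟩ := hT X n
  exact ⟨default, hom_ext fun m _ _ ↦ (hT.subsingleton X m).elim _ _⟩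

namespace InftyCosmos

/-- Restriction of cotensors along a monomorphism is an isofibration. -/
lemma isofib_restriction (H : InftyCosmos.{w} K) {U V : SSet.{w}} (i : U ⟶ V) [Mono i] {B BU BV : K}
    {εU : U ⟶ Fun.{w} BU B} {εV : V ⟶ Fun.{w} BV B} (hU : IsCotensor εU) (hV : IsCotensor εV)
    {r : Arr.{w} BV BU} (hr : ∀ n (u : U.obj n), preArr r (εU.app n u) = εV.app n (i.app n u)) :
    H.IsIsofib r := by
  obtain ⟨T, hT⟩ := H.exists_terminal
  have hs := hT.subsingleton
  have toT (X : K) : Arr.{w} X T := (hT X (op ⦋0⦌)).some.default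
  -- This is the Leibniz cotensor with the map from `B` to the terminal object: the cotensors of the
  -- latter are terminal, so the pullback is `BU` and the Leibniz map is `r`.
  refine H.isofib_leibniz i (toT B) εU εV (terminalCotensor U T) (terminalCotensor V T) r (idn T _)
    (toT BU) (toT BV) (idn BU _) (toT BU) r (H.isofib_terminal _ hT) hU hV
    (isCotensor_terminalCotensor U hT) (isCotensor_terminalCotensor V hT) hr
    (fun n _ ↦ (hs _ n).elim _ _) (fun n _ ↦ (hs _ n).elim _ _) (fun n _ ↦ (hs _ n).elim _ _)
    { comm := (hs _ _).elim _ _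
      universal := fun X n x y _ ↦ ⟨x, ⟨post_idn x, (hs X n).elim _ _⟩, fun z hz ↦ ?_⟩ }
    (comp_idn r) ((hs _ _).elim _ _)
  exact (post_idn z).symm.trans hz.1

variable {F : SFunctor A K}

/-- A restriction of strict limits which is an isofibration. -/
def HasIsofibration (H : InftyCosmos.{w} K) {V W : Weight A} (u : V ⟶ W) (S : StrictLimit V F)
    (T : StrictLimit W F) : Prop :=
  ∃ r, StrictLimit.IsRestriction u S T r ∧ H.IsIsofib r

lemma exists_strictLimit_cell (H : InftyCosmos.{w} K) {U V : SSet.{w}} (i : U ⟶ V) [Mono i]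
    (a : A) : ∃ (S : StrictLimit (cellWeight U a) F) (T : StrictLimit (cellWeight V a) F),
      H.HasIsofibration (cellMap i a) S T := by
  obtain ⟨D, ε, hε⟩ := H.exists_cotensor U (F.obj a)
  obtain ⟨E, δ, hδ⟩ := H.exists_cotensor V (F.obj a)
  obtain ⟨r, hr⟩ := StrictLimit.exists_restriction (cellMap i a)
    (StrictLimit.cotensor (F := F) ε hε) (StrictLimit.cotensor δ hδ)
  refine ⟨_, _, r, hr, H.isofib_restriction i hε hδ fun n s ↦ ?_⟩
  have := congrArg (fun c : cellWeight U a ⟶ funAlong E F ↦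
    (c.app a).app n ((cellUnit U a).app n s)) hr
  refine (congrArg (preArr (B := F.obj a) r) (act_idn (funAlong D F) (ε.app n s)).symm).trans
    (this.trans ?_)
  exact act_idn (funAlong E F) (δ.app n (i.app n s))

-- Limits turn the attaching pushout into a pullback along a product of restriction maps. Being a
-- product of isofibrations, this map can be pulled back, and its pullback is again an isofibration.
-- Carrying the isofibration along makes the limit of the tower available.
open HomotopicalAlgebra in
lemma exists_strictLimit_attachCells (H : InftyCosmos.{w} K) {V W : Weight A} {u : V ⟶ W}
    (c : AttachCells.{w} (projectiveCell (A := A)) u) (S : StrictLimit V F) :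
    ∃ T : StrictLimit W F, H.HasIsofibration u S T := by
  choose R R' r hr hr' using fun i : c.ι ↦ H.exists_strictLimit_cell (F := F)
    ∂Δ[(c.π i).1].ι (c.π i).2
  obtain ⟨P, π, hP⟩ := H.exists_product fun i ↦ (R i).pt
  obtain ⟨P', π', hP'⟩ := H.exists_product fun i ↦ (R' i).pt
  obtain ⟨s, hs⟩ := StrictLimit.exists_restriction c.m
    (StrictLimit.product c.isColimit₁ R hP) (StrictLimit.product c.isColimit₂ R' hP')
  have hs' : H.IsIsofib s := by
    refine H.isofib_product _ _ r P' P π' π s hP' hP (fun i ↦ (R i).arr_ext ?_) hr'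
    refine (congrArg ((R i).cone ≫ ·) (precomp_comp (L' := P) s (π i) F)).trans ?_
    refine (Category.assoc _ _ _).symm.trans ?_
    refine (congrArg (· ≫ precomp s F) (StrictLimit.inj_product c.isColimit₁ R hP i).symm).trans ?_
    refine (Category.assoc _ _ _).trans ((congrArg (c.cofan₁.inj i ≫ ·) hs).trans ?_)
    refine (Category.assoc _ _ _).symm.trans
      ((congrArg (· ≫ (StrictLimit.product c.isColimit₂ R' hP').cone) (c.hm i)).trans ?_)
    refine (Category.assoc _ _ _).trans ((congrArg (projectiveCell (c.π i) ≫ ·)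
      (StrictLimit.inj_product c.isColimit₂ R' hP' i)).trans ?_)
    refine (Category.assoc _ _ _).symm.trans
      ((congrArg (· ≫ precomp (π' i) F) (hr i).symm).trans ?_)
    exact (Category.assoc _ _ _).trans
      (congrArg ((R i).cone ≫ ·) (precomp_comp (π' i) (r i) F).symm)
  obtain ⟨t, ht⟩ := StrictLimit.exists_restriction c.g₁ (StrictLimit.product c.isColimit₁ R hP) S
  obtain ⟨Q, g, q, hQ⟩ := H.exists_pullback s t hs'
  exact ⟨StrictLimit.pullback c.isPushout ht hs hQ, q,
    StrictLimit.isRestriction_pullback c.isPushout ht hs hQ, H.isofib_pullback g q s t hQ hs'⟩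

/-- An `∞`-cosmos has strict limits weighted by flexible weights. -/
lemma exists_strictLimit (H : InftyCosmos.{w} K) {W : Weight A} (hW : IsFlexible W)
    (F : SFunctor A K) : Nonempty (StrictLimit W F) := by
  obtain ⟨E, hE, ⟨c⟩⟩ := hW
  obtain ⟨T, hT⟩ := H.exists_terminal
  choose next hnext using fun k (S : StrictLimit (c.F.obj k) F) ↦
    H.exists_strictLimit_attachCells (c.attachCells k (not_isMax k)) S
  let S (k : ℕ) : StrictLimit (c.F.obj k) F :=
    Nat.rec (StrictLimit.terminal (hE.ofIso c.isoBot.symm) hT) next k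
  choose p hp hp' using fun k ↦ hnext k (S k)
  obtain ⟨L, π, hL⟩ := H.exists_towerLimit (fun k ↦ (S k).pt) p hp'
  exact ⟨StrictLimit.tower c.isColimit S hp hL⟩

end InftyCosmos

section Functoriality

/-- The maps of weighted cones inducing the functoriality of strict limits. -/
def coneMap {V W : Weight A} {F G : SFunctor A K} {L : K} (c : Cone W F L)
    {n : SimplexCategoryᵒᵖ} (α : (Fun.{w} V W).obj n) (κ : (Fun.{w} F G).obj n) :
    (Fun.{w} V (funAlong L G)).obj n :=
  comp α ((preFun c _).app n (funAlongMap L κ))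

namespace StrictLimit

variable {V W : Weight A} {F G : SFunctor A K} (S : StrictLimit W F) (T : StrictLimit V G)

/-- The simplicial functoriality of strict limits. -/
noncomputable def map {n : SimplexCategoryᵒᵖ} (α : (Fun.{w} V W).obj n) (κ : (Fun.{w} F G).obj n) :
    (Fun.{w} S.pt T.pt).obj n :=
  ((T.bijective S.pt n).2 (coneMap S.cone α κ)).choose

lemma comparison_map {n : SimplexCategoryᵒᵖ} (α : (Fun.{w} V W).obj n)
    (κ : (Fun.{w} F G).obj n) :
    (T.cone.comparison S.pt).app n (map S T α κ) = coneMap S.cone α κ :=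
  ((T.bijective S.pt n).2 (coneMap S.cone α κ)).choose_spec

lemma map_leg {n m : SimplexCategoryᵒᵖ} (α : (Fun.{w} V W).obj n)
    (κ : (Fun.{w} F G).obj n) (φ : n ⟶ m) {a : A} (x : (V.obj a).obj m) :
    comp ((Fun.{w} S.pt T.pt).map φ (map S T α κ)) (T.cone.leg x) =
      comp (S.cone.leg (natEval α φ x))
        ((Fun.{w} (F.obj a) (G.obj a)).map φ (SFunctor.component κ a)) :=
  congrArg (fun h ↦ natEval h φ x) (comparison_map S T α κ)

/-- Uniqueness in the universal property makes the chosen limits strictly functorial, although each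
was chosen without regard to the others. -/
lemma eq_map {n : SimplexCategoryᵒᵖ} {α : (Fun.{w} V W).obj n} {κ : (Fun.{w} F G).obj n}
    {f : (Fun.{w} S.pt T.pt).obj n}
    (hf : ∀ (a : A) (m : SimplexCategoryᵒᵖ) (φ : n ⟶ m) (x : (V.obj a).obj m),
      comp ((Fun.{w} S.pt T.pt).map φ f) (T.cone.leg x) =
        comp (S.cone.leg (natEval α φ x))
          ((Fun.{w} (F.obj a) (G.obj a)).map φ (SFunctor.component κ a))) :
    map S T α κ = f :=
  (T.bijective S.pt n).1 ((comparison_map S T α κ).trans (nat_ext fun a m φ x ↦ (hf a m φ x).symm))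

lemma map_map {n m : SimplexCategoryᵒᵖ} (ψ : n ⟶ m) (α : (Fun.{w} V W).obj n)
    (κ : (Fun.{w} F G).obj n) :
    map S T ((Fun.{w} V W).map ψ α) ((Fun.{w} F G).map ψ κ) =
      (Fun.{w} S.pt T.pt).map ψ (map S T α κ) := by
  refine eq_map S T fun a k φ x ↦ ?_
  rw [← Functor.map_comp_apply, map_leg, natEval_map, Functor.map_comp_apply]
  rfl

lemma map_idn (n : SimplexCategoryᵒᵖ) : map S S (idn W n) (idn F n) = idn S.pt n := by
  refine eq_map S S fun a k φ x ↦ ?_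
  rw [SimpCat.map_idn, idn_comp, natEval_idn]
  exact ((congrArg (comp _) (SimpCat.map_idn (F.obj a) φ)).trans (comp_idn _)).symm

lemma map_comp {U : Weight A} {J : SFunctor A K} (R : StrictLimit U J) {n : SimplexCategoryᵒᵖ}
    (α : (Fun.{w} V W).obj n) (κ : (Fun.{w} F G).obj n) (β : (Fun.{w} U V).obj n)
    (μ : (Fun.{w} G J).obj n) :
    map S R (comp β α) (comp κ μ) = comp (map S T α κ) (map T R β μ) := by
  refine eq_map S R fun a k φ x ↦ ?_
  rw [SimpCat.map_comp, comp_assoc, map_leg, ← comp_assoc, map_leg, natEval_comp, comp_assoc]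
  exact congrArg (comp _) (SimpCat.map_comp φ (SFunctor.component κ a) (SFunctor.component μ a)).symm

end StrictLimit

/-- A choice of strict limits weighted by flexible weights is simplicially functorial. -/
noncomputable def FlexibleHolimChoice.ofStrictLimit
    (S : ∀ (W : Flex A) (F : SFunctor A K), StrictLimit W.weight F) : FlexibleHolimChoice A K where
  lim := mkEnrichedFunctor _ _ (fun p ↦ (S p.1.unop p.2).pt)
    (fun {p q _} f ↦ StrictLimit.map (S p.1.unop p.2) (S q.1.unop q.2)
      (V := q.1.unop.weight) (W := p.1.unop.weight) f.1 f.2)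
    (fun φ f ↦ StrictLimit.map_map _ _ φ _ _)
    (fun p n ↦ StrictLimit.map_idn _ n)
    (fun {p q r _} f g ↦ StrictLimit.map_comp (S p.1.unop p.2) (S q.1.unop q.2) (S r.1.unop r.2)
      (V := q.1.unop.weight) (W := p.1.unop.weight) (U := r.1.unop.weight) f.1 f.2 g.1 g.2)
  cone W F := (S W F).cone
  cone_natural {V W F G _ _} α κ φ _ x := StrictLimit.map_leg (S W F) (S V G) α κ φ x
  isHomotopyLimit W F X := by
    have : IsIso ((S W F).cone.comparison X) := by
      rw [NatTrans.isIso_iff_isIso_app]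
      exact fun n ↦ (isIso_iff_bijective _).2 ((S W F).bijective X n)
    exact isEquivalence_of_iso (asIso ((S W F).cone.comparison X))

/-- The core of an `∞`-cosmos has flexible weighted homotopy limits. -/
lemma InftyCosmos.nonempty_flexibleHolimChoice_core (H : InftyCosmos.{w} K) :
    Nonempty (FlexibleHolimChoice A (Core K)) :=
  have : QCatEnriched.{w} K := ⟨H.quasicategory⟩
  ⟨(FlexibleHolimChoice.ofStrictLimit fun W F ↦ (H.exists_strictLimit W.flexible F).some).core⟩

end Functoriality

end SimpCat

theorem mainTheorem6 :
    -- every weight has a levelwise Kan replacement by a projective anodyne extension,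
    -- which is flexible if the given weight is
    (∀ (A : Type w) [EnrichedCategory SSet.{w} A] (W : SimpCat.Weight A),
      ∃ (W' : SimpCat.Weight A) (u : W ⟶ W'), SimpCat.IsLevelwiseKan W' ∧
        SimpCat.IsProjectiveAnodyne u ∧ (SimpCat.IsFlexible W → SimpCat.IsFlexible W')) ∧
    -- homotopy limits in the core are computed by levelwise Kan replacement of the weight
    (∀ (K : Type u) [EnrichedCategory SSet.{w} K] [SimpCat.QCatEnriched.{w} K]
      (A : Type w) [EnrichedCategory SSet.{w} A] (W W' : SimpCat.Weight A) (u : W ⟶ W')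
      (F : SimpCat.SFunctor A (SimpCat.Core K)) (L : K) (c : SimpCat.Cone W' F.toBase L),
      SimpCat.IsFlexible W → SimpCat.IsProjectiveAnodyne u → SimpCat.IsLevelwiseKan W' →
      c.IsHomotopyLimit →
      ∃ d : SimpCat.Cone W' F (SimpCat.Core.mk L),
        d ≫ SimpCat.funAlongInclusion (SimpCat.Core.mk L) F = c ∧
        SimpCat.Cone.IsHomotopyLimit (W := W) (F := F) (L := SimpCat.Core.mk L) (u ≫ d)) ∧
    -- a functorial choice of flexible weighted homotopy limits passes to the core
    (∀ (K : Type u) [EnrichedCategory SSet.{w} K] [SimpCat.QCatEnriched.{w} K],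
      ∀ (A : Type w) [EnrichedCategory SSet.{w} A],
        Nonempty (SimpCat.FlexibleHolimChoice A K) →
        Nonempty (SimpCat.FlexibleHolimChoice A (SimpCat.Core K))) ∧
    -- the core of an ∞-cosmos has a functorial choice of flexible weighted homotopy limits
    (∀ (K : Type u) [EnrichedCategory SSet.{w} K], SimpCat.InftyCosmos.{w} K →
      ∀ (A : Type w) [EnrichedCategory SSet.{w} A],
        Nonempty (SimpCat.FlexibleHolimChoice A (SimpCat.Core K))) := by
  refine ⟨fun A _ W ↦ SimpCat.exists_projectiveAnodyne W, ?_, ?_, ?_⟩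
  · intro K _ _ A _ W W' u F L c hW hu hW' hc
    exact SimpCat.exists_coneLift_isHomotopyLimit hW hu hW' hc
  · exact fun K _ _ A _ ⟨H⟩ ↦ ⟨H.core⟩
  · exact fun K _ H A _ ↦ H.nonempty_flexibleHolimChoice_core
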